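/- Let $n\ge 1$ and let $V=\mathbb{C}^{2n}$ have coordinate basis $q_1,\dots,q_n,p_1,\dots,p_n$ and symplectic form $\omega=\sum_k dq^k\wedge dp_k$. Let $\mathfrak g^{\mathbb C}=\mathfrak{sp}(2n,\mathbb{C})$ be the complexified Lie algebra of $Sp(2n,\mathbb{R})$, consisting of the matrices $X=\begin{pmatrix}A&B\\ C&-A^t\end{pmatrix}$ with $B=B^t$, $C=C^t$. **The module $\Lambda^\bullet V^*\otimes S$.** Let $S=\mathcal S(\mathbb{R}^n)$ be the Schwartz space, on which $\mathfrak g^{\mathbb C}$ acts by the differential of the Segal–Shale–Weil representation, $$\sigma_*(X)=\frac1{4\pi\imath}\sum_{i,j}B_{ij}\partial_i\partial_j-\pi\imath\sum_{i,j}C_{ij}x^ix^j-\sum_{i,j}A_{ij}x^j\partial_i-\tfrac12\sum_iA_{ii}.$$ Let $S_\pm$ be the subspaces of even and odd functions and $S_K\subset S$ the subspace of polynomials times $e^{-\pi|x|^2}$ (the span of the Hermite functions). Let $v\cdot s$ be the symplectic spinor multiplication given by $q_k\cdot s=\frac{1}{\imath\sqrt{2\pi}}\partial_ks$ and $p_k\cdot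 s=\sqrt{2\pi}\,x^ks$; thus, in the symplectic basis $\frac{\imath}{\sqrt{2\pi}}p_k,\ \imath\sqrt{2\pi}\,q_k$ of $V$, it is given by $\imath x^k$ and $\partial_k$. Let $\mathfrak g^{\mathbb C}$ act on $E=\Lambda^\bullet V^*\otimes S$ by the tensor product $\sigma$ of its natural action on forms and $\sigma_*$. Grade $E$ modulo $2$ by the degree of forms, and put $E_K=\Lambda^\bullet V^*\otimes S_K$. **The Lie superalgebra.** $\mathfrak{osp}(1|2)$ has the basis $e^\pm,h$ (even), $f^\pm$ (odd), and the brackets $[h,e^\pm]=\pm e^\pm$, $[h,f^\pm]=\pm\frac12f^\pm$, $[e^\pm,f^\mp]=-f^\pm$, $[e^\pm,f^\pm]=0$, $[e^+,e^-]=2h$, $\{f^+,f^-\}=\frac12h$, $\{f^\pm,f^\pm\}=\pm\frac12e^\pm$, where $\{a,b\}=ab+ba$. Let $(e_a)_{a=1}^{2n}$ be any symplectic basis of $V$, i.e. $\omega(e_a,e_b)=\omega_{ab}$ with $\omega_{ab}=\delta_{a,2n+1-b}$ for $a\le n$ and $\omega_{ab}=-\delta_{a,2n+1-b}$ for $a>n$.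 Let $(\epsilon^a)$ be its dual basis and let $\sum_c\omega_{ac}\omega^{bc}=\delta_a^b$. Define $\rho:\mathfrak{osp}(1|2)\to\mathrm{End}(E)$ by $$\rho(f^+)(\alpha\otimes s)=\frac{\imath}{2}\sum_a\epsilon^a\wedge\alpha\otimes e_a\cdot s,\qquad\rho(f^-)(\alpha\otimes s)=\frac12\sum_{a,b}\omega^{ab}\iota_{e_a}\alpha\otimes e_b\cdot s,$$ $\rho(e^\pm)=\pm2\{\rho(f^\pm),\rho(f^\pm)\}$, $\rho(h)=\frac12[\rho(e^+),\rho(e^-)]$. **The modules $E^{ii}_\pm$.** Let $H_k\in\mathfrak g^{\mathbb C}$ ($1\le k\le n$) be given by $q_k\mapsto-\imath p_k$, $p_k\mapsto\imath q_k$, and zero on the other basis vectors. The $H_k$ span a Cartan subalgebra; let $(\varepsilon_k)$ be the dual basis to $(H_k)$ and take $\varepsilon_i-\varepsilon_j$ ($i<j$), $\varepsilon_i+\varepsilon_j$ ($i\le j$) as positive roots. Let $L(\lambda_1,\dots,\lambda_n)$ be the irreducible highest weight module with highest weight $\sum_k\lambda_k\varepsilon_k$. For $0\le i<n$ put $$E^{ii}_+=L(\underbrace{\tfrac12,\dots,\tfrac12}_{i},\underbrace{-\tfrac12,\dots,-\tfrac12}_{n-i}),\qquad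 E^{ii}_-=L(\underbrace{\tfrac12,\dots,\tfrac12}_{i},\underbrace{-\tfrac12,\dots,-\tfrac12}_{n-i-1},-\tfrac32),$$ and put $E^{nn}_+=L(\frac12,\dots,\frac12)$, $E^{nn}_-=L(\frac12,\dots,\frac12,-\frac52)$. **The modules $F_i$.** For $0\le i\le n$ let $F_i=\mathbb{C}^{2n-2i+1}$ have the basis $(b_j)_{j=i}^{2n-i}$, with $b_j$ of parity $j$ and $b_j=0$ for $j$ out of range. Put $$\rho_i(f^+)b_j=A(n,i,j+1)b_{j+1},\quad\rho_i(f^-)b_j=b_{j-1},\quad\rho_i(h)=2\{\rho_i(f^+),\rho_i(f^-)\},\quad\rho_i(e^\pm)=\pm2\{\rho_i(f^\pm),\rho_i(f^\pm)\},$$ where $A(n,i,j)=\frac{(-1)^{i-j}+1}{16}(j-i)+\frac{(-1)^{i-j+1}+1}{16}(i+j-2n-1)$. **Theorem.** The map $\sigma$ is a representation of $\mathfrak g^{\mathbb C}$, the maps $\rho$ and $\rho_i$ are representations of the Lie superalgebra $\mathfrak{osp}(1|2)$ on the superspaces $E$ and $F_i$, and $\sigma$ commutes with $\rho$. Moreover: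 1. $E_K$ is invariant under $\sigma$ and $\rho$, and there is a parity-preserving isomorphism of $\mathfrak g^{\mathbb C}\times\mathfrak{osp}(1|2)$-modules $$\Lambda^\bullet V^*\otimes S_K=E_K\;\simeq\;\bigoplus_{i=0}^n(E^{ii}_+\otimes F_i)\oplus\bigoplus_{i=0}^n(E^{ii}_-\otimes F_i),$$ where $\mathfrak g^{\mathbb C}$ acts on the first tensor factors, which are purely even, and $\mathfrak{osp}(1|2)$ acts on the second ones by $\rho_i$. 2. The same holds for the Schwartz space $S$, with the $E^{ii}_\pm$ replaced by globalizations: there are $\mathfrak g^{\mathbb C}$-submodules $\mathcal W^{ii}_\pm\subset\Lambda^iV^*\otimes S_\pm$ of $E$ with $\mathcal W^{ii}_\pm\cap E_K\simeq E^{ii}_\pm$ as $\mathfrak g^{\mathbb C}$-modules, and a parity-preserving isomorphism of $\mathfrak g^{\mathbb C}\times\mathfrak{osp}(1|2)$-modules $$\Lambda^\bullet V^*\otimes S\;\simeq\;\bigoplus_{i=0}^n(\mathcal W^{ii}_+\otimes F_i)\oplus\bigoplus_{i=0}^n(\mathcal W^{ii}_-\otimes F_i).$$ -/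

import Mathlib

open scoped TensorProduct DirectSum SchwartzMap
open Complex

noncomputable section

namespace SympHowe

/-! ### The symplectic Lie algebra, its weights and its irreducible highest weight modules -/

/-- The complexified symplectic vector space, with coordinates `v (inl k)` along `q_k` and
`v (inr k)` along `p_k`. -/
abbrev V (n : ℕ) : Type := Fin n ⊕ Fin n → ℂ

/-- The symplectic form `∑ dq^k ∧ dp_k`. -/
def omega (n : ℕ) (v w : V n) : ℂ :=
  ∑ k, (v (Sum.inl k) * w (Sum.inr k) - v (Sum.inr k) * w (Sum.inl k))

/-- The complexification `sp(2n, ℂ)` of the Lie algebra of `Sp(2n, ℝ)`: the block matrices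
`(A, B; C, -Aᵗ)` with `B` and `C` symmetric. -/
abbrev G (n : ℕ) : Type := LieAlgebra.Symplectic.sp (Fin n) ℂ

/-- The inclusion of `sp(2n, ℂ)` into the matrices. -/
def toMat (n : ℕ) : G n →ₗ[ℂ] Matrix (Fin n ⊕ Fin n) (Fin n ⊕ Fin n) ℂ where
  toFun X := X.1
  map_add' _ _ := rfl
  map_smul' _ _ := rfl

/-- The matrix of `-i` times the rotation `q_k ↦ p_k, p_k ↦ -q_k` of the `k`-th coordinate plane. -/
def cartanMatrix {n : ℕ} (k : Fin n) : Matrix (Fin n ⊕ Fin n) (Fin n ⊕ Fin n) ℂ :=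
  Matrix.fromBlocks 0 (Matrix.single k k I) (Matrix.single k k (-I)) 0

theorem cartanMatrix_mem {n : ℕ} (k : Fin n) :
    cartanMatrix k ∈ LieAlgebra.Symplectic.sp (Fin n) ℂ := by
  simp [LieAlgebra.Symplectic.sp, mem_skewAdjointMatricesLieSubalgebra,
    mem_skewAdjointMatricesSubmodule, Matrix.IsSkewAdjoint, Matrix.IsAdjointPair,
    cartanMatrix, Matrix.J, Matrix.fromBlocks_transpose, Matrix.fromBlocks_multiply,
    Matrix.fromBlocks_neg]

/-- The basis `H_1, …, H_n` of the (complexified compact) Cartan subalgebra. The dual basis of the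
Cartan subalgebra is denoted `ε_1, …, ε_n`. -/
def H {n : ℕ} (k : Fin n) : G n := ⟨cartanMatrix k, cartanMatrix_mem k⟩

/-- `X` is a vector of weight `∑ μ_k ε_k` for the adjoint action of the Cartan subalgebra. -/
def HasRoot {n : ℕ} (X : G n) (μ : Fin n → ℂ) : Prop := ∀ k, ⁅H k, X⁆ = μ k • X

/-- The positive roots `ε_i - ε_j` (`i < j`) and `ε_i + ε_j` (`i ≤ j`). -/
def PosRoots (n : ℕ) : Set (Fin n → ℂ) :=
  {μ | ∃ i j : Fin n, i < j ∧ μ = Pi.single i 1 - Pi.single j 1} ∪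
  {μ | ∃ i j : Fin n, i ≤ j ∧ μ = Pi.single i 1 + Pi.single j 1}

/-- The universal enveloping algebra. -/
abbrev U (n : ℕ) : Type := UniversalEnvelopingAlgebra ℂ (G n)

/-- The left ideal by which the Verma module of highest weight `∑ lam_k ε_k` is the quotient
of `U`. -/
def vermaIdeal {n : ℕ} (lam : Fin n → ℂ) : Submodule (U n) (U n) :=
  Submodule.span (U n)
    ({u | ∃ X : G n, (∃ μ ∈ PosRoots n, HasRoot X μ) ∧
        u = UniversalEnvelopingAlgebra.ι ℂ X} ∪
     {u | ∃ k : Fin n, u = UniversalEnvelopingAlgebra.ι ℂ (H k) - algebraMap ℂ (U n) (lam k)})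

/-- The preimage in `U` of the sum of all proper submodules of the Verma module. -/
def maxIdeal {n : ℕ} (lam : Fin n → ℂ) : Submodule (U n) (U n) :=
  sSup {N | vermaIdeal lam ≤ N ∧ N ≠ ⊤}

/-- The irreducible highest weight module `L(lam)` with highest weight `∑ lam_k ε_k`: the Verma
module modulo the sum of its proper submodules. -/
abbrev L {n : ℕ} (lam : Fin n → ℂ) : Type := U n ⧸ maxIdeal lam

/-- The action of the symplectic Lie algebra on `L(lam)`. -/
def actL {n : ℕ} (lam : Fin n → ℂ) (X : G n) : Module.End ℂ (L lam) :=
  Algebra.lsmul ℂ ℂ (L lam) (UniversalEnvelopingAlgebra.ι ℂ X)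

/-- The highest weight of the higher symplectic spinor module `E^{ij}_±` (`j ≤ i ≤ n`); the sign is
encoded as `s = sgn(±)`, that is, `0` for `+` and `1` for `-`. -/
def spinorWeight (n i j : ℕ) (s : Fin 2) : Fin n → ℂ := fun k =>
  if i = n ∧ j = n then
    (if (k : ℕ) + 1 = n ∧ s = 1 then -5 / 2 else 1 / 2)
  else if (k : ℕ) < j then 1 / 2
  else if (k : ℕ) + 1 < n then -1 / 2
  else -1 + 1 / 2 * (-1) ^ (i + j + (s : ℕ))

/-- The higher symplectic spinor module `E^{ii}_±`. -/
abbrev Eii (n i : ℕ) (s : Fin 2) : Type := L (spinorWeight n i i s)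

/-! ### Symplectic spinors -/

/-- The Schwartz space on `ℝ^n`. -/
abbrev S (n : ℕ) : Type := 𝓢(EuclideanSpace ℝ (Fin n), ℂ)

/-- Multiplication by the coordinate function `x^k`. -/
def mulX {n : ℕ} (k : Fin n) : Module.End ℂ (S n) :=
  (SchwartzMap.smulLeftCLM ℂ (fun x : EuclideanSpace ℝ (Fin n) => (x k : ℂ))).toLinearMap

theorem mulX_apply {n : ℕ} (k : Fin n) (s : S n) (x : EuclideanSpace ℝ (Fin n)) :
    mulX k s x = (x k : ℂ) * s x := by
  have h : (fun x : EuclideanSpace ℝ (Fin n) => (x k : ℂ)).HasTemperateGrowth :=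
    (Complex.ofRealCLM.comp (EuclideanSpace.proj k)).hasTemperateGrowth
  simp [mulX, SchwartzMap.smulLeftCLM_apply_apply h]

/-- The partial derivative `∂/∂x^k`. -/
def derX {n : ℕ} (k : Fin n) : Module.End ℂ (S n) :=
  (LineDeriv.lineDerivOpCLM ℂ (S n)
    (EuclideanSpace.single k (1 : ℝ) : EuclideanSpace ℝ (Fin n))).toLinearMap

/-- The matrix entries of an element of `sp(2n, ℂ)`, as linear functionals. -/
def entry {n : ℕ} (a c : Fin n ⊕ Fin n) : G n →ₗ[ℂ] ℂ :=
  Matrix.entryLinearMap ℂ ℂ a c ∘ₗ toMat n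

/-- The differential `σ_*` of the Segal-Shale-Weil representation, extended complex linearly: the
matrix `X = (A, B; C, -Aᵗ)` acts by
`(1/(4πi)) ∑ B_{ij} ∂_i ∂_j - π i ∑ C_{ij} x^i x^j - ∑ A_{ij} x^j ∂_i - (1/2) ∑ A_{ii}`. -/
def sigmaS (n : ℕ) : G n →ₗ[ℂ] Module.End ℂ (S n) :=
  ((1 : ℂ) / (4 * Real.pi * I)) •
      (∑ i, ∑ j, (entry (Sum.inl i) (Sum.inr j)).smulRight (derX i * derX j)) -
    (Real.pi * I : ℂ) •
      (∑ i, ∑ j, (entry (Sum.inr i) (Sum.inl j)).smulRight (mulX i * mulX j)) -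
    (∑ i, ∑ j, (entry (Sum.inl i) (Sum.inl j)).smulRight (mulX j * derX i)) -
    (1 / 2 : ℂ) • (∑ i, (entry (Sum.inl i) (Sum.inl i)).smulRight 1)

/-- The symplectic spinor multiplication `V × S → S`, given by
`q_k · s = (1 / (i √(2π))) ∂s/∂x^k` and `p_k · s = √(2π) x^k s`. -/
def cliff (n : ℕ) : V n →ₗ[ℂ] Module.End ℂ (S n) :=
  ∑ k, ((LinearMap.proj (Sum.inl k)).smulRight
        ((1 / (I * (Real.sqrt (2 * Real.pi) : ℂ))) • derX k) +
      (LinearMap.proj (Sum.inr k)).smulRight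
        ((Real.sqrt (2 * Real.pi) : ℂ) • mulX k))

/-- The subspace of `S` of polynomials times the Gaussian `exp (-π |x|²)`. -/
def SK (n : ℕ) : Submodule ℂ (S n) where
  carrier := {s | ∃ P : MvPolynomial (Fin n) ℂ, ∀ x : EuclideanSpace ℝ (Fin n),
    s x = MvPolynomial.eval (fun k => (x k : ℂ)) P * Real.exp (-Real.pi * ‖x‖ ^ 2)}
  add_mem' := by
    rintro s t ⟨P, hP⟩ ⟨Q, hQ⟩
    exact ⟨P + Q, fun x => by simp only [add_apply, hP, hQ, map_add, add_mul]⟩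
  zero_mem' := ⟨0, fun x => by simp⟩
  smul_mem' := by
    rintro c s ⟨P, hP⟩
    exact ⟨c • P, fun x => by
      simp only [smul_apply, hP, MvPolynomial.smul_eval, smul_eq_mul, mul_assoc]⟩

/-- The even (`s = 0`) and the odd (`s = 1`) Schwartz functions. -/
def Spar (n : ℕ) (s : Fin 2) : Submodule ℂ (S n) where
  carrier := {f | ∀ x, f (-x) = (-1) ^ (s : ℕ) * f x}
  add_mem' := by
    intro f g hf hg x
    simp only [add_apply, hf x, hg x, mul_add]
  zero_mem' := fun x => by simp
  smul_mem' := by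
    intro c f hf x
    simp only [smul_apply, hf x, smul_eq_mul]
    ring

/-! ### Exterior forms with values in symplectic spinors -/

/-- The exterior algebra of `V^*`. -/
abbrev Forms (n : ℕ) : Type := ExteriorAlgebra ℂ (Module.Dual ℂ (V n))

/-- Exterior multiplication `ε ∧ ·` by a one-form. -/
def wedge {n : ℕ} : Module.Dual ℂ (V n) →ₗ[ℂ] Module.End ℂ (Forms n) :=
  LinearMap.mul ℂ (Forms n) ∘ₗ ExteriorAlgebra.ι ℂ

/-- The contraction `ι_v` by a vector. -/
def contract {n : ℕ} (v : V n) : Module.End ℂ (Forms n) :=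
  CliffordAlgebra.contractLeft (Q := (0 : QuadraticForm ℂ (Module.Dual ℂ (V n))))
    (Module.Dual.eval ℂ (V n) v)

/-- The dual action on `V^*`: `(X ε)(v) = - ε (X v)`. -/
def dualAct {n : ℕ} (ε : Module.Dual ℂ (V n)) : G n →ₗ[ℂ] Module.Dual ℂ (V n) :=
  -(LinearMap.compRight ℂ ε ∘ₗ Matrix.toLin'.toLinearMap ∘ₗ
    toMat n)

theorem dualAct_apply {n : ℕ} (ε : Module.Dual ℂ (V n)) (X : G n) (v : V n) :
    dualAct ε X v = -ε ((toMat n X).mulVec v) := rfl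

/-- The action on exterior forms, that is, the derivation extending the dual action on `V^*`,
written as `∑ (X ε^a) ∧ ι_{e_a}` in the standard basis. -/
def actForms (n : ℕ) : G n →ₗ[ℂ] Module.End ℂ (Forms n) :=
  ∑ a, (LinearMap.mulRight ℂ (contract (Pi.single a 1))) ∘ₗ wedge ∘ₗ
    dualAct (LinearMap.proj a)

theorem actForms_apply {n : ℕ} (X : G n) (w : Forms n) :
    actForms n X w = ∑ a, ExteriorAlgebra.ι ℂ (dualAct (LinearMap.proj a) X) *
      contract (Pi.single a 1) w := by
  simp [actForms, wedge]

theorem actForms_one {n : ℕ} (X : G n) : actForms n X 1 = 0 := by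
  simp [actForms_apply, contract]

theorem actForms_ι_mul {n : ℕ} (X : G n) (ε : Module.Dual ℂ (V n)) (w : Forms n) :
    actForms n X (ExteriorAlgebra.ι ℂ ε * w) =
      ExteriorAlgebra.ι ℂ (dualAct ε X) * w + ExteriorAlgebra.ι ℂ ε * actForms n X w := by
  have hX : dualAct ε X = ∑ a, ε (Pi.single a 1) • dualAct (LinearMap.proj a) X := by
    refine LinearMap.ext fun v => ?_
    simp only [dualAct_apply, LinearMap.sum_apply, LinearMap.smul_apply, LinearMap.proj_apply,
      smul_eq_mul, mul_neg, Finset.sum_neg_distrib]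
    congr 1
    conv_lhs => rw [LinearMap.pi_apply_eq_sum_univ ε ((toMat n X).mulVec v)]
    refine Finset.sum_congr rfl fun a _ => ?_
    rw [smul_eq_mul, mul_comm]
    congr 2
    ext c
    simp [Pi.single_apply, eq_comm]
  have hs (x y : Module.Dual ℂ (V n)) (u : Forms n) :
      ExteriorAlgebra.ι ℂ x * (ExteriorAlgebra.ι ℂ y * u) =
        -(ExteriorAlgebra.ι ℂ y * (ExteriorAlgebra.ι ℂ x * u)) := by
    rw [← mul_assoc, ← mul_assoc, ← neg_mul]
    congr 1
    exact eq_neg_of_add_eq_zero_left (ExteriorAlgebra.ι_add_mul_swap x y)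
  have hc (a : Fin n ⊕ Fin n) : contract (Pi.single a (1 : ℂ)) (ExteriorAlgebra.ι ℂ ε * w) =
      ε (Pi.single a 1) • w - ExteriorAlgebra.ι ℂ ε * contract (Pi.single a (1 : ℂ)) w :=
    CliffordAlgebra.contractLeft_ι_mul _ _ _
  simp only [actForms_apply, hc, hX, map_sum, map_smul, Finset.mul_sum, Finset.sum_mul,
    ← Finset.sum_add_distrib, mul_sub, smul_mul_assoc, mul_smul_comm]
  refine Finset.sum_congr rfl fun a _ => ?_
  rw [hs, sub_neg_eq_add]

/-- The space `E = Λ V^* ⊗ S`. -/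
abbrev E (n : ℕ) : Type := Forms n ⊗[ℂ] S n

/-- The tensor product action `σ(X)(α ⊗ s) = X α ⊗ s + α ⊗ σ_*(X) s` on `E`. -/
def sigmaE (n : ℕ) (X : G n) : Module.End ℂ (E n) :=
  TensorProduct.map (actForms n X) LinearMap.id + TensorProduct.map LinearMap.id (sigmaS n X)

/-- The image in `E` of `A ⊗ B`, for subspaces `A` of `Λ V^*` and `B` of `S`. -/
def tensorSub {n : ℕ} (A : Submodule ℂ (Forms n)) (B : Submodule ℂ (S n)) :
    Submodule ℂ (E n) :=
  LinearMap.range (TensorProduct.map A.subtype B.subtype)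

/-- The subspace `Λ V^* ⊗ S_K` of `E`. -/
def EK (n : ℕ) : Submodule ℂ (E n) := tensorSub ⊤ (SK n)

/-- The even and odd parts of `E`: forms of even and of odd degree. -/
def gradeE (n : ℕ) (p : ZMod 2) : Submodule ℂ (E n) :=
  ⨆ (k : ℕ) (_ : (k : ZMod 2) = p), tensorSub (⋀[ℂ]^k (Module.Dual ℂ (V n))) ⊤

/-! ### The Lie superalgebra `osp(1|2)` -/

/-- The generators `e^+, e^-, h, f^+, f^-`. -/
inductive OspGen : Type
  | eP | eM | h0 | fP | fM
  deriving DecidableEq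

open OspGen

instance : Fintype OspGen := ⟨{eP, eM, h0, fP, fM}, by intro x; cases x <;> simp⟩

/-- The underlying vector space of `osp(1|2)`. -/
abbrev Osp : Type := OspGen → ℂ

/-- The basis vector of `osp(1|2)` given by a generator. -/
def gen (a : OspGen) : Osp := Pi.single a 1

/-- `e^+, e^-, h` are even and `f^+, f^-` are odd. -/
def ospParity : OspGen → ℕ
  | eP => 0 | eM => 0 | h0 => 0 | fP => 1 | fM => 1

/-- The superbracket on the generators. -/
def ospBracket : OspGen → OspGen → Osp
  | h0, eP => gen eP
  | eP, h0 => -gen eP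
  | h0, eM => -gen eM
  | eM, h0 => gen eM
  | h0, fP => (1 / 2 : ℂ) • gen fP
  | fP, h0 => -((1 / 2 : ℂ) • gen fP)
  | h0, fM => -((1 / 2 : ℂ) • gen fM)
  | fM, h0 => (1 / 2 : ℂ) • gen fM
  | eP, fM => -gen fP
  | fM, eP => gen fP
  | eM, fP => -gen fM
  | fP, eM => gen fM
  | eP, eM => (2 : ℂ) • gen h0
  | eM, eP => -((2 : ℂ) • gen h0)
  | fP, fM => (1 / 2 : ℂ) • gen h0
  | fM, fP => (1 / 2 : ℂ) • gen h0
  | fP, fP => (1 / 2 : ℂ) • gen eP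
  | fM, fM => -((1 / 2 : ℂ) • gen eM)
  | _, _ => 0

/-- `R` is a representation of the Lie superalgebra `osp(1|2)` on the superspace `M` with even part
`gr 0` and odd part `gr 1`. -/
structure IsOspRep {M : Type*} [AddCommGroup M] [Module ℂ M] (gr : ZMod 2 → Submodule ℂ M)
    (R : Osp →ₗ[ℂ] Module.End ℂ M) : Prop where
  isCompl : IsCompl (gr 0) (gr 1)
  parity : ∀ (a : OspGen) (p : ZMod 2), ∀ m ∈ gr p, R (gen a) m ∈ gr (p + (ospParity a : ZMod 2))
  bracket : ∀ a b : OspGen,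
    R (gen a) * R (gen b) - (-1 : ℂ) ^ (ospParity a * ospParity b) • (R (gen b) * R (gen a)) =
      R (ospBracket a b)

/-- The anticommutator. -/
def anti {A : Type*} [Ring A] (a b : A) : A := a * b + b * a

/-- The linear map on `osp(1|2)` with the given values on the generators. -/
def ospLift {M : Type*} [AddCommGroup M] [Module ℂ M] (r : OspGen → Module.End ℂ M) :
    Osp →ₗ[ℂ] Module.End ℂ M :=
  (Pi.basisFun ℂ OspGen).constr ℂ r

/-! ### The action of `osp(1|2)` on `E` -/

/-- The matrix `(ω_{ab})` of the symplectic form in a symplectic basis. A symplectic basis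
`e_1, …, e_{2n}` is indexed so that `inl k` stands for the index `k` and `inr k` for the index
`2n + 1 - k`. Since `∑_c ω_{ac} ω_{bc} = δ_{ab}`, this is also the matrix `(ω^{ab})`. -/
def omegaMat (n : ℕ) : Matrix (Fin n ⊕ Fin n) (Fin n ⊕ Fin n) ℂ := Matrix.fromBlocks 0 1 (-1) 0

theorem omegaMat_mul_transpose (n : ℕ) : omegaMat n * (omegaMat n).transpose = 1 := by
  simp [omegaMat, Matrix.fromBlocks_transpose, Matrix.fromBlocks_multiply]

/-- Symplectic bases of the complexified symplectic vector space. -/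
def IsSymplecticBasis {n : ℕ} (e : Module.Basis (Fin n ⊕ Fin n) ℂ (V n)) : Prop :=
  ∀ a b, omega n (e a) (e b) = omegaMat n a b

/-- `ρ(f^+)(α ⊗ s) = (i/2) ∑ ε^a ∧ α ⊗ e_a · s`. -/
def rhoFp {n : ℕ} (e : Module.Basis (Fin n ⊕ Fin n) ℂ (V n)) : Module.End ℂ (E n) :=
  (I / 2) • ∑ a, TensorProduct.map (wedge (e.coord a)) (cliff n (e a))

/-- `ρ(f^-)(α ⊗ s) = (1/2) ∑ ω^{ab} ι_{e_a} α ⊗ e_b · s`. -/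
def rhoFm {n : ℕ} (e : Module.Basis (Fin n ⊕ Fin n) ℂ (V n)) : Module.End ℂ (E n) :=
  (1 / 2 : ℂ) • ∑ a, ∑ b, omegaMat n a b • TensorProduct.map (contract (e a)) (cliff n (e b))

/-- `ρ(e^+) = 2 {ρ(f^+), ρ(f^+)}`. -/
def rhoEp {n : ℕ} (e : Module.Basis (Fin n ⊕ Fin n) ℂ (V n)) : Module.End ℂ (E n) :=
  (2 : ℂ) • anti (rhoFp e) (rhoFp e)

/-- `ρ(e^-) = -2 {ρ(f^-), ρ(f^-)}`. -/
def rhoEm {n : ℕ} (e : Module.Basis (Fin n ⊕ Fin n) ℂ (V n)) : Module.End ℂ (E n) :=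
  -((2 : ℂ) • anti (rhoFm e) (rhoFm e))

/-- The map `ρ : osp(1|2) → End(E)`, with `ρ(h) = (1/2) [ρ(e^+), ρ(e^-)]`. -/
def rho {n : ℕ} (e : Module.Basis (Fin n ⊕ Fin n) ℂ (V n)) : Osp →ₗ[ℂ] Module.End ℂ (E n) :=
  ospLift fun
    | eP => rhoEp e
    | eM => rhoEm e
    | h0 => (1 / 2 : ℂ) • (rhoEp e * rhoEm e - rhoEm e * rhoEp e)
    | fP => rhoFp e
    | fM => rhoFm e

/-! ### The modules `F_i` -/

/-- The space `F_i = ℂ^{2n-2i+1}`, with coordinates indexed by `j = i, …, 2n - i`. -/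
abbrev F (n i : ℕ) : Type := Finset.Icc (i : ℤ) (2 * n - i) → ℂ

/-- The basis `b_j` (`i ≤ j ≤ 2n - i`) of `F_i`; `b_j = 0` if `j` is out of range. -/
def b (n i : ℕ) (j : ℤ) : F n i :=
  if hj : j ∈ Finset.Icc (i : ℤ) (2 * n - i) then Pi.single ⟨j, hj⟩ 1 else 0

/-- The coefficients `A(n,i,j)`. -/
def A (n i : ℕ) (j : ℤ) : ℂ :=
  ((-1) ^ ((i : ℤ) - j) + 1) / 16 * (j - i) +
    ((-1) ^ ((i : ℤ) - j + 1) + 1) / 16 * (i + j - 2 * n - 1)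

/-- `ρ_i(f^+) b_j = A(n,i,j+1) b_{j+1}`. -/
def rhoIFp (n i : ℕ) : Module.End ℂ (F n i) :=
  (Pi.basisFun ℂ _).constr ℂ fun j => A n i (j + 1) • b n i (j + 1)

/-- `ρ_i(f^-) b_j = b_{j-1}`. -/
def rhoIFm (n i : ℕ) : Module.End ℂ (F n i) :=
  (Pi.basisFun ℂ _).constr ℂ fun j => b n i (j - 1)

/-- The map `ρ_i : osp(1|2) → End(F_i)`. -/
def rhoI (n i : ℕ) : Osp →ₗ[ℂ] Module.End ℂ (F n i) :=
  ospLift fun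
    | eP => (2 : ℂ) • anti (rhoIFp n i) (rhoIFp n i)
    | eM => -((2 : ℂ) • anti (rhoIFm n i) (rhoIFm n i))
    | h0 => (2 : ℂ) • anti (rhoIFp n i) (rhoIFm n i)
    | fP => rhoIFp n i
    | fM => rhoIFm n i

/-- The even and odd parts of `F_i`: `b_j` has the parity of `j`. -/
def gradeF (n i : ℕ) (p : ZMod 2) : Submodule ℂ (F n i) :=
  Submodule.span ℂ {f | ∃ j : ℤ, (j : ZMod 2) = p ∧ f = b n i j}

/-- The subspace `P` of `E` is a `sp(2n, ℂ)`-submodule isomorphic to `E^{ii}_±`. -/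
def IsEii {n : ℕ} (i : ℕ) (s : Fin 2) (P : Submodule ℂ (E n)) : Prop :=
  ∃ φ : Eii n i s ≃ₗ[ℂ] P, ∀ (X : G n) (m : Eii n i s),
    (φ (actL (spinorWeight n i i s) X m)).1 = sigmaE n X (φ m).1

/-! ### Direct sums of modules `M_a ⊗ F_i` over all pairs `a = (±, i)`, `i = 0, …, n` -/

/-- The pairs `(sgn(±), i)` with `0 ≤ i ≤ n`. -/
abbrev Idx (n : ℕ) : Type := Fin 2 × Fin (n + 1)

variable {n : ℕ} (M : Idx n → Type) [∀ a, AddCommGroup (M a)] [∀ a, Module ℂ (M a)]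

/-- The direct sum of the `M_a ⊗ F_i`. -/
abbrev SumF : Type := ⨁ a : Idx n, M a ⊗[ℂ] F n a.2

/-- The endomorphism `⊕ (T_a ⊗ 1)`. -/
def sumLeft (T : ∀ a, Module.End ℂ (M a)) : Module.End ℂ (SumF M) :=
  DirectSum.lmap fun a => TensorProduct.map (T a) LinearMap.id

/-- The action `⊕ (1 ⊗ ρ_i(y))` of `osp(1|2)`. -/
def sumOsp (y : Osp) : Module.End ℂ (SumF M) :=
  DirectSum.lmap fun a => TensorProduct.map LinearMap.id (rhoI n a.2 y)

/-- The even and odd parts, each `M_a` being purely even. -/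
def gradeSum (p : ZMod 2) : Submodule ℂ (SumF M) :=
  ⨆ a : Idx n, (LinearMap.range
    (TensorProduct.map (LinearMap.id : M a →ₗ[ℂ] M a) (gradeF n a.2 p).subtype)).map
      (DirectSum.lof ℂ (Idx n) (fun a => M a ⊗[ℂ] F n a.2) a)

end SympHowe

end

open SympHowe

/-!
The proof identifies `E` with a module over `n` bosonic and `2n` fermionic oscillators. With
`A_k = (q_k + i p_k) / 2` and `B_k = (q_k - i p_k) / 2`, the spinor multiplications by `A_k` and `B_k`
are multiples of the creation and annihilation operators `z_k`, `d_k` of the Gaussian, while exterior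
multiplications and contractions are the fermionic operators. The Lie algebra `sp(2n)` is spanned by
elements `T u v`, which act by quadratic expressions in the oscillators (`sigmaE_BB`, `sigmaE_BA`),
and `ρ(f^+)`, `ρ(f^-)` are multiples of the quadratic operators `D'` and `D` (`rhoFp_eq`, `rhoFm_eq`).
The latter are images of the canonical element of `V^* ⊗ V`, hence commute with `sp(2n)`, and their
anticommutator is `(deg - n) / 4` (`ospPair_rho`). From this anticommutator alone all brackets of
`osp(1|2)` follow, on `E` and on the `F_i` alike (`OspPair.isOspRep`).

The same relation decomposes every graded module with degrees in `0, …, 2n` (`OspData.equiv`). The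
vectors `f^j w` with `g w = 0`, `deg w = i`, form a copy of `F_i` (`OspPair.g_f_pow`); as `f g` is injective
in degrees above `n` (`OspData.eq_zero_of_f_g`), these strings span (`OspData.mem_span_f_pow`), and
they are independent because a nonzero kernel, being stable under the nilpotent operator `g`, would
contain a nonzero vector killed by `g` (`OspData.sumMap_injective`). No topology enters, so the
argument applies to `E` itself, where the first tensor factors are the kernels of `ρ(f^-)` in given
degree and parity, and to `E_K`.

It remains to see that the kernel of `D` in `E_K`, in given fermion number and boson parity, is the
irreducible module `L(λ)`. Its singular vectors are unique up to scalars (`Osc.eq_smul_hvec`): sorting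
the equations by bosonic degree, a singular vector is forced to be one of three explicit vectors. The
arguments there rest on the fact that `c + ∑ p_k` is injective for commuting idempotents `p_k` and an
integer `c > 0` (`eq_zero_of_smul_add_sum_idem`). The weights have bounded height, so every nonzero
submodule contains a singular vector, hence the highest weight vector (`hvec_mem_of_invariant`). A
contravariant form, the product of `∫ s t` with a form on `Λ V^*`, is nonzero on the highest weight
vector, and a submodule `N` then splits off its orthogonal complement, so the module is
irreducible (`eq_of_form`). Finally an irreducible highest weight module is the quotient of the Verma
module by its largest proper submodule (`exists_equiv_L`).
-/

noncomputable section

namespace SympHowe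

open Module (End)

section

/-! ### Sums of commuting idempotents -/

section Idempotents

variable {M ι : Type*} [AddCommGroup M] [Module ℂ M]

/-- The eigenvalues of a sum of commuting idempotents are natural numbers, so adding a positive integer
gives an injective operator. The induction removes one idempotent `p r` at a time: applying `p r` to
the equation raises `c` by one and gives `p r x = 0`. -/
theorem eq_zero_of_smul_add_sum_idem [DecidableEq ι] (p : ι → End ℂ M)
    (hp : ∀ k x, p k (p k x) = p k x)
    (hc : ∀ k l x, p k (p l x) = p l (p k x)) (T : Finset ι) :
    ∀ (c : ℕ), c ≠ 0 → ∀ x : M, (c : ℂ) • x + ∑ k ∈ T, p k x = 0 → x = 0 := by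
  induction T using Finset.induction_on with
  | empty =>
    intro c h0 x h
    simpa [h0] using h
  | insert r T hr ih =>
    intro c h0 x h
    rw [Finset.sum_insert hr] at h
    have h1 : p r x = 0 := by
      refine ih (c + 1) (Nat.succ_ne_zero _) _ ?_
      have := congrArg (p r) h
      simp only [map_add, map_smul, map_zero, hp, map_sum] at this
      rw [← this, Nat.cast_add, Nat.cast_one, add_smul, one_smul, add_assoc]
      congr 2
      exact Finset.sum_congr rfl fun k _ => hc k r x
    refine ih c h0 x ?_
    rwa [h1, zero_add] at h

/-- A vector in the kernel of a sum of commuting idempotents is in the kernel of each of them. -/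
theorem idem_eq_zero_of_sum_eq_zero [DecidableEq ι] (p : ι → End ℂ M)
    (hp : ∀ k x, p k (p k x) = p k x)
    (hc : ∀ k l x, p k (p l x) = p l (p k x)) (T : Finset ι) (x : M)
    (h : ∑ k ∈ T, p k x = 0) {r : ι} (hr : r ∈ T) : p r x = 0 := by
  refine eq_zero_of_smul_add_sum_idem p hp hc (T.erase r) 1 one_ne_zero _ ?_
  have := congrArg (p r) h
  rw [← Finset.add_sum_erase _ _ hr] at this
  simp only [map_add, map_zero, hp, map_sum] at this
  rw [← this, Nat.cast_one, one_smul]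
  congr 1
  exact Finset.sum_congr rfl fun k _ => hc k r x

end Idempotents

/-! ### Bosonic and fermionic oscillators -/

/-- A system of `n` bosonic and `2n` fermionic oscillators acting on `M`: creation operators `z k`,
`c r` and annihilation operators `d k`, `dc r`, subject to the canonical commutation relations
(bosons), anticommutation relations (fermions), bosons commuting with fermions. -/
structure Osc (n : ℕ) (M : Type*) [AddCommGroup M] [Module ℂ M] where
  z : Fin n → End ℂ M
  d : Fin n → End ℂ M
  c : Fin n ⊕ Fin n → End ℂ M
  dc : Fin n ⊕ Fin n → End ℂ M
  zz : ∀ k l x, z k (z l x) = z l (z k x)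
  dd : ∀ k l x, d k (d l x) = d l (d k x)
  dz : ∀ k l x, d k (z l x) = z l (d k x) + if k = l then x else 0
  cc : ∀ r s x, c r (c s x) = -c s (c r x)
  dcdc : ∀ r s x, dc r (dc s x) = -dc s (dc r x)
  dcc : ∀ r s x, dc r (c s x) = (if r = s then x else 0) - c s (dc r x)
  zc : ∀ k r x, z k (c r x) = c r (z k x)
  zdc : ∀ k r x, z k (dc r x) = dc r (z k x)
  d_c : ∀ k r x, d k (c r x) = c r (d k x)
  ddc : ∀ k r x, d k (dc r x) = dc r (d k x)

namespace Osc

variable {n : ℕ} {M : Type*} [AddCommGroup M] [Module ℂ M] (o : Osc n M)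

/-- The fermionic creation operators of positive weight. -/
abbrev a (k : Fin n) : End ℂ M := o.c (Sum.inl k)
/-- The fermionic creation operators of negative weight. -/
abbrev b (k : Fin n) : End ℂ M := o.c (Sum.inr k)
/-- The annihilation operators dual to `a`. -/
abbrev da (k : Fin n) : End ℂ M := o.dc (Sum.inl k)
/-- The annihilation operators dual to `b`. -/
abbrev db (k : Fin n) : End ℂ M := o.dc (Sum.inr k)

theorem c_self (r : Fin n ⊕ Fin n) (x : M) : o.c r (o.c r x) = 0 :=
  haveI : IsAddTorsionFree M := .of_isTorsionFree ℂ M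
  self_eq_neg.mp (o.cc r r x)

theorem dc_self (r : Fin n ⊕ Fin n) (x : M) : o.dc r (o.dc r x) = 0 :=
  haveI : IsAddTorsionFree M := .of_isTorsionFree ℂ M
  self_eq_neg.mp (o.dcdc r r x)

theorem dcc_ne {r s : Fin n ⊕ Fin n} (h : r ≠ s) (x : M) : o.dc r (o.c s x) = -o.c s (o.dc r x) := by
  rw [o.dcc, if_neg h, zero_sub]

theorem cdc (r s : Fin n ⊕ Fin n) (x : M) :
    o.c r (o.dc s x) = (if s = r then x else 0) - o.dc s (o.c r x) := by
  rw [o.dcc]; abel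

theorem c_dc_c (r : Fin n ⊕ Fin n) (x : M) : o.c r (o.dc r (o.c r x)) = o.c r x := by
  rw [o.dcc, if_pos rfl, map_sub, o.c_self, sub_zero]

theorem dc_c_dc (r : Fin n ⊕ Fin n) (x : M) : o.dc r (o.c r (o.dc r x)) = o.dc r x := by
  rw [o.dcc, if_pos rfl, o.dc_self, map_zero, sub_zero]

/-- The occupation number of the fermionic mode `r`. -/
def num (r : Fin n ⊕ Fin n) : End ℂ M := o.c r * o.dc r
/-- The complementary idempotent of `num r`. -/
def hole (r : Fin n ⊕ Fin n) : End ℂ M := o.dc r * o.c r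

theorem num_apply (r x) : o.num r x = o.c r (o.dc r x) := rfl
theorem hole_apply (r x) : o.hole r x = o.dc r (o.c r x) := rfl

theorem num_add_hole (r x) : o.num r x + o.hole r x = x := by
  rw [num_apply, hole_apply, o.dcc, if_pos rfl]; abel

theorem num_idem (r x) : o.num r (o.num r x) = o.num r x := by
  simp only [num_apply, o.dc_c_dc]

theorem hole_idem (r x) : o.hole r (o.hole r x) = o.hole r x := by
  simp only [hole_apply, o.c_dc_c]

theorem num_c_ne {r s : Fin n ⊕ Fin n} (h : r ≠ s) (x : M) :
    o.num r (o.c s x) = o.c s (o.num r x) := by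
  rw [num_apply, o.dcc_ne h, map_neg, o.cc, neg_neg, num_apply]

theorem num_dc_ne {r s : Fin n ⊕ Fin n} (h : r ≠ s) (x : M) :
    o.num r (o.dc s x) = o.dc s (o.num r x) := by
  rw [num_apply, o.dcdc, map_neg, num_apply, o.dcc_ne h.symm]

theorem num_comm (r s x) : o.num r (o.num s x) = o.num s (o.num r x) := by
  by_cases h : r = s
  · rw [h]
  · rw [o.num_apply s, o.num_c_ne h, o.num_dc_ne h, o.num_apply s]

theorem hole_eq (r x) : o.hole r x = x - o.num r x := by
  rw [eq_sub_iff_add_eq, add_comm, o.num_add_hole]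

theorem hole_comm (r s x) : o.hole r (o.hole s x) = o.hole s (o.hole r x) := by
  simp only [hole_eq, map_sub, o.num_comm r s]; abel

/-- `∑ ∂_{a_k} a_k`, the number of empty modes of type `a`. -/
def P : End ℂ M := ∑ k, o.hole (Sum.inl k)

theorem P_apply (x : M) : o.P x = ∑ k, o.da k (o.a k x) := by
  simp [P, hole_apply]

theorem a_P (l : Fin n) (x : M) : o.a l (o.P x) = o.a l x + o.P (o.a l x) := by
  simp only [P_apply, map_sum]
  have : ∀ k, o.a l (o.da k (o.a k x)) = (if k = l then o.a l x else 0) + o.da k (o.a k (o.a l x)) := by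
    intro k
    rw [o.cdc, o.cc, map_neg, sub_neg_eq_add]
    by_cases h : k = l <;> simp [h]
  simp only [this, Finset.sum_add_distrib, Finset.sum_ite_eq', Finset.mem_univ, if_true]

theorem eq_zero_of_add_P {x : M} (h : x + o.P x = 0) : x = 0 := by
  refine eq_zero_of_smul_add_sum_idem (fun k : Fin n => o.hole (Sum.inl k))
    (fun k x => o.hole_idem _ x) (fun k l x => o.hole_comm _ _ x) Finset.univ 1 one_ne_zero x ?_
  rw [Nat.cast_one, one_smul, ← h, P_apply]; rfl

theorem a_eq_zero_of_P {x : M} (h : o.P x = 0) (k : Fin n) : o.a k x = 0 := by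
  have := idem_eq_zero_of_sum_eq_zero (fun k : Fin n => o.hole (Sum.inl k))
    (fun k x => o.hole_idem _ x) (fun k l x => o.hole_comm _ _ x) Finset.univ x
    (by rw [← h, P_apply]; rfl) (Finset.mem_univ k)
  rw [hole_apply] at this
  rw [← o.c_dc_c, this, map_zero]

/-- The bosonic number operator. -/
def NZ : End ℂ M := ∑ k, o.z k * o.d k

/-- The fermionic number operator. -/
def NF : End ℂ M := ∑ r, o.num r

theorem NZ_apply (x : M) : o.NZ x = ∑ k, o.z k (o.d k x) := by simp [NZ]

theorem NF_apply (x : M) : o.NF x = ∑ k, o.a k (o.da k x) + ∑ k, o.b k (o.db k x) := by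
  simp [NF, num_apply]

/-- The vectors of bosonic degree `m`. Besides the eigenvalue of `NZ`, all `(m + 1)`-fold derivatives
are required to vanish, which is not automatic in an arbitrary module. -/
def Gr : ℕ → Submodule ℂ M
  | 0 => ⨅ k, LinearMap.ker (o.d k)
  | m + 1 => End.eigenspace o.NZ ((m + 1 : ℕ) : ℂ) ⊓ ⨅ k, (Gr m).comap (o.d k)

theorem mem_Gr_zero {x : M} : x ∈ o.Gr 0 ↔ ∀ k, o.d k x = 0 := by simp [Gr]

theorem mem_Gr_succ {m : ℕ} {x : M} :
    x ∈ o.Gr (m + 1) ↔ o.NZ x = ((m + 1 : ℕ) : ℂ) • x ∧ ∀ k, o.d k x ∈ o.Gr m := by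
  simp [Gr]

theorem NZ_of_mem_Gr {m : ℕ} {x : M} (h : x ∈ o.Gr m) : o.NZ x = (m : ℂ) • x := by
  cases m with
  | zero => simp [NZ_apply, o.mem_Gr_zero.mp h]
  | succ m => exact (o.mem_Gr_succ.mp h).1

theorem Gr_le_eigenspace (m : ℕ) : o.Gr m ≤ End.eigenspace o.NZ (m : ℂ) := fun _ h =>
  End.mem_eigenspace_iff.mpr (o.NZ_of_mem_Gr h)

theorem NZ_z (k : Fin n) (x : M) : o.NZ (o.z k x) = o.z k (o.NZ x) + o.z k x := by
  simp only [NZ_apply, o.dz, map_add, Finset.sum_add_distrib, map_sum]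
  congr 1
  · exact Finset.sum_congr rfl fun l _ => o.zz _ _ _
  · rw [Finset.sum_eq_single k] <;> simp +contextual

theorem z_mem_Gr {m : ℕ} (k : Fin n) {x : M} (h : x ∈ o.Gr m) : o.z k x ∈ o.Gr (m + 1) := by
  induction m generalizing x with
  | zero =>
    refine o.mem_Gr_succ.mpr ⟨?_, fun l => ?_⟩
    · rw [NZ_z, o.NZ_of_mem_Gr h]; simp
    · rw [o.dz, o.mem_Gr_zero.mp h, map_zero, zero_add]
      split_ifs
      exacts [h, zero_mem _]
  | succ m ih =>
    refine o.mem_Gr_succ.mpr ⟨?_, fun l => ?_⟩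
    · rw [NZ_z, o.NZ_of_mem_Gr h]
      push_cast
      simp only [map_smul, map_add, add_smul, one_smul]
    · rw [o.dz]
      refine add_mem (ih ((o.mem_Gr_succ.mp h).2 l)) ?_
      split_ifs
      exacts [h, zero_mem _]

theorem d_mem_Gr {m : ℕ} (k : Fin n) {x : M} (h : x ∈ o.Gr (m + 1)) : o.d k x ∈ o.Gr m :=
  (o.mem_Gr_succ.mp h).2 k

theorem c_mem_Gr {m : ℕ} (r : Fin n ⊕ Fin n) {x : M} (h : x ∈ o.Gr m) : o.c r x ∈ o.Gr m := by
  induction m generalizing x with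
  | zero =>
    simp only [mem_Gr_zero] at h ⊢
    intro k; rw [o.d_c, h, map_zero]
  | succ m ih =>
    refine o.mem_Gr_succ.mpr ⟨?_, fun l => ?_⟩
    · rw [← map_smul, ← o.NZ_of_mem_Gr h]; simp [NZ_apply, o.d_c, o.zc]
    · rw [o.d_c]; exact ih (o.d_mem_Gr l h)

theorem dc_mem_Gr {m : ℕ} (r : Fin n ⊕ Fin n) {x : M} (h : x ∈ o.Gr m) : o.dc r x ∈ o.Gr m := by
  induction m generalizing x with
  | zero =>
    simp only [mem_Gr_zero] at h ⊢
    intro k; rw [o.ddc, h, map_zero]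
  | succ m ih =>
    refine o.mem_Gr_succ.mpr ⟨?_, fun l => ?_⟩
    · rw [← map_smul, ← o.NZ_of_mem_Gr h]; simp [NZ_apply, o.ddc, o.zdc]
    · rw [o.ddc]; exact ih (o.d_mem_Gr l h)

theorem eq_zero_of_d {m : ℕ} {x : M} (h : x ∈ o.Gr (m + 1)) (h0 : ∀ k, o.d k x = 0) : x = 0 := by
  have := o.NZ_of_mem_Gr h
  simp only [NZ_apply, h0, map_zero, Finset.sum_const_zero] at this
  exact (smul_eq_zero.mp this.symm).resolve_left (by exact_mod_cast Nat.succ_ne_zero m)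

theorem eq_zero_of_sum_Gr {N : ℕ} {u : ℕ → M} (hu : ∀ m, u m ∈ o.Gr m)
    (h : ∑ m ∈ Finset.range N, u m = 0) {m : ℕ} (hm : m < N) : u m = 0 := by
  have hi := (End.eigenspaces_iSupIndep o.NZ).comp (f := fun m : ℕ => (m : ℂ)) Nat.cast_injective
  exact (iSupIndep_iff_finsetSum_eq_zero_imp_eq_zero _).mp hi (Finset.range N)
    u (fun m _ => o.Gr_le_eigenspace m (hu m)) h m (Finset.mem_range.mpr hm)

end Osc

end

section

/-! ### Singular vectors -/

namespace Osc

variable {n : ℕ} {M : Type*} [AddCommGroup M] [Module ℂ M] (o : Osc n M)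

/-- The fermionic part `a_k ∂_{b_l} + a_l ∂_{b_k}` of the raising operator of weight
`ε_k + ε_l`. -/
def XF (k l : Fin n) : End ℂ M := o.a k * o.db l + o.a l * o.db k

theorem XF_apply (k l : Fin n) (x : M) : o.XF k l x = o.a k (o.db l x) + o.a l (o.db k x) := rfl

theorem XF_symm (k l : Fin n) : o.XF k l = o.XF l k := add_comm _ _

/-- The raising operator of weight `ε_k + ε_l`. -/
def X (k l : Fin n) : End ℂ M := o.d k * o.d l + o.XF k l

theorem X_apply (k l : Fin n) (x : M) : o.X k l x = o.d k (o.d l x) + o.XF k l x := rfl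

/-- The operator of weight `ε_k - ε_l` of the Levi subalgebra `gl(n)` (up to a constant if
`k = l`). -/
def R (k l : Fin n) : End ℂ M := o.a k * o.da l - o.b l * o.db k - o.z l * o.d k

theorem R_apply (k l : Fin n) (x : M) :
    o.R k l x = o.a k (o.da l x) - o.b l (o.db k x) - o.z l (o.d k x) := rfl

/-- The multiple `∑ (∂_{b_k} z_k + ∂_{a_k} d_k)` of `ρ(f^-)`. -/
def D : End ℂ M := ∑ k, (o.db k * o.z k + o.da k * o.d k)

theorem D_apply (x : M) : o.D x = ∑ k, (o.db k (o.z k x) + o.da k (o.d k x)) := by simp [D]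

/-- A vector of `ker D` that is annihilated by the raising operators. -/
structure Sing (w : M) : Prop where
  X : ∀ k l, o.X k l w = 0
  R : ∀ k l, k < l → o.R k l w = 0
  D : o.D w = 0

/-- `w` is the sum of its components `u 0, u 1, …` of bosonic degrees `0, 1, …`. -/
def IsComp (w : M) (u : ℕ → M) : Prop :=
  (∀ m, u m ∈ o.Gr m) ∧ ∃ N, (∀ m, N ≤ m → u m = 0) ∧ w = ∑ m ∈ Finset.range N, u m

variable {o}

theorem IsComp.exists_ge {w : M} {u : ℕ → M} (h : o.IsComp w u) (K : ℕ) :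
    ∃ N, K ≤ N ∧ (∀ m, N ≤ m → u m = 0) ∧ w = ∑ m ∈ Finset.range N, u m := by
  obtain ⟨-, N, h1, h2⟩ := h
  refine ⟨max K N, le_max_left _ _, fun m hm => h1 m ((le_max_right _ _).trans hm), ?_⟩
  rw [h2]
  refine Finset.sum_subset (Finset.range_mono (le_max_right _ _)) fun m _ hm => h1 m ?_
  simpa using hm

theorem IsComp.sub {w w' : M} {u u' : ℕ → M} (h : o.IsComp w u) (h' : o.IsComp w' u') :
    o.IsComp (w - w') (u - u') := by
  obtain ⟨N, -, h1, h2⟩ := h.exists_ge 0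
  obtain ⟨N', hN, h1', h2'⟩ := h'.exists_ge N
  refine ⟨fun m => sub_mem (h.1 m) (h'.1 m), N', fun m hm => ?_, ?_⟩
  · rw [Pi.sub_apply, h1 m (hN.trans hm), h1' m hm, sub_zero]
  · simp only [Pi.sub_apply, Finset.sum_sub_distrib]
    rw [← h2', h2]
    congr 1
    refine Finset.sum_subset (Finset.range_mono hN) fun m _ hm => h1 m ?_
    simpa using hm

theorem IsComp.smul {w : M} {u : ℕ → M} (h : o.IsComp w u) (t : ℂ) :
    o.IsComp (t • w) (t • u) := by
  obtain ⟨N, -, h1, h2⟩ := h.exists_ge 0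
  refine ⟨fun m => Submodule.smul_mem _ t (h.1 m), N, fun m hm => ?_, ?_⟩
  · rw [Pi.smul_apply, h1 m hm, smul_zero]
  · rw [h2, Finset.smul_sum]; rfl

theorem IsComp.map_eq {w : M} {u : ℕ → M} (h : o.IsComp w u) {T : End ℂ M}
    (hT : ∀ m, ∀ x ∈ o.Gr m, T x ∈ o.Gr m) {t : ℂ} (hw : T w = t • w) (m : ℕ) :
    T (u m) = t • u m := by
  obtain ⟨N, hN, -, h2⟩ := h.exists_ge (m + 1)
  have := o.eq_zero_of_sum_Gr (N := N) (u := fun m => T (u m) - t • u m)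
    (fun m => sub_mem (hT m _ (h.1 m)) (Submodule.smul_mem _ _ (h.1 m)))
    (by rw [Finset.sum_sub_distrib, ← map_sum, ← Finset.smul_sum, ← h2, hw, sub_self])
    (m := m) (by omega)
  exact sub_eq_zero.mp this

theorem XF_mem_Gr {m : ℕ} (k l : Fin n) {x : M} (h : x ∈ o.Gr m) : o.XF k l x ∈ o.Gr m :=
  add_mem (o.c_mem_Gr _ (o.dc_mem_Gr _ h)) (o.c_mem_Gr _ (o.dc_mem_Gr _ h))

theorem IsComp.X {w : M} {u : ℕ → M} (h : o.IsComp w u) (k l : Fin n) (hw : o.X k l w = 0)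
    (m : ℕ) : o.d k (o.d l (u (m + 2))) + o.XF k l (u m) = 0 := by
  obtain ⟨N, hN, h1, h2⟩ := h.exists_ge (m + 1)
  refine o.eq_zero_of_sum_Gr (N := N) (u := fun m => o.d k (o.d l (u (m + 2))) + o.XF k l (u m))
    (fun m => add_mem (o.d_mem_Gr _ (o.d_mem_Gr _ (h.1 _))) (XF_mem_Gr _ _ (h.1 m))) ?_ (by omega)
  have h0 : o.d k (o.d l (u 0)) = 0 := by rw [o.mem_Gr_zero.mp (h.1 0), map_zero]
  have h1' : o.d k (o.d l (u 1)) = 0 := o.mem_Gr_zero.mp (o.d_mem_Gr l (h.1 1)) k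
  rw [← hw, X_apply, h2, map_sum, map_sum, map_sum, Finset.sum_add_distrib]
  congr 1
  have e : ∑ m ∈ Finset.range (N + 2), o.d k (o.d l (u m)) =
      ∑ m ∈ Finset.range N, o.d k (o.d l (u (m + 2))) := by
    rw [Finset.sum_range_succ', Finset.sum_range_succ', h0]
    simp [h1']
  rw [← e, Finset.sum_range_succ, Finset.sum_range_succ, h1 N le_rfl, h1 (N + 1) (by omega)]
  simp

theorem R_mem_Gr {m : ℕ} (k l : Fin n) {x : M} (h : x ∈ o.Gr m) : o.R k l x ∈ o.Gr m := by
  refine sub_mem (sub_mem (o.c_mem_Gr _ (o.dc_mem_Gr _ h)) (o.c_mem_Gr _ (o.dc_mem_Gr _ h))) ?_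
  cases m with
  | zero =>
    have : o.d k x = 0 := o.mem_Gr_zero.mp h k
    simp [this]
  | succ m => exact o.z_mem_Gr _ (o.d_mem_Gr _ h)

theorem NF_mem_Gr {m : ℕ} {x : M} (h : x ∈ o.Gr m) : o.NF x ∈ o.Gr m := by
  rw [NF_apply]
  exact add_mem (sum_mem fun _ _ => o.c_mem_Gr _ (o.dc_mem_Gr _ h))
    (sum_mem fun _ _ => o.c_mem_Gr _ (o.dc_mem_Gr _ h))

theorem IsComp.R {w : M} {u : ℕ → M} (h : o.IsComp w u) (k l : Fin n) (hw : o.R k l w = 0)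
    (m : ℕ) : o.R k l (u m) = 0 := by
  simpa using h.map_eq (fun _ _ => R_mem_Gr k l) (t := 0) (by rw [hw, zero_smul]) m

/-- The components of the equation `D w = 0` of bosonic degree `0` and of bosonic degree `m + 1`. -/
theorem IsComp.D {w : M} {u : ℕ → M} (h : o.IsComp w u) (hw : o.D w = 0) :
    ∑ k, o.da k (o.d k (u 1)) = 0 ∧
      ∀ m, ∑ k, (o.db k (o.z k (u m)) + o.da k (o.d k (u (m + 2)))) = 0 := by
  let f : ℕ → M := fun m => match m with
    | 0 => ∑ k, o.da k (o.d k (u 1))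
    | m + 1 => ∑ k, (o.db k (o.z k (u m)) + o.da k (o.d k (u (m + 2))))
  have hf : ∀ m, f m ∈ o.Gr m := by
    intro m
    cases m with
    | zero => exact sum_mem fun k _ => o.dc_mem_Gr _ (o.d_mem_Gr _ (h.1 1))
    | succ m =>
      exact sum_mem fun k _ => add_mem (o.dc_mem_Gr _ (o.z_mem_Gr _ (h.1 m)))
        (o.dc_mem_Gr _ (o.d_mem_Gr _ (h.1 (m + 2))))
  have key : ∀ m, f m = 0 := by
    intro m
    obtain ⟨N, hN, h1, h2⟩ := h.exists_ge (m + 1)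
    refine o.eq_zero_of_sum_Gr (N := N + 1) hf ?_ (m := m) (by omega)
    rw [Finset.sum_range_succ']
    have h0 : ∀ k, o.d k (u 0) = 0 := o.mem_Gr_zero.mp (h.1 0)
    have e : ∑ m ∈ Finset.range (N + 2), ∑ k, o.da k (o.d k (u m)) =
        ∑ m ∈ Finset.range N, ∑ k, o.da k (o.d k (u (m + 2))) + ∑ k, o.da k (o.d k (u 1)) := by
      rw [Finset.sum_range_succ', Finset.sum_range_succ']
      simp [h0]
    have e' : ∑ m ∈ Finset.range (N + 2), ∑ k, o.da k (o.d k (u m)) =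
        ∑ m ∈ Finset.range N, ∑ k, o.da k (o.d k (u m)) := by
      rw [Finset.sum_range_succ, Finset.sum_range_succ, h1 N le_rfl, h1 (N + 1) (by omega)]
      simp
    rw [e'] at e
    simp only [f, Finset.sum_add_distrib]
    rw [add_assoc, ← e, ← hw, D_apply, h2]
    simp only [map_sum, Finset.sum_add_distrib]
    congr 1 <;> exact Finset.sum_comm
  exact ⟨key 0, fun m => key (m + 1)⟩

variable (o)

theorem eq_zero_of_d_d {m : ℕ} {x : M} (h : x ∈ o.Gr (m + 2)) (h0 : ∀ k l, o.d k (o.d l x) = 0) :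
    x = 0 :=
  o.eq_zero_of_d h fun l => o.eq_zero_of_d (o.d_mem_Gr l h) fun k => h0 k l

variable {o}

/-- If the raising operators of weight `ε_k + ε_l` act on the component of degree `m` by zero, the
components of degrees `m + 2, m + 4, …` vanish. -/
theorem IsComp.eq_zero {w : M} {u : ℕ → M} (h : o.IsComp w u) (hw : ∀ k l, o.X k l w = 0)
    {m : ℕ} (hm : ∀ k l, o.XF k l (u m) = 0) (j : ℕ) : u (m + 2 * (j + 1)) = 0 := by
  induction j with
  | zero =>
    refine o.eq_zero_of_d_d (h.1 (m + 2)) fun k l => ?_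
    simpa [hm] using h.X k l (hw k l) m
  | succ j ih =>
    refine o.eq_zero_of_d_d (m := m + 2 * (j + 1)) (h.1 _) fun k l => ?_
    have := h.X k l (hw k l) (m + 2 * (j + 1))
    rwa [ih, map_zero, add_zero] at this

variable (o)

/-- The operator `∑ ∂_{a_k} ∂_{b_k}`. -/
def K (x : M) : M := ∑ k, o.da k (o.db k x)

theorem sum_da_XF (j : Fin n) (x : M) :
    ∑ k, o.da k (o.XF k j x) = o.P (o.db j x) + o.db j x - o.a j (o.K x) := by
  simp only [XF_apply, map_add, Finset.sum_add_distrib, P_apply, K, map_sum]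
  rw [add_sub_assoc]
  congr 1
  have : ∀ k, o.da k (o.a j (o.db k x)) =
      (if k = j then o.db j x else 0) - o.a j (o.da k (o.db k x)) := by
    intro k
    rw [o.dcc]
    by_cases h : k = j <;> simp [h]
  simp only [this, Finset.sum_sub_distrib, Finset.sum_ite_eq', Finset.mem_univ, if_true]

variable {o}

/-- In even bosonic degrees a singular vector of `ker D` contains neither bosons nor fermions of
type `b`. -/
theorem IsComp.even {w : M} {u : ℕ → M} (h : o.IsComp w u) (hw : o.Sing w)
    (hp : ∀ m, u (2 * m + 1) = 0) : (∀ k, o.d k w = 0) ∧ (∀ k, o.db k w = 0) := by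
  have hD := (h.D hw.D).2 0
  have h0 : ∀ k, o.d k (u 0) = 0 := o.mem_Gr_zero.mp (h.1 0)
  have hX : ∀ k l, o.d k (o.d l (u 2)) = -o.XF k l (u 0) := fun k l =>
    eq_neg_of_add_eq_zero_left (h.X k l (hw.X k l) 0)
  have e1 : ∀ j, o.a j (o.K (u 0)) = o.P (o.db j (u 0)) := by
    intro j
    have := congrArg (o.d j) hD
    simp only [map_sum, map_add, o.ddc, map_zero, o.dz, h0, zero_add, hX, map_neg,
      Finset.sum_add_distrib, Finset.sum_neg_distrib] at this
    simp only [fun k => o.XF_symm j k, o.sum_da_XF] at this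
    have e : ∑ x, o.db x (if j = x then u 0 else 0) = o.db j (u 0) := by
      rw [Finset.sum_eq_single j] <;> simp +contextual [eq_comm]
    rw [e] at this
    rw [← sub_eq_zero, ← this]
    abel
  have e2 : ∀ k l, o.XF k l (u 0) = 0 := by
    intro k l
    refine o.eq_zero_of_add_P ?_
    have h1 := o.a_P k (o.db l (u 0))
    have h2 := o.a_P l (o.db k (u 0))
    rw [← e1] at h1 h2
    rw [o.cc] at h1
    rw [XF_apply, map_add]
    rw [add_add_add_comm, ← h1, ← h2]
    abel
  have e3 : ∀ m, m ≠ 0 → u m = 0 := by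
    intro m hm
    rcases Nat.even_or_odd' m with ⟨r, rfl | rfl⟩
    · obtain ⟨r, rfl⟩ := Nat.exists_eq_succ_of_ne_zero (show r ≠ 0 by omega)
      simpa using h.eq_zero hw.X e2 r
    · exact hp r
  have e4 : w = u 0 := by
    obtain ⟨N, hN, -, h2⟩ := h.exists_ge 1
    rw [h2]
    exact Finset.sum_eq_single_of_mem 0 (Finset.mem_range.mpr hN) fun m _ hm => e3 m hm
  refine ⟨fun k => by rw [e4, h0], fun j => ?_⟩
  have := congrArg (o.d j) hD
  simp only [zero_add, e3 2 (by norm_num), map_sum, o.ddc, map_zero, add_zero, o.dz, h0] at this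
  rw [Finset.sum_eq_single j] at this
  · rw [e4]; simpa using this
  · intro k _ hk; simp [Ne.symm hk]
  · simp

theorem eq_zero_of_hole_d {m : ℕ} {r : Fin n ⊕ Fin n} {x : M} (h : x ∈ o.Gr (m + 1))
    (h0 : ∀ k, o.c r (o.d k x) = 0) : o.c r x = 0 :=
  o.eq_zero_of_d (o.c_mem_Gr r h) fun k => by rw [o.d_c, h0]

/-- The component of degree `3` of a singular vector of odd bosonic degree is filled with
fermions of type `a`. -/
theorem IsComp.odd_a {w : M} {u : ℕ → M} (h : o.IsComp w u) (hw : o.Sing w) (k : Fin n) :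
    o.a k (u 3) = 0 := by
  let v : Fin n → M := fun j => o.d j (u 1)
  let T : Fin n → Fin n → Fin n → M := fun i j l => o.XF i j (v l)
  have hdT : ∀ i j l, o.d i (o.d j (o.d l (u 3))) = -T i j l := fun i j l => by
    have := congrArg (o.d l) (h.X i j (hw.X i j) 1)
    simp only [map_add, XF_apply, o.d_c, o.ddc, map_zero] at this
    rw [o.dd j l, o.dd i l]
    exact eq_neg_of_add_eq_zero_left this
  have hs1 : ∀ i j l, T i j l = T j i l := fun i j l => by simp only [T, o.XF_symm i j]
  have hs2 : ∀ i j l, T i j l = T i l j := fun i j l => by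
    rw [← neg_inj, ← hdT, ← hdT, o.dd j l]
  have tr : ∑ k, o.da k (v k) = 0 := (h.D hw.D).1
  have e1 : ∀ i j, ∑ k, o.da k (T i j k) = o.db j (v i) + o.db i (v j) := by
    intro i j
    have aux : ∀ i j, ∑ k, o.da k (o.a i (o.db j (v k))) = o.db j (v i) := by
      intro i j
      have : ∀ k, o.da k (o.a i (o.db j (v k))) =
          (if k = i then o.db j (v i) else 0) + o.a i (o.db j (o.da k (v k))) := by
        intro k
        rw [o.dcc, o.dcdc, map_neg, sub_neg_eq_add]
        by_cases hk : k = i <;> simp [hk]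
      simp only [this, Finset.sum_add_distrib, Finset.sum_ite_eq', Finset.mem_univ, if_true]
      rw [← map_sum, ← map_sum, tr, map_zero, map_zero, add_zero]
    simp only [T, XF_apply, map_add, Finset.sum_add_distrib, aux]
  have e2 : ∀ i j, o.db j (v i) = o.P (o.db i (v j)) - o.a i (o.K (v j)) := by
    intro i j
    have h1 := o.sum_da_XF i (v j)
    have h2 : ∑ k, o.da k (o.XF k i (v j)) = ∑ k, o.da k (T i j k) :=
      Finset.sum_congr rfl fun k _ => by
        change o.da k (T k i j) = _
        rw [hs1 k i j, hs2 i k j]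
    rw [e1, h1] at h2
    rw [← sub_eq_zero]
    rw [← sub_eq_zero] at h2
    rw [← neg_eq_zero, ← h2]
    abel
  -- `Y l j i = a_l ∂_{b_j} v_i`
  let Y : Fin n → Fin n → Fin n → M := fun l j i => o.a l (o.db j (v i))
  have hT : ∀ i j l, T i j l = Y i j l + Y j i l := fun i j l => rfl
  have e3 : ∀ l i j, Y l j i + Y i j l = T l i j + o.P (T l i j) := by
    intro l i j
    have h1 := congrArg (o.a l) (e2 i j)
    have h2 := congrArg (o.a i) (e2 l j)
    rw [map_sub, o.a_P] at h1 h2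
    rw [o.cc (Sum.inl i)] at h2
    change o.a l (o.db j (v i)) + o.a i (o.db j (v l)) = _
    rw [h1, h2, hT, map_add]
    simp only [Y]
    abel
  have e4 : ∀ i j l, o.P (T i j l) = 0 := by
    intro i j l
    have h1 := e3 i j l
    have h2 := e3 i l j
    have h3 := e3 j l i
    have t2 : T i l j = T i j l := hs2 i l j
    have t3 : T j l i = T i j l := by rw [hs2 j l i, hs1 j i l]
    rw [t2] at h2
    rw [t3] at h3
    have s1 : T i j l = Y i j l + Y j i l := hT _ _ _
    have s2 : T i j l = Y i l j + Y l i j := by rw [← t2, hT]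
    have s3 : T i j l = Y j l i + Y l j i := by rw [← t3, hT]
    have : (3 : ℂ) • o.P (T i j l) = 0 := by
      have : (3 : ℂ) • o.P (T i j l) = (T i j l + o.P (T i j l)) + (T i j l + o.P (T i j l)) +
          (T i j l + o.P (T i j l)) - T i j l - T i j l - T i j l := by module
      rw [this]
      nth_rewrite 1 [← h1]
      nth_rewrite 1 [← h2]
      rw [← h3]
      nth_rewrite 1 [s1]
      nth_rewrite 1 [s2]
      rw [s3]
      abel
    exact (smul_eq_zero.mp this).resolve_left three_ne_zero
  refine eq_zero_of_hole_d (h.1 3) fun l => eq_zero_of_hole_d (o.d_mem_Gr l (h.1 3)) fun j =>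
    eq_zero_of_hole_d (o.d_mem_Gr j (o.d_mem_Gr l (h.1 3))) fun i => ?_
  rw [hdT, map_neg, o.a_eq_zero_of_P (e4 i j l), neg_zero]

theorem num_eq_zero_of_smul_add {t : ℕ} (s : Finset (Fin n ⊕ Fin n)) (ht : t ≠ 0) {x : M}
    (h : (t : ℂ) • x + ∑ r ∈ s, o.num r x = 0) : x = 0 :=
  eq_zero_of_smul_add_sum_idem o.num o.num_idem o.num_comm s t ht x h

theorem a_filled {x : M} (h : ∀ k, o.a k x = 0) (k : Fin n) : o.a k (o.da k x) = x := by
  rw [o.cdc, h, map_zero, if_pos rfl, sub_zero]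

/-- If all modes of type `a` are filled, the fermion number is at least `n`. -/
theorem eq_zero_of_a_of_lt {x : M} (h : ∀ k, o.a k x = 0) {i : ℕ} (hi : i < n)
    (hx : o.NF x = (i : ℂ) • x) : x = 0 := by
  have hb : ∑ r ∈ Finset.univ.map ⟨Sum.inr, Sum.inr_injective⟩, o.num r x =
    ∑ k, o.b k (o.db k x) := by simp [num_apply]
  refine num_eq_zero_of_smul_add (o := o) (Finset.univ.map ⟨Sum.inr, Sum.inr_injective⟩)
    (t := n - i) (by omega) ?_
  rw [hb]
  rw [NF_apply] at hx
  simp only [a_filled h, Finset.sum_const, Finset.card_univ, Fintype.card_fin] at hx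
  rw [Nat.cast_sub hi.le, sub_smul, sub_add_eq_add_sub, sub_eq_zero, ← hx]
  simp [Nat.cast_smul_eq_nsmul]

theorem db_eq_zero_of_a {x : M} (h : ∀ k, o.a k x = 0)
    (hx : o.NF x = (n : ℂ) • x) (k : Fin n) : o.db k x = 0 := by
  have h1 := idem_eq_zero_of_sum_eq_zero (fun k : Fin n => o.num (Sum.inr k))
    (fun k x => o.num_idem _ x) (fun k l x => o.num_comm _ _ x) Finset.univ x ?_ (Finset.mem_univ k)
  · rw [← o.dc_c_dc, ← num_apply, h1, map_zero]
  · rw [NF_apply] at hx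
    simp only [a_filled h, Finset.sum_const, Finset.card_univ, Fintype.card_fin] at hx
    simpa [Nat.cast_smul_eq_nsmul, num_apply] using hx

variable (o) in
/-- The vectors without bosons and fermions of type `b` in which exactly the first `i` modes of
type `a` are filled. -/
structure Vac (i : ℕ) (x : M) : Prop where
  d : ∀ k, o.d k x = 0
  db : ∀ k, o.db k x = 0
  a : ∀ k : Fin n, (k : ℕ) < i → o.a k x = 0
  da : ∀ k : Fin n, i ≤ k → o.da k x = 0

/-- A vector of the exterior algebra on the `a_k` that is annihilated by `a_k ∂_{a_l}`, `k < l`, is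
proportional to `a_0 ∧ a_1 ∧ ⋯`. -/
theorem vac_of_tri {i : ℕ} {x : M} (hd : ∀ k, o.d k x = 0) (hb : ∀ k, o.db k x = 0)
    (ht : ∀ k l, k < l → o.a k (o.da l x) = 0) (hx : o.NF x = (i : ℂ) • x) : o.Vac i x := by
  let p : Fin n → End ℂ M := fun k => o.num (Sum.inl k)
  have hp : ∀ k x, p k (p k x) = p k x := fun k x => o.num_idem _ x
  have hc : ∀ k l x, p k (p l x) = p l (p k x) := fun k l x => o.num_comm _ _ x
  have h1 : ∀ k l, k ≤ l → p k (p l x) = p l x := by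
    intro k l hkl
    rcases hkl.eq_or_lt with rfl | hkl
    · exact hp _ _
    · have := congrArg (o.da k) (ht k l hkl)
      rw [← hole_apply, o.hole_eq, map_zero, sub_eq_zero] at this
      change o.num _ (o.c _ (o.dc _ x)) = o.c _ (o.dc _ x)
      rw [o.num_c_ne (by simpa using hkl.ne), ← this]
  have hN : ∑ l, p l x = (i : ℂ) • x := by
    rw [← hx, NF_apply]; simp [hb, p, num_apply]
  refine ⟨hd, hb, fun k hk => ?_, fun k hk => ?_⟩
  · -- apply `1 - p k` to `hN`; only the modes `l < k` contribute
    have h2 : o.hole (Sum.inl k) x = 0 := by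
      let y := o.hole (Sum.inl k) x
      have hy : y = x - p k x := o.hole_eq _ _
      have e : ∑ l, p l y = ∑ l ∈ Finset.Iio k, p l y := by
        symm
        refine Finset.sum_subset (Finset.subset_univ _) fun l _ hl => ?_
        have hkl : k ≤ l := by simpa using hl
        rw [hy, map_sub, hc l k, h1 k l hkl, sub_self]
      have e2 : ∑ l, p l y = (i : ℂ) • y := by
        have := hN
        simp only [hy, map_sub, hc _ k, Finset.sum_sub_distrib]
        rw [← map_sum, hN, map_smul, smul_sub]
      refine eq_zero_of_smul_add_sum_idem (fun k : Fin n => o.hole (Sum.inl k))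
        (fun k x => o.hole_idem _ x) (fun k l x => o.hole_comm _ _ x) (Finset.Iio k) (i - k)
        (by omega) _ ?_
      change ((i - k : ℕ) : ℂ) • y + ∑ l ∈ Finset.Iio k, o.hole (Sum.inl l) y = 0
      simp only [o.hole_eq, Finset.sum_sub_distrib]
      change _ + (_ - ∑ l ∈ Finset.Iio k, p l y) = 0
      rw [← e, e2, Finset.sum_const, Fin.card_Iio, Nat.cast_sub hk.le, sub_smul,
        Nat.cast_smul_eq_nsmul, Nat.cast_smul_eq_nsmul]
      abel
    rw [← o.c_dc_c, ← hole_apply, h2, map_zero]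
  · have h2 : p k x = 0 := by
      refine eq_zero_of_smul_add_sum_idem p hp hc (Finset.Ioi k) (k + 1 - i) (by omega) _ ?_
      have e : ∑ l, p l (p k x) = ((k + 1 : ℕ) : ℂ) • p k x + ∑ l ∈ Finset.Ioi k, p l (p k x) := by
        rw [← Finset.sum_filter_add_sum_filter_not Finset.univ (fun l => l ≤ k)]
        congr 1
        · rw [Finset.sum_congr rfl (g := fun _ => p k x)
            fun l hl => h1 l k (by simpa using hl), Finset.sum_const, Nat.cast_smul_eq_nsmul]
          congr 1
          rw [← Fin.card_Iic]
          congr 1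
          ext l; simp
        · refine Finset.sum_congr ?_ fun _ _ => rfl
          ext l; simp
      have e2 : ∑ l, p l (p k x) = (i : ℂ) • p k x := by
        simp only [hc _ k]
        rw [← map_sum, hN, map_smul]
      rw [Nat.cast_sub (by omega), sub_smul, sub_add_eq_add_sub, ← e, e2, sub_self]
    rw [← o.dc_c_dc]
    change o.dc _ (p k x) = 0
    rw [h2, map_zero]

/-- A singular vector of even bosonic degree contains no bosons, and its fermions fill exactly the first
`i` modes of type `a`. -/
theorem IsComp.even_vac {w : M} {u : ℕ → M} (h : o.IsComp w u) (hw : o.Sing w)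
    (hp : ∀ m, u (2 * m + 1) = 0) {i : ℕ} (hi : o.NF w = (i : ℂ) • w) : o.Vac i w := by
  obtain ⟨hd, hb⟩ := h.even hw hp
  refine vac_of_tri hd hb (fun k l hkl => ?_) hi
  have := hw.R k l hkl
  rwa [R_apply, hb, hd, map_zero, map_zero, sub_zero, sub_zero] at this

/-- A singular vector of odd bosonic degree without component of degree `3` contains one boson, in
the last mode `t`; its fermions fill the first `i` modes of type `a`, but not the mode `t`. -/
theorem IsComp.odd_vac {w : M} {u : ℕ → M} (h : o.IsComp w u) (hw : o.Sing w)
    (hp : ∀ m, u (2 * m) = 0) (h3 : u 3 = 0) {i : ℕ} (hi : o.NF w = (i : ℂ) • w)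
    {t : Fin n} (ht : ∀ k, k ≤ t) : ∃ v, o.Vac i v ∧ w = o.z t v ∧ o.da t v = 0 := by
  let v : Fin n → M := fun j => o.d j (u 1)
  have hdv : ∀ k l, o.d k (v l) = 0 := fun k l => o.mem_Gr_zero.mp (o.d_mem_Gr l (h.1 1)) k
  have hX1 : ∀ k l, o.XF k l (u 1) = 0 := fun k l => by
    have := h.X k l (hw.X k l) 1
    rwa [show 1 + 2 = 3 from rfl, h3, map_zero, map_zero, zero_add] at this
  have e4 : w = u 1 := by
    obtain ⟨N, hN, -, h2⟩ := h.exists_ge 2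
    rw [h2]
    refine Finset.sum_eq_single_of_mem 1 (Finset.mem_range.mpr hN) fun m _ hm => ?_
    rcases Nat.even_or_odd' m with ⟨r, rfl | rfl⟩
    · exact hp r
    · obtain ⟨r, rfl⟩ := Nat.exists_eq_succ_of_ne_zero (show r ≠ 0 by omega)
      have := h.eq_zero hw.X hX1 r
      rwa [add_comm 1] at this
  have tr : ∑ k, o.da k (v k) = 0 := (h.D hw.D).1
  have hD := (h.D hw.D).2 1
  simp only [show 1 + 2 = 3 from rfl, h3, map_zero, add_zero] at hD
  have hanti : ∀ i j, o.db i (v j) = -o.db j (v i) := by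
    intro i j
    have := congrArg (o.d i) (congrArg (o.d j) hD)
    simp only [map_sum, o.ddc, o.dz, map_add, map_zero, Finset.sum_add_distrib] at this
    have s1 : ∑ k, o.db k (o.z k (o.d i (o.d j (u 1)))) = 0 := by
      simp [show o.d i (o.d j (u 1)) = 0 from hdv i j]
    have s2 : ∑ k, o.db k (if i = k then o.d j (u 1) else 0) = o.db i (v j) := by
      rw [Finset.sum_eq_single i] <;> simp +contextual [v, eq_comm]
    have s3 : ∑ k, o.db k (o.d i (if j = k then u 1 else 0)) = o.db j (v i) := by
      rw [Finset.sum_eq_single j] <;> simp +contextual [v, eq_comm]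
    rw [s1, s2, s3, zero_add] at this
    exact eq_neg_of_add_eq_zero_left this
  have hK : ∀ j, o.K (v j) = 0 := by
    intro j
    have : ∀ k, o.da k (o.db k (v j)) = o.db j (o.da k (v k)) := fun k => by
      rw [hanti, map_neg, o.dcdc, neg_neg]
    simp only [K, this]
    rw [← map_sum, tr, map_zero]
  have hbv : ∀ i j, o.db i (v j) = 0 := by
    intro i j
    refine o.eq_zero_of_add_P ?_
    have h1 := o.sum_da_XF i (v j)
    have h2 : ∀ k, o.XF k i (v j) = 0 := fun k => by
      have := congrArg (o.d j) (hX1 k i)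
      simpa only [map_add, XF_apply, o.d_c, o.ddc, map_zero] using this
    simp only [h2, hK, map_zero, Finset.sum_const_zero, sub_zero] at h1
    rw [h1, add_comm]
  have hbw : ∀ k, o.db k (u 1) = 0 := fun k =>
    o.eq_zero_of_d (o.dc_mem_Gr _ (h.1 1)) fun j => by rw [o.ddc]; exact hbv k j
  have htri : ∀ k l, k < l → ∀ j, o.a k (o.da l (v j)) = if j = l then v k else 0 := by
    intro k l hkl j
    have := hw.R k l hkl
    rw [e4, R_apply, hbw, map_zero, sub_zero, sub_eq_zero] at this
    have := congrArg (o.d j) this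
    rw [o.d_c, o.ddc, o.dz, o.mem_Gr_zero.mp (o.d_mem_Gr k (h.1 1)) j, map_zero, zero_add] at this
    exact this
  have ht0 : o.da t (v t) = 0 := by
    have hP : o.P (o.da t (v t)) = 0 := by
      rw [P_apply, ← tr]
      refine Finset.sum_congr rfl fun k _ => ?_
      rcases (ht k).eq_or_lt with rfl | hk
      · exact o.dc_c_dc _ _
      · rw [htri k t hk, if_pos rfl]
    rw [← o.dc_c_dc, o.a_eq_zero_of_P hP, map_zero]
  have hv0 : ∀ k, k ≠ t → v k = 0 := fun k hk => by
    have := htri k t ((ht k).lt_of_ne hk) t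
    rwa [if_pos rfl, ht0, map_zero, eq_comm] at this
  refine ⟨v t, vac_of_tri (fun k => hdv k t) (fun k => hbv k t) (fun k l hkl => ?_) ?_, ?_, ht0⟩
  · rcases eq_or_ne l t with rfl | hl
    · rw [ht0, map_zero]
    · rw [htri k l hkl, if_neg hl.symm]
  · have := congrArg (o.d t) hi
    rw [e4] at this
    simpa only [NF_apply, map_add, map_sum, o.d_c, o.ddc, map_smul] using this
  · have := o.NZ_of_mem_Gr (h.1 1)
    rw [Nat.cast_one, one_smul] at this
    rw [e4, ← this, NZ_apply]
    refine (Finset.sum_eq_single_of_mem t (Finset.mem_univ t) fun k _ hk => ?_)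
    change o.z k (v k) = 0
    rw [hv0 k hk, map_zero]

theorem z_injOn {m : ℕ} (t : Fin n) {x : M} (hx : x ∈ o.Gr m) (h : o.z t x = 0) : x = 0 := by
  induction m generalizing x with
  | zero =>
    have := congrArg (o.d t) h
    rwa [o.dz, o.mem_Gr_zero.mp hx, map_zero, map_zero, zero_add, if_pos rfl] at this
  | succ m ih =>
    have h1 : ∀ j, j ≠ t → o.d j x = 0 := fun j hj => ih (o.d_mem_Gr j hx) <| by
      have := congrArg (o.d j) h
      rwa [o.dz, if_neg hj, add_zero, map_zero] at this
    have h2 := congrArg (o.d t) h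
    rw [o.dz, if_pos rfl, map_zero] at h2
    have h3 := o.NZ_of_mem_Gr hx
    rw [NZ_apply, Finset.sum_eq_single_of_mem t (Finset.mem_univ t)
      (fun k _ hk => by rw [h1 k hk, map_zero])] at h3
    rw [h3] at h2
    nth_rewrite 2 [← one_smul ℂ x] at h2
    rw [← add_smul] at h2
    exact (smul_eq_zero.mp h2).resolve_left (by exact_mod_cast Nat.succ_ne_zero (m + 1))

theorem eq_z_d {m : ℕ} {t : Fin n} {x : M} (hx : x ∈ o.Gr (m + 1)) (h : ∀ k, k ≠ t → o.d k x = 0) :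
    x = ((m + 1 : ℕ) : ℂ)⁻¹ • o.z t (o.d t x) := by
  have h3 := o.NZ_of_mem_Gr hx
  rw [NZ_apply, Finset.sum_eq_single_of_mem t (Finset.mem_univ t)
      (fun k _ hk => by rw [h k hk, map_zero])] at h3
  rw [h3, inv_smul_smul₀ (by exact_mod_cast Nat.succ_ne_zero m)]

/-- In fermion number `n`, the component of degree `3` of a singular vector of odd bosonic degree has
all its bosons in the last mode `t`, and its fermions fill the modes of type `a`. -/
theorem IsComp.odd_top {w : M} {u : ℕ → M} (h : o.IsComp w u) (hw : o.Sing w)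
    (hi : o.NF w = (n : ℂ) • w) {t : Fin n} (ht : ∀ k, k ≤ t) :
    ∃ q, o.Vac n q ∧ u 3 = o.z t (o.z t (o.z t q)) := by
  have ha := h.odd_a hw
  have hN := h.map_eq (fun _ _ => NF_mem_Gr) hi 3
  have hb := db_eq_zero_of_a ha hN
  have hd : ∀ k, k ≠ t → o.d k (u 3) = 0 := fun k hk => by
    have := h.R k t (hw.R k t ((ht k).lt_of_ne hk)) 3
    rw [R_apply, hb, map_zero, sub_zero, o.cdc, if_neg (by simpa using hk.symm), ha, map_zero,
      sub_zero, zero_sub, neg_eq_zero] at this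
    exact z_injOn t (o.d_mem_Gr k (h.1 3)) this
  have g2 := o.d_mem_Gr t (h.1 3)
  have g1 := o.d_mem_Gr t g2
  have g0 := o.d_mem_Gr t g1
  have e3 := eq_z_d (h.1 3) hd
  have e2 := eq_z_d g2 fun k hk => by rw [o.dd, hd k hk, map_zero]
  have e1 := eq_z_d g1 fun k hk => by rw [o.dd, o.dd k, hd k hk, map_zero, map_zero]
  refine ⟨(((2 + 1 : ℕ) : ℂ)⁻¹ * ((1 + 1 : ℕ) : ℂ)⁻¹ * ((0 + 1 : ℕ) : ℂ)⁻¹) •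
    o.d t (o.d t (o.d t (u 3))), ⟨fun k => ?_, fun k => ?_, fun k _ => ?_, fun k hk => ?_⟩, ?_⟩
  · rw [map_smul, o.mem_Gr_zero.mp g0, smul_zero]
  · rw [map_smul, ← o.ddc, ← o.ddc, ← o.ddc, hb]; simp
  · rw [map_smul, ← o.d_c, ← o.d_c, ← o.d_c, ha]; simp
  · exact absurd k.2 (by omega)
  · rw [map_smul, map_smul, map_smul, mul_smul, mul_smul]
    conv_lhs => rw [e3, e2, e1]
    simp only [map_smul]

/-- In fermion number less than `n`, a singular vector of odd bosonic degree has no component of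
degree `3`, since that component would have all `n` modes of type `a` filled. -/
theorem IsComp.odd_lt {w : M} {u : ℕ → M} (h : o.IsComp w u) (hw : o.Sing w)
    {i : ℕ} (hin : i < n) (hi : o.NF w = (i : ℂ) • w) : u 3 = 0 :=
  eq_zero_of_a_of_lt (h.odd_a hw) hin (h.map_eq (fun _ _ => NF_mem_Gr) hi 3)

end Osc

end

section

/-! ### The Fock space of an oscillator system -/

section Eigen

variable {M : Type*} [AddCommGroup M] [Module ℂ M]

/-- An eigenvector in a sum of eigenspaces belongs to one of them. -/
theorem exists_eq_of_mem_iSup_eigenspace {ι : Type*} (T : End ℂ M) (f : ι → ℂ) {x : M}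
    (hx : x ∈ ⨆ i, End.eigenspace T (f i)) (h0 : x ≠ 0) {μ : ℂ} (hμ : T x = μ • x) :
    ∃ i, μ = f i := by
  by_contra! hne
  have hd := (End.eigenspaces_iSupIndep T) μ
  refine h0 (Submodule.disjoint_def.mp hd x (End.mem_eigenspace_iff.mpr hμ) ?_)
  refine (iSup_le fun i => ?_ : (⨆ i, End.eigenspace T (f i)) ≤ _) hx
  exact le_iSup₂_of_le (f i) (hne i).symm le_rfl

end Eigen

namespace Osc

variable {n : ℕ} {M : Type*} [AddCommGroup M] [Module ℂ M] (o : Osc n M)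

/-- `Ω` is annihilated by all annihilation operators, and `par` is the parity operator of the
bosonic degree. -/
structure Vacuum (Ω : M) (par : End ℂ M) : Prop where
  d : ∀ k, o.d k Ω = 0
  dc : ∀ r, o.dc r Ω = 0
  par_z : ∀ k x, par (o.z k x) = -o.z k (par x)
  par_c : ∀ r x, par (o.c r x) = o.c r (par x)
  par_vac : par Ω = Ω

/-- The Fock space: the smallest subspace that contains the vacuum and is stable under the creation
operators. -/
def fock (Ω : M) : Submodule ℂ M :=
  sInf {p | Ω ∈ p ∧ (∀ k, ∀ x ∈ p, o.z k x ∈ p) ∧ ∀ r, ∀ x ∈ p, o.c r x ∈ p}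

variable {o} {Ω : M} {par : End ℂ M}

theorem fock_le {p : Submodule ℂ M} (h0 : Ω ∈ p) (hz : ∀ k, ∀ x ∈ p, o.z k x ∈ p)
    (hc : ∀ r, ∀ x ∈ p, o.c r x ∈ p) : o.fock Ω ≤ p := sInf_le ⟨h0, hz, hc⟩

theorem vac_mem_fock : Ω ∈ o.fock Ω := Submodule.mem_sInf.mpr fun _ h => h.1

theorem z_mem_fock (k) {x : M} (hx : x ∈ o.fock Ω) : o.z k x ∈ o.fock Ω :=
  Submodule.mem_sInf.mpr fun p h => h.2.1 k x (Submodule.mem_sInf.mp hx p h)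

theorem c_mem_fock (r) {x : M} (hx : x ∈ o.fock Ω) : o.c r x ∈ o.fock Ω :=
  Submodule.mem_sInf.mpr fun p h => h.2.2 r x (Submodule.mem_sInf.mp hx p h)

theorem ite_mem {p : Submodule ℂ M} {q : Prop} [Decidable q] {x : M} (h : x ∈ p) :
    (if q then x else 0) ∈ p := by
  split_ifs
  exacts [h, zero_mem _]

theorem d_mem_fock (hv : o.Vacuum Ω par) (k) {x : M} (hx : x ∈ o.fock Ω) : o.d k x ∈ o.fock Ω := by
  suffices h : o.fock Ω ≤ o.fock Ω ⊓ (o.fock Ω).comap (o.d k) from (h hx).2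
  refine fock_le ⟨vac_mem_fock, by simp [hv.d]⟩ (fun l x hx => ⟨z_mem_fock l hx.1, ?_⟩)
    (fun r x hx => ⟨c_mem_fock r hx.1, ?_⟩)
  · change o.d k (o.z l x) ∈ o.fock Ω
    rw [o.dz]
    exact add_mem (z_mem_fock l hx.2) (ite_mem hx.1)
  · change o.d k (o.c r x) ∈ o.fock Ω
    rw [o.d_c]
    exact c_mem_fock r hx.2

theorem dc_mem_fock (hv : o.Vacuum Ω par) (s) {x : M} (hx : x ∈ o.fock Ω) :
    o.dc s x ∈ o.fock Ω := by
  suffices h : o.fock Ω ≤ o.fock Ω ⊓ (o.fock Ω).comap (o.dc s) from (h hx).2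
  refine fock_le ⟨vac_mem_fock, by simp [hv.dc]⟩ (fun l x hx => ⟨z_mem_fock l hx.1, ?_⟩)
    (fun r x hx => ⟨c_mem_fock r hx.1, ?_⟩)
  · change o.dc s (o.z l x) ∈ o.fock Ω
    rw [← o.zdc]
    exact z_mem_fock l hx.2
  · change o.dc s (o.c r x) ∈ o.fock Ω
    rw [o.dcc]
    exact sub_mem (ite_mem hx.1) (c_mem_fock r hx.2)

/-! ### Bosonic degree and parity on the Fock space -/

theorem fock_le_iSup_Gr (hv : o.Vacuum Ω par) :
    o.fock Ω ≤ ⨆ m : ℕ, o.fock Ω ⊓ (o.Gr m ⊓ End.eigenspace par ((-1) ^ m)) := by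
  refine fock_le (Submodule.mem_iSup_of_mem 0 ⟨vac_mem_fock, o.mem_Gr_zero.mpr hv.d, ?_⟩)
    (fun k x hx => ?_) (fun r x hx => ?_)
  · simp [hv.par_vac]
  · induction hx using Submodule.iSup_induction' with
    | mem m x hx =>
      refine Submodule.mem_iSup_of_mem (m + 1) ⟨z_mem_fock k hx.1, o.z_mem_Gr k hx.2.1, ?_⟩
      refine End.mem_eigenspace_iff.mpr ?_
      rw [hv.par_z, End.mem_eigenspace_iff.mp hx.2.2, pow_succ]
      simp
    | zero => simp
    | add x y _ _ h1 h2 => rw [map_add]; exact add_mem h1 h2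
  · induction hx using Submodule.iSup_induction' with
    | mem m x hx =>
      refine Submodule.mem_iSup_of_mem m ⟨c_mem_fock r hx.1, o.c_mem_Gr r hx.2.1, ?_⟩
      refine End.mem_eigenspace_iff.mpr ?_
      rw [hv.par_c, End.mem_eigenspace_iff.mp hx.2.2, map_smul]
    | zero => simp
    | add x y _ _ h1 h2 => rw [map_add]; exact add_mem h1 h2

theorem exists_isComp_of_mem_iSup {p : ℕ → Submodule ℂ M} (hp : ∀ m, p m ≤ o.Gr m) {x : M}
    (hx : x ∈ ⨆ m, p m) : ∃ u, o.IsComp x u ∧ ∀ m, u m ∈ p m := by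
  obtain ⟨f, hf, hs⟩ := (Submodule.mem_iSup_iff_exists_finsupp _ _).mp hx
  refine ⟨f, ⟨fun m => hp m (hf m), f.support.sup id + 1, fun m hm => ?_, ?_⟩, hf⟩
  · by_contra h
    have := Finset.le_sup (f := id) (Finsupp.mem_support_iff.mpr h)
    simp only [id] at this
    omega
  · rw [← hs]
    refine Finset.sum_subset (fun m hm => ?_) fun m _ hm => by simpa using hm
    have := Finset.le_sup (f := id) hm
    simp only [id] at this
    exact Finset.mem_range.mpr (by omega)

/-- A vector of the Fock space of parity `s` is the sum of its bosonic components, which belong to the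
Fock space and are nonzero only in degrees of parity `s`. -/
theorem exists_isComp (hv : o.Vacuum Ω par) {x : M} (hx : x ∈ o.fock Ω) {s : Fin 2}
    (hs : par x = (-1 : ℂ) ^ (s : ℕ) • x) :
    ∃ u, o.IsComp x u ∧ (∀ m, u m ∈ o.fock Ω) ∧
      ∀ m, (-1 : ℂ) ^ m ≠ (-1) ^ (s : ℕ) → u m = 0 := by
  obtain ⟨u, hu, hm⟩ := exists_isComp_of_mem_iSup (fun _ => inf_le_right.trans inf_le_left)
    (fock_le_iSup_Gr hv hx)
  refine ⟨u, hu, fun m => (hm m).1, fun m hne => ?_⟩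
  obtain ⟨N, hN, -, h2⟩ := hu.exists_ge (m + 1)
  have := o.eq_zero_of_sum_Gr (N := N) (u := fun m => ((-1 : ℂ) ^ m - (-1) ^ (s : ℕ)) • u m)
    (fun m => Submodule.smul_mem _ _ (hu.1 m)) (m := m) ?_ (by omega)
  · exact (smul_eq_zero.mp this).resolve_left (sub_ne_zero.mpr hne)
  · simp only [sub_smul, Finset.sum_sub_distrib]
    rw [← Finset.smul_sum, ← h2, ← hs, sub_eq_zero]
    conv_rhs => rw [h2]
    rw [map_sum]
    exact Finset.sum_congr rfl fun m _ => (End.mem_eigenspace_iff.mp (hm m).2.2).symm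

/-! ### The vacuum and the vectors `a_{i-1} ⋯ a_0 Ω` -/

theorem NF_c (r) (x : M) : o.NF (o.c r x) = o.c r (o.NF x) + o.c r x := by
  simp only [NF, LinearMap.sum_apply, map_sum]
  rw [← Finset.add_sum_erase _ _ (Finset.mem_univ r), ← Finset.add_sum_erase (a := r) _ _ (Finset.mem_univ r)]
  rw [Finset.sum_congr rfl fun s hs => o.num_c_ne (Finset.ne_of_mem_erase hs) x, num_apply,
    o.c_dc_c, o.num_apply r, o.c_self]
  abel

theorem NF_z (k) (x : M) : o.NF (o.z k x) = o.z k (o.NF x) := by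
  simp only [NF, LinearMap.sum_apply, map_sum, num_apply, o.zc, o.zdc]

theorem NZ_c (r) (x : M) : o.NZ (o.c r x) = o.c r (o.NZ x) := by
  simp only [NZ_apply, map_sum, o.zc, o.d_c]

/-- The vacuum is unique up to scalars. -/
theorem mem_span_vac (hv : o.Vacuum Ω par) {x : M} (hx : x ∈ o.fock Ω) (hd : ∀ k, o.d k x = 0)
    (hdc : ∀ r, o.dc r x = 0) : ∃ t : ℂ, x = t • Ω := by
  let N := o.NZ + o.NF
  have hNz : ∀ k x, N (o.z k x) = o.z k (N x) + o.z k x := fun k x => by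
    simp only [N, LinearMap.add_apply, NZ_z, NF_z, map_add]; abel
  have hNc : ∀ k x, N (o.c k x) = o.c k (N x) + o.c k x := fun k x => by
    simp only [N, LinearMap.add_apply, NZ_c, NF_c, map_add]; abel
  have hN : ∀ x : M, (∀ k, o.d k x = 0) → (∀ r, o.dc r x = 0) → N x = 0 := fun x h1 h2 => by
    simp [N, NZ_apply, NF_apply, h1, h2]
  have hle : o.fock Ω ≤ Submodule.span ℂ {Ω} ⊔ ⨆ m : ℕ, End.eigenspace N ((m + 1 : ℕ) : ℂ) := by
    have key : ∀ T : End ℂ M, (∀ x, N (T x) = T (N x) + T x) →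
        ∀ x ∈ Submodule.span ℂ {Ω} ⊔ ⨆ m : ℕ, End.eigenspace N ((m + 1 : ℕ) : ℂ),
          T x ∈ Submodule.span ℂ {Ω} ⊔ ⨆ m : ℕ, End.eigenspace N ((m + 1 : ℕ) : ℂ) := by
      intro T hT x hx
      obtain ⟨y, hy, z, hz, rfl⟩ := Submodule.mem_sup.mp hx
      obtain ⟨t, rfl⟩ := Submodule.mem_span_singleton.mp hy
      rw [map_add, map_smul]
      refine Submodule.mem_sup_right (add_mem (Submodule.smul_mem _ _ ?_) ?_)
      · refine Submodule.mem_iSup_of_mem 0 (End.mem_eigenspace_iff.mpr ?_)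
        rw [hT, hN Ω hv.d hv.dc]; simp
      · clear hx
        induction hz using Submodule.iSup_induction' with
        | mem m x hx =>
          refine Submodule.mem_iSup_of_mem (m + 1) (End.mem_eigenspace_iff.mpr ?_)
          rw [hT, End.mem_eigenspace_iff.mp hx]
          push_cast
          simp only [map_smul, map_add, add_smul, one_smul]
        | zero => simp
        | add x y _ _ h1 h2 => rw [map_add]; exact add_mem h1 h2
    exact fock_le (Submodule.mem_sup_left (Submodule.mem_span_singleton_self _))
      (fun k => key _ (hNz k)) (fun r => key _ (hNc r))
  obtain ⟨y, hy, w, hw, rfl⟩ := Submodule.mem_sup.mp (hle hx)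
  obtain ⟨t, rfl⟩ := Submodule.mem_span_singleton.mp hy
  have hw0 : N w = (0 : ℂ) • w := by
    have := hN _ hd hdc
    rw [map_add, map_smul, hN Ω hv.d hv.dc, smul_zero, zero_add] at this
    rw [this, zero_smul]
  refine ⟨t, ?_⟩
  by_cases h : w = 0
  · rw [h, add_zero]
  · obtain ⟨m, hm⟩ := exists_eq_of_mem_iSup_eigenspace N _ hw h hw0
    exact absurd hm.symm (by exact_mod_cast Nat.succ_ne_zero m)

variable (o) in
/-- The vector `a_{i-1} ⋯ a_0 Ω`. -/
def vec (Ω : M) : ℕ → M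
  | 0 => Ω
  | i + 1 => if h : i < n then o.a ⟨i, h⟩ (vec Ω i) else 0

theorem vec_mem_fock (i : ℕ) : o.vec Ω i ∈ o.fock Ω := by
  induction i with
  | zero => exact vac_mem_fock
  | succ i ih =>
    rw [vec]
    split_ifs
    exacts [c_mem_fock _ ih, zero_mem _]

theorem vec_succ {i : ℕ} (h : i < n) : o.vec Ω (i + 1) = o.a ⟨i, h⟩ (o.vec Ω i) := by
  rw [vec, dif_pos h]

theorem vac_vec (hv : o.Vacuum Ω par) {i : ℕ} (hi : i ≤ n) : o.Vac i (o.vec Ω i) := by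
  induction i with
  | zero =>
    exact ⟨hv.d, fun k => hv.dc _, fun k hk => absurd hk (by omega), fun k _ => hv.dc _⟩
  | succ i ih =>
    have h := ih (by omega)
    rw [vec_succ (by omega)]
    refine ⟨fun k => ?_, fun k => ?_, fun k hk => ?_, fun k hk => ?_⟩
    · rw [o.d_c, h.d, map_zero]
    · rw [o.dcc_ne (by simp), h.db, map_zero, neg_zero]
    · rcases Nat.lt_succ_iff_lt_or_eq.mp hk with hk | hk
      · rw [o.cc, h.a k hk, map_zero, neg_zero]
      · have : k = ⟨i, by omega⟩ := Fin.ext hk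
        rw [this, o.c_self]
    · rw [o.dcc_ne (by simp [Fin.ext_iff]; omega), h.da k (by omega), map_zero, neg_zero]

theorem Vac.eq_smul_vec (hv : o.Vacuum Ω par) {i : ℕ} (hi : i ≤ n) {x : M} (hx : o.Vac i x)
    (hm : x ∈ o.fock Ω) : ∃ t : ℂ, x = t • o.vec Ω i := by
  induction i generalizing x with
  | zero =>
    refine mem_span_vac hv hm hx.d fun r => ?_
    rcases r with k | k
    exacts [hx.da k (Nat.zero_le _), hx.db k]
  | succ i ih =>
    let k : Fin n := ⟨i, by omega⟩
    have hy : o.Vac i (o.da k x) := by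
      refine ⟨fun l => ?_, fun l => ?_, fun l hl => ?_, fun l hl => ?_⟩
      · rw [o.ddc, hx.d, map_zero]
      · rw [o.dcdc, hx.db, map_zero, neg_zero]
      · rw [o.cdc, if_neg (by simp [Fin.ext_iff, k]; omega), hx.a l (by omega), map_zero, sub_zero]
      · rcases hl.eq_or_lt with hl | hl
        · have : l = k := Fin.ext hl.symm
          rw [this, o.dc_self]
        · rw [o.dcdc, hx.da l hl, map_zero, neg_zero]
    obtain ⟨t, ht⟩ := ih (by omega) hy (dc_mem_fock hv _ hm)
    refine ⟨t, ?_⟩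
    rw [vec_succ (by omega), ← map_smul, ← ht, o.cdc, if_pos rfl, hx.a k (Nat.lt_succ_self i),
      map_zero, sub_zero]

/-! ### The grading by heights -/

theorem R_self_a (k l : Fin n) (x : M) :
    o.R k k (o.a l x) = o.a l (o.R k k x) + if k = l then o.a l x else 0 := by
  simp only [R_apply, o.d_c, o.zc, map_sub, ← num_apply,
    o.num_c_ne (show Sum.inr k ≠ Sum.inl l by simp)]
  by_cases h : k = l
  · subst h
    rw [if_pos rfl, num_apply, o.c_dc_c, o.num_apply (Sum.inl k), o.c_self]; abel
  · rw [if_neg h, o.num_c_ne (show Sum.inl k ≠ Sum.inl l by simpa using h), add_zero]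

theorem R_self_b (k l : Fin n) (x : M) :
    o.R k k (o.b l x) = o.b l (o.R k k x) - if k = l then o.b l x else 0 := by
  simp only [R_apply, o.d_c, o.zc, map_sub, ← num_apply,
    o.num_c_ne (show Sum.inl k ≠ Sum.inr l by simp)]
  by_cases h : k = l
  · subst h
    rw [if_pos rfl, num_apply, o.num_apply (Sum.inr k) (o.b k x), o.c_dc_c, o.num_apply (Sum.inr k),
      o.c_self]
    abel
  · rw [if_neg h, o.num_c_ne (show Sum.inr k ≠ Sum.inr l by simpa using h), sub_zero]

theorem R_self_z (k l : Fin n) (x : M) :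
    o.R k k (o.z l x) = o.z l (o.R k k x) - if k = l then o.z l x else 0 := by
  simp only [R_apply, map_sub, o.zc, o.zdc, o.dz, map_add]
  rw [o.zz k l]
  split_ifs with h
  · rw [h]; abel
  · simp

variable (o) in
/-- The element `∑ (n - k) H_k` of the Cartan subalgebra (`k = 0, …, n - 1`), up to a constant. It
is positive on the positive roots. -/
def ht : End ℂ M := ∑ k : Fin n, ((n - k : ℕ) : ℂ) • o.R k k

theorem ht_apply (x : M) : o.ht x = ∑ k : Fin n, ((n - k : ℕ) : ℂ) • o.R k k x := by simp [ht]

theorem ht_a (l : Fin n) (x : M) : o.ht (o.a l x) = o.a l (o.ht x) + ((n - l : ℕ) : ℂ) • o.a l x := by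
  simp [ht_apply, R_self_a, Finset.sum_add_distrib, smul_add]

theorem ht_b (l : Fin n) (x : M) : o.ht (o.b l x) = o.b l (o.ht x) - ((n - l : ℕ) : ℂ) • o.b l x := by
  simp [ht_apply, R_self_b, Finset.sum_sub_distrib, smul_sub]

theorem ht_z (l : Fin n) (x : M) : o.ht (o.z l x) = o.z l (o.ht x) - ((n - l : ℕ) : ℂ) • o.z l x := by
  simp [ht_apply, R_self_z, Finset.sum_sub_distrib, smul_sub]

variable (o) in
/-- The span of the products of the fermionic creation operators in `l`, applied to the vacuum. -/
def fer (Ω : M) : List (Fin n ⊕ Fin n) → Submodule ℂ M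
  | [] => Submodule.span ℂ {Ω}
  | r :: l => fer Ω l ⊔ (fer Ω l).map (o.c r)

theorem c_mem_fer {l : List (Fin n ⊕ Fin n)} {r} (hr : r ∈ l) {x : M} (hx : x ∈ o.fer Ω l) :
    o.c r x ∈ o.fer Ω l := by
  induction l generalizing x with
  | nil => simp at hr
  | cons s l ih =>
    obtain ⟨y, hy, z, ⟨z, hz, rfl⟩, rfl⟩ := Submodule.mem_sup.mp hx
    rw [map_add]
    by_cases h : r = s
    · subst h
      rw [o.c_self, add_zero]
      exact Submodule.mem_sup_right ⟨y, hy, rfl⟩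
    · have hr' : r ∈ l := (List.mem_cons.mp hr).resolve_left h
      rw [o.cc]
      exact add_mem (Submodule.mem_sup_left (ih hr' hy))
        (neg_mem (Submodule.mem_sup_right ⟨_, ih hr' hz, rfl⟩))

theorem fer_finite (l : List (Fin n ⊕ Fin n)) : (o.fer Ω l).FG := by
  induction l with
  | nil => exact Submodule.fg_span_singleton _
  | cons s l ih => exact ih.sup (ih.map _)

variable (o) in
/-- The sum of the eigenspaces of `ht` for the integers `t ≤ s`. -/
def htLe (s : ℤ) : Submodule ℂ M := ⨆ t : {t : ℤ // t ≤ s}, End.eigenspace o.ht (t : ℤ)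

theorem map_mem_htLe {T : End ℂ M} {c s s' : ℤ} (hT : ∀ x, o.ht (T x) = T (o.ht x) + (c : ℂ) • T x)
    (hs : s + c ≤ s') {x : M} (hx : x ∈ o.htLe s) : T x ∈ o.htLe s' := by
  induction hx using Submodule.iSup_induction' with
  | mem t x hx =>
    refine Submodule.mem_iSup_of_mem ⟨t + c, by linarith [t.2]⟩ (End.mem_eigenspace_iff.mpr ?_)
    rw [hT, End.mem_eigenspace_iff.mp hx, map_smul, ← add_smul]
    push_cast; rfl
  | zero => simp
  | add x y _ _ h1 h2 => rw [map_add]; exact add_mem h1 h2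

theorem htLe_mono {s s' : ℤ} (h : s ≤ s') : o.htLe s ≤ o.htLe s' :=
  iSup_le fun t => le_iSup_of_le ⟨t, t.2.trans h⟩ le_rfl

/-- Each fermionic creation operator raises the eigenvalue of `ht` by at most `n`. -/
theorem fer_le (hv : o.Vacuum Ω par) (l : List (Fin n ⊕ Fin n)) :
    o.fer Ω l ≤ o.htLe (n * l.length) := by
  induction l with
  | nil =>
    refine (Submodule.span_singleton_le_iff_mem _ _).mpr ?_
    refine Submodule.mem_iSup_of_mem ⟨0, by simp⟩ (End.mem_eigenspace_iff.mpr ?_)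
    simp [ht_apply, R_apply, hv.d, hv.dc]
  | cons r l ih =>
    refine sup_le (ih.trans (htLe_mono (by simp; nlinarith))) ?_
    rintro _ ⟨x, hx, rfl⟩
    rcases r with k | k
    · refine map_mem_htLe (c := (n - k : ℕ)) (fun x => ?_) ?_ (ih hx)
      · exact_mod_cast ht_a k x
      · simp only [List.length_cons]; push_cast; rw [mul_add]; gcongr; simp
    · refine map_mem_htLe (c := -(n - k : ℕ)) (fun x => ?_) ?_ (ih hx)
      · have := ht_b (o := o) k x
        rw [Int.cast_neg, neg_smul, ← sub_eq_add_neg]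
        exact_mod_cast this
      · simp only [List.length_cons]; push_cast; rw [mul_add]; gcongr; omega

variable (o) in
/-- The part of bosonic degree `m` of the Fock space. -/
def fockGr (Ω : M) : ℕ → Submodule ℂ M
  | 0 => o.fer Ω Finset.univ.toList
  | m + 1 => ⨆ k, (fockGr Ω m).map (o.z k)

theorem c_mem_fockGr (r) {m : ℕ} {x : M} (hx : x ∈ o.fockGr Ω m) : o.c r x ∈ o.fockGr Ω m := by
  induction m generalizing x with
  | zero => exact c_mem_fer (by simp) hx
  | succ m ih =>
    rw [fockGr] at hx ⊢
    induction hx using Submodule.iSup_induction' with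
    | mem k x hx =>
      obtain ⟨x, hx, rfl⟩ := hx
      exact Submodule.mem_iSup_of_mem k ⟨_, ih hx, o.zc _ _ _⟩
    | zero => simp
    | add x y _ _ h1 h2 => rw [map_add]; exact add_mem h1 h2

theorem vac_mem_fer (l : List (Fin n ⊕ Fin n)) : Ω ∈ o.fer Ω l := by
  induction l with
  | nil => exact Submodule.mem_span_singleton_self _
  | cons r l ih => exact Submodule.mem_sup_left ih

theorem fock_le_iSup_fockGr : o.fock Ω ≤ ⨆ m, o.fockGr Ω m := by
  refine fock_le (Submodule.mem_iSup_of_mem 0 (vac_mem_fer _)) (fun k x hx => ?_) (fun r x hx => ?_)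
  · induction hx using Submodule.iSup_induction' with
    | mem m x hx =>
      exact Submodule.mem_iSup_of_mem (m + 1) (Submodule.mem_iSup_of_mem k ⟨x, hx, rfl⟩)
    | zero => simp
    | add x y _ _ h1 h2 => rw [map_add]; exact add_mem h1 h2
  · induction hx using Submodule.iSup_induction' with
    | mem m x hx => exact Submodule.mem_iSup_of_mem m (c_mem_fockGr r hx)
    | zero => simp
    | add x y _ _ h1 h2 => rw [map_add]; exact add_mem h1 h2

theorem fockGr_fg (m : ℕ) : (o.fockGr Ω m).FG := by
  induction m with
  | zero => exact fer_finite _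
  | succ m ih => exact Submodule.fg_iSup _ fun k => ih.map _

theorem fer_le_Gr (hv : o.Vacuum Ω par) (l : List (Fin n ⊕ Fin n)) : o.fer Ω l ≤ o.Gr 0 := by
  induction l with
  | nil => exact (Submodule.span_singleton_le_iff_mem _ _).mpr (o.mem_Gr_zero.mpr hv.d)
  | cons r l ih =>
    refine sup_le ih ?_
    rintro _ ⟨x, hx, rfl⟩
    exact o.c_mem_Gr r (ih hx)

theorem fockGr_le_Gr (hv : o.Vacuum Ω par) (m : ℕ) : o.fockGr Ω m ≤ o.Gr m := by
  induction m with
  | zero => exact fer_le_Gr hv _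
  | succ m ih =>
    refine iSup_le fun k => ?_
    rintro _ ⟨x, hx, rfl⟩
    exact o.z_mem_Gr k (ih hx)

/-- Each boson lowers the eigenvalue of `ht` by at least `1`. -/
theorem fockGr_le_htLe (hv : o.Vacuum Ω par) (m : ℕ) :
    o.fockGr Ω m ≤ o.htLe (n * (n + n) - m) := by
  induction m with
  | zero =>
    have := fer_le (o := o) hv Finset.univ.toList
    simpa [fockGr] using this
  | succ m ih =>
    refine iSup_le fun k => ?_
    rintro _ ⟨x, hx, rfl⟩
    refine map_mem_htLe (c := -(n - k : ℕ)) (fun x => ?_) ?_ (ih hx)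
    · have := ht_z (o := o) k x
      rw [Int.cast_neg, neg_smul, ← sub_eq_add_neg]
      exact_mod_cast this
    · push_cast; have := k.2; omega

theorem ht_mem_Gr {m : ℕ} {x : M} (h : x ∈ o.Gr m) : o.ht x ∈ o.Gr m := by
  rw [ht_apply]
  exact sum_mem fun k _ => Submodule.smul_mem _ _ (R_mem_Gr k k h)

/-- On the Fock space, `ht` is diagonalizable with integral eigenvalues bounded above, since there are
only finitely many fermionic modes, and bosons have negative weight. -/
theorem fock_le_htLe (hv : o.Vacuum Ω par) : o.fock Ω ≤ o.htLe (n * (n + n)) :=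
  fock_le_iSup_fockGr.trans (iSup_le fun m => (fockGr_le_htLe hv m).trans (htLe_mono (by simp)))

theorem exists_le_of_mem_htLe {s : ℤ} {x : M} (hx : x ∈ o.htLe s) (h0 : x ≠ 0) {μ : ℂ}
    (hμ : o.ht x = μ • x) : ∃ t : ℤ, t ≤ s ∧ μ = t := by
  obtain ⟨t, ht⟩ := exists_eq_of_mem_iSup_eigenspace o.ht _ hx h0 hμ
  exact ⟨t, t.2, ht⟩

/-- The eigenspaces of `ht` in the Fock space are finite-dimensional. -/
theorem finite_eigenspace_ht (hv : o.Vacuum Ω par) (μ : ℂ) :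
    Module.Finite ℂ ↥(o.fock Ω ⊓ End.eigenspace o.ht μ) := by
  by_cases hμ : ∃ t : ℤ, μ = t
  · obtain ⟨t, rfl⟩ := hμ
    let L : ℕ := (n * (n + n) - t).toNat
    have hle : o.fock Ω ⊓ End.eigenspace o.ht (t : ℂ) ≤ ⨆ m : Fin (L + 1), o.fockGr Ω m := by
      rintro x ⟨hx, hxt⟩
      obtain ⟨u, hu, hum⟩ := exists_isComp_of_mem_iSup (fockGr_le_Gr hv) (fock_le_iSup_fockGr hx)
      have h0 : ∀ m, L < m → u m = 0 := by
        intro m hm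
        by_contra hne
        obtain ⟨s, hs, hts⟩ := exists_le_of_mem_htLe (fockGr_le_htLe hv m (hum m)) hne
          (hu.map_eq (fun _ _ => ht_mem_Gr) (End.mem_eigenspace_iff.mp hxt) m)
        have : t = s := by exact_mod_cast hts
        omega
      obtain ⟨N, -, -, h2⟩ := hu.exists_ge 0
      rw [h2]
      refine sum_mem fun m _ => ?_
      by_cases hm : m ≤ L
      · exact Submodule.mem_iSup_of_mem (⟨m, by omega⟩ : Fin (L + 1)) (hum m)
      · rw [h0 m (by omega)]; exact zero_mem _
    have hf : (⨆ m : Fin (L + 1), o.fockGr Ω m).FG := Submodule.fg_iSup _ fun m => fockGr_fg _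
    have := Module.Finite.of_fg hf
    exact Submodule.finiteDimensional_of_le hle
  · have : o.fock Ω ⊓ End.eigenspace o.ht μ = ⊥ := by
      refine (Submodule.eq_bot_iff _).mpr fun x hx => ?_
      by_contra h0
      obtain ⟨t, -, ht⟩ := exists_le_of_mem_htLe (fock_le_htLe hv hx.1) h0
        (End.mem_eigenspace_iff.mp hx.2)
      exact hμ ⟨t, ht⟩
    rw [this]
    infer_instance

end Osc

end

section

/-! ### Highest weight vectors -/

namespace Osc

variable {n : ℕ} {M : Type*} [AddCommGroup M] [Module ℂ M] {o : Osc n M}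
  {Ω : M} {par : End ℂ M}

variable (o) in
/-- The part of fermion number `i` and boson parity `s` of `ker D` in the Fock space. -/
def prim (Ω : M) (par : End ℂ M) (s : Fin 2) (i : ℕ) : Submodule ℂ M :=
  o.fock Ω ⊓ (End.eigenspace par ((-1) ^ (s : ℕ)) ⊓ (End.eigenspace o.NF (i : ℂ) ⊓
    LinearMap.ker o.D))

theorem mem_prim {s : Fin 2} {i : ℕ} {x : M} : x ∈ o.prim Ω par s i ↔
    x ∈ o.fock Ω ∧ par x = (-1 : ℂ) ^ (s : ℕ) • x ∧ o.NF x = (i : ℂ) • x ∧ o.D x = 0 := by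
  simp [prim]

variable (o) in
/-- The highest weight vector of weight `(1/2, …, 1/2, -5/2)`; here `t` is the last index `n - 1`. -/
def topVec (Ω : M) (t : Fin n) : M :=
  o.z t (o.b t (o.vec Ω (n - 1))) - (3⁻¹ : ℂ) • o.z t (o.z t (o.z t (o.a t (o.vec Ω (n - 1)))))

variable (o) in
/-- The highest weight vectors of the `sp(2n)`-modules `prim Ω par s i`. -/
def hvec (Ω : M) (t : Fin n) (s : Fin 2) (i : ℕ) : M :=
  if s = 0 then o.vec Ω i else if i < n then o.z t (o.vec Ω i) else o.topVec Ω t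

section

variable {t : Fin n} (ht : (t : ℕ) + 1 = n) (hv : o.Vacuum Ω par)
include ht hv

theorem vac_pred : o.Vac (t : ℕ) (o.vec Ω (n - 1)) := by
  have : (t : ℕ) = n - 1 := by omega
  rw [this]; exact vac_vec hv (by omega)

theorem d_topVec {k : Fin n} (hk : k ≠ t) : o.d k (o.topVec Ω t) = 0 := by
  have h := vac_pred ht hv
  simp [topVec, o.dz, hk, o.d_c, h.d]

theorem db_topVec (k : Fin n) :
    o.db k (o.topVec Ω t) = if k = t then o.z t (o.vec Ω (n - 1)) else 0 := by
  have h := vac_pred ht hv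
  simp only [topVec, map_sub, map_smul, ← o.zdc, o.dcc, h.db]
  by_cases hk : k = t <;> simp [hk]

theorem d_d_topVec : o.d t (o.d t (o.topVec Ω t)) =
    -((2 : ℂ) • o.z t (o.a t (o.vec Ω (n - 1)))) := by
  have h := vac_pred ht hv
  simp only [topVec, map_sub, map_smul, o.dz, if_true, map_add, o.d_c, h.d, map_zero, zero_add]
  module

theorem a_topVec {k : Fin n} (hk : k ≠ t) : o.a k (o.topVec Ω t) = 0 := by
  have h := vac_pred ht hv
  have hk' : (k : ℕ) < t := by
    have := k.2
    have : (k : ℕ) ≠ t := fun h => hk (Fin.ext h)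
    omega
  simp only [topVec, map_sub, map_smul, ← o.zc]
  rw [o.cc _ (Sum.inr t), o.cc _ (Sum.inl t), h.a k hk']
  simp

/-- The coefficient in `topVec` makes the components of degree `1` of `X t t w` cancel. -/
theorem sing_topVec : o.Sing (o.topVec Ω t) := by
  have h := vac_pred ht hv
  refine ⟨fun k l => ?_, fun k l hkl => ?_, ?_⟩
  · rw [X_apply, XF_apply, db_topVec ht hv, db_topVec ht hv]
    by_cases hk : k = t
    · by_cases hl : l = t
      · subst hk; subst hl
        rw [d_d_topVec ht hv, if_pos rfl, ← o.zc]
        module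
      · subst hk
        have hl' : (l : ℕ) < k := by
          have := l.2
          have : (l : ℕ) ≠ k := fun h => hl (Fin.ext h)
          omega
        rw [d_topVec ht hv hl, if_neg hl, if_pos rfl, map_zero, map_zero, ← o.zc,
          h.a l hl', map_zero]
        simp
    · have hk' : (k : ℕ) < t := by
        have := k.2
        have : (k : ℕ) ≠ t := fun h => hk (Fin.ext h)
        omega
      rw [o.dd, d_topVec ht hv hk, if_neg hk, map_zero, map_zero]
      split_ifs
      · rw [← o.zc, h.a k hk', map_zero]; simp
      · simp
  · have hk : k ≠ t := fun h => by
      have := l.2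
      rw [h, Fin.lt_def] at hkl
      omega
    rw [R_apply, d_topVec ht hv hk, db_topVec ht hv, if_neg hk, o.cdc,
      if_neg (by simpa using hkl.ne'), a_topVec ht hv hk]
    simp
  · rw [D_apply]
    refine Finset.sum_eq_zero fun k _ => ?_
    by_cases hk : k = t
    · subst hk
      rw [← o.zdc, db_topVec ht hv, if_pos rfl]
      simp only [topVec, map_sub, map_smul, o.dz, if_true, map_add, o.d_c, h.d, map_zero, zero_add,
        ← o.zdc, o.dcc, if_true, h.da k le_rfl, sub_zero]
      simp only [reduceCtorEq, if_false]
      module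
    · rw [← o.zdc, db_topVec ht hv, if_neg hk, d_topVec ht hv hk, map_zero, map_zero, add_zero]

omit ht in
theorem NF_vec {i : ℕ} (hi : i ≤ n) : o.NF (o.vec Ω i) = (i : ℂ) • o.vec Ω i := by
  induction i with
  | zero => simp [vec, NF_apply, hv.dc]
  | succ i ih =>
    rw [vec_succ (by omega), NF_c, ih (by omega)]
    push_cast
    rw [map_smul, add_smul, one_smul]

omit ht in
theorem par_vec {i : ℕ} (hi : i ≤ n) : par (o.vec Ω i) = o.vec Ω i := by
  induction i with
  | zero => exact hv.par_vac
  | succ i ih =>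
    rw [vec_succ (by omega), hv.par_c, ih (by omega)]

omit ht in
theorem R_self_vec {i : ℕ} (hi : i ≤ n) (k : Fin n) :
    o.R k k (o.vec Ω i) = (if (k : ℕ) < i then (1 : ℂ) else 0) • o.vec Ω i := by
  induction i with
  | zero => simp [vec, R_apply, hv.dc, hv.d]
  | succ i ih =>
    rw [vec_succ (by omega), R_self_a, ih (by omega), map_smul]
    have hk : k = ⟨i, by omega⟩ ↔ (k : ℕ) = i := Fin.ext_iff
    simp only [hk]
    rcases lt_trichotomy (k : ℕ) i with h | h | h
    · rw [if_pos h, if_neg (by omega), if_pos (by omega), add_zero]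
    · rw [if_neg (by omega), if_pos h, if_pos (by omega)]; simp
    · rw [if_neg (by omega), if_neg (by omega), if_neg (by omega)]; simp

theorem hvec_mem_prim {s : Fin 2} {i : ℕ} (hi : i ≤ n) : o.hvec Ω t s i ∈ o.prim Ω par s i := by
  rw [mem_prim, hvec]
  have hs : s ≠ 0 → (s : ℕ) = 1 := fun h => by
    have := s.2
    have : (s : ℕ) ≠ 0 := fun h' => h (Fin.ext h')
    omega
  split_ifs with h1 h2
  · have h := vac_vec hv hi
    refine ⟨vec_mem_fock _, by rw [par_vec hv hi, h1]; simp, NF_vec hv hi, ?_⟩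
    rw [D_apply]
    exact Finset.sum_eq_zero fun k _ => by rw [← o.zdc, h.db, h.d]; simp
  · have h := vac_vec hv hi
    refine ⟨z_mem_fock _ (vec_mem_fock _), by rw [hv.par_z, par_vec hv hi, hs h1]; simp, ?_, ?_⟩
    · rw [NF_z, NF_vec hv hi, map_smul]
    · rw [D_apply]
      refine Finset.sum_eq_zero fun k _ => ?_
      rw [← o.zdc, ← o.zdc, h.db, o.dz, h.d, map_zero, map_zero, zero_add, zero_add]
      split_ifs with hk
      · rw [h.da k (by rw [hk]; omega)]
      · simp
  · obtain rfl : i = n := by omega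
    have hn1 : i - 1 + 1 = i := by omega
    refine ⟨?_, ?_, ?_, (sing_topVec ht hv).D⟩
    · exact sub_mem (z_mem_fock _ (c_mem_fock _ (vec_mem_fock _))) (Submodule.smul_mem _ _
        (z_mem_fock _ (z_mem_fock _ (z_mem_fock _ (c_mem_fock _ (vec_mem_fock _))))))
    · rw [hs h1, topVec]
      simp only [map_sub, map_smul, hv.par_z, hv.par_c, par_vec hv (Nat.sub_le i 1), map_neg]
      module
    · have h : (i : ℂ) = ((i - 1 : ℕ) : ℂ) + 1 := by exact_mod_cast hn1.symm
      rw [h, topVec]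
      simp only [map_sub, map_smul, NF_z, NF_c, NF_vec hv (Nat.sub_le i 1), map_add]
      module

/-- The weight of `hvec`; the shift by `1 / 2` is the zero-point energy of the bosons. -/
theorem R_self_hvec {s : Fin 2} {i : ℕ} (hi : i ≤ n) (k : Fin n) :
    o.R k k (o.hvec Ω t s i) = (spinorWeight n i i s k + 1 / 2) • o.hvec Ω t s i := by
  have hs : s ≠ 0 → (s : ℕ) = 1 := fun h => by
    have := s.2
    have : (s : ℕ) ≠ 0 := fun h' => h (Fin.ext h')
    omega
  have hkt : k = t ↔ (k : ℕ) + 1 = n := by rw [Fin.ext_iff]; omega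
  have hk := k.2
  have he : ((-1 : ℂ)) ^ (i + i) = 1 := Even.neg_one_pow ⟨i, rfl⟩
  rw [hvec]
  split_ifs with h1 h2
  · rw [R_self_vec hv hi]
    subst h1
    congr 1
    simp only [spinorWeight, Fin.val_zero, add_zero, he]
    split_ifs <;> first | omega | norm_num
  · have hw : spinorWeight n i i s k + 1 / 2 =
        (if (k : ℕ) < i then 1 else 0) - if k = t then 1 else 0 := by
      simp only [spinorWeight, hs h1, pow_add, he, hkt]
      split_ifs <;> first | omega | norm_num
    rw [R_self_z, R_self_vec hv hi, map_smul, hw, sub_smul]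
    congr 1
    split_ifs <;> simp
  · obtain rfl : i = n := by omega
    have h3 : s = 1 := Fin.ext (hs h1)
    have hw : spinorWeight i i i s k + 1 / 2 = if k = t then -2 else 1 := by
      simp only [spinorWeight, h3, hkt]
      by_cases h : (k : ℕ) + 1 = i <;> norm_num [h]
    have hk1 : (k : ℕ) < i - 1 ↔ k ≠ t := by rw [Ne, hkt]; omega
    rw [topVec, hw]
    simp only [R_self_z, R_self_a, R_self_b, map_sub, map_smul, R_self_vec hv (Nat.sub_le i 1), hk1,
      map_add]
    by_cases hkt : k = t
    · simp only [hkt, ne_eq, not_true_eq_false, if_true, if_false, zero_smul, zero_sub, zero_add]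
      module
    · simp only [hkt, ne_eq, not_false_eq_true, if_true, if_false, map_zero, one_smul, sub_zero,
        add_zero]

end

/-- Singular vectors are unique up to scalars. In fermion number `n` and odd parity, subtracting a
multiple of `topVec` removes the component of degree `3`, and nothing remains. -/
theorem eq_smul_hvec {t : Fin n} (ht : (t : ℕ) + 1 = n) (hv : o.Vacuum Ω par) {s : Fin 2} {i : ℕ}
    (hi : i ≤ n) {w : M} (hw : w ∈ o.prim Ω par s i) (hs : o.Sing w) :
    ∃ c : ℂ, w = c • o.hvec Ω t s i := by
  have htop : ∀ k, k ≤ t := fun k => by rw [Fin.le_def]; omega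
  obtain ⟨hf, hp, hN, -⟩ := mem_prim.mp hw
  obtain ⟨u, hu, huf, hum⟩ := exists_isComp hv hf hp
  have hodd : s ≠ 0 → ∀ m, u (2 * m) = 0 := fun h m => hum _ <| by
    have := s.2
    have h1 : (s : ℕ) ≠ 0 := fun h' => h (Fin.ext h')
    have h2 : (s : ℕ) = 1 := by omega
    rw [h2, pow_mul]; norm_num
  rw [hvec]
  split_ifs with h1 h2
  · refine Vac.eq_smul_vec hv hi (hu.even_vac hs (fun m => hum _ ?_) hN) hf
    rw [h1, pow_succ, pow_mul]; norm_num
  · obtain ⟨v, hv1, rfl, -⟩ := hu.odd_vac hs (hodd h1) (hu.odd_lt hs h2 hN) hN htop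
    have hvf : v ∈ o.fock Ω := by
      have := d_mem_fock hv t hf
      rwa [o.dz, hv1.d, map_zero, zero_add, if_pos rfl] at this
    obtain ⟨c, rfl⟩ := hv1.eq_smul_vec hv hi hvf
    exact ⟨c, by rw [map_smul]⟩
  · obtain rfl : i = n := by omega
    obtain ⟨q, hq, h3⟩ := hu.odd_top hs hN htop
    have hvac := vac_pred ht hv
    have hqf : q ∈ o.fock Ω := by
      have := d_mem_fock hv t (d_mem_fock hv t (d_mem_fock hv t (huf 3)))
      rw [h3] at this
      simp only [o.dz, if_true, map_add, hq.d, map_zero, zero_add] at this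
      refine (Submodule.smul_mem_iff _ (show (6 : ℂ) ≠ 0 by norm_num)).mp ?_
      convert this using 1
      module
    obtain ⟨c, rfl⟩ := hq.eq_smul_vec hv le_rfl hqf
    have hvi : o.vec Ω i = o.a t (o.vec Ω (i - 1)) := by
      have hi1 : i - 1 + 1 = i := by omega
      have e : (⟨i - 1, by omega⟩ : Fin i) = t := Fin.ext (by simp; omega)
      have := vec_succ (o := o) (Ω := Ω) (i := i - 1) (by omega)
      rwa [e, hi1] at this
    -- subtract the multiple of `topVec` with the same component of degree `3`
    let u' : ℕ → M := fun m => if m = 1 then o.z t (o.b t (o.vec Ω (i - 1))) else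
      if m = 3 then -((3⁻¹ : ℂ) • o.z t (o.z t (o.z t (o.a t (o.vec Ω (i - 1)))))) else 0
    have h0 : o.vec Ω (i - 1) ∈ o.Gr 0 := o.mem_Gr_zero.mpr hvac.d
    have hu' : o.IsComp (o.topVec Ω t) u' := by
      refine ⟨fun m => ?_, 4, fun m hm => ?_, ?_⟩
      · simp only [u']
        split_ifs with h h'
        · rw [h]; exact o.z_mem_Gr t (o.c_mem_Gr _ h0)
        · rw [h']
          exact neg_mem (Submodule.smul_mem _ _ (o.z_mem_Gr t (o.z_mem_Gr t
            (o.z_mem_Gr t (o.c_mem_Gr _ h0)))))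
        · exact zero_mem _
      · simp only [u']
        rw [if_neg (by omega), if_neg (by omega)]
      · simp [u', Finset.sum_range_succ, topVec, sub_eq_add_neg]
    have htv := mem_prim.mp (hvec_mem_prim (o := o) ht hv (s := s) le_rfl)
    rw [hvec, if_neg h1, if_neg (lt_irrefl _)] at htv
    have hsing := sing_topVec (o := o) ht hv
    refine ⟨-3 * c, ?_⟩
    let c' : ℂ := -3 * c
    have hd := hu.sub (hu'.smul c')
    have hds : o.Sing (w - c' • o.topVec Ω t) :=
      ⟨fun k l => by rw [map_sub, map_smul, hs.X, hsing.X, smul_zero, sub_zero],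
        fun k l h => by rw [map_sub, map_smul, hs.R k l h, hsing.R k l h, smul_zero, sub_zero],
        by rw [map_sub, map_smul, hs.D, hsing.D, smul_zero, sub_zero]⟩
    obtain ⟨v, hv1, hv2, hv3⟩ := hd.odd_vac hds (fun m => by
        have h1' : 2 * m ≠ 1 := by omega
        have h3' : 2 * m ≠ 3 := by omega
        simp [u', hodd h1 m, h1', h3'])
      (by
        simp only [Pi.sub_apply, Pi.smul_apply, h3, u', c', hvi, map_smul]
        norm_num
        module)
      (i := i) (by rw [map_sub, map_smul, hN, htv.2.2.1]; module) htop
    have hv0 : v = 0 := by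
      have := o.num_add_hole (Sum.inl t) v
      rw [num_apply, hole_apply, hv3, hv1.a t (by omega)] at this
      simpa using this.symm
    rw [hv0, map_zero] at hv2
    exact sub_eq_zero.mp hv2

/-! ### Contravariant forms on the Fock space -/

variable (o) in
/-- `B` is a contravariant bilinear form: bosonic creation and annihilation operators are adjoint to
each other, fermionic ones up to the factors `∓2i`. -/
structure IsForm (B : M →ₗ[ℂ] M →ₗ[ℂ] ℂ) : Prop where
  z : ∀ k x y, B (o.z k x) y = B x (o.d k y)
  d : ∀ k x y, B (o.d k x) y = B x (o.z k y)
  a : ∀ k x y, B (o.a k x) y = -(2 * I) * B x (o.da k y)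
  b : ∀ k x y, B (o.b k x) y = 2 * I * B x (o.db k y)
  da : ∀ k x y, B (o.da k x) y = I / 2 * B x (o.a k y)
  db : ∀ k x y, B (o.db k x) y = -(I / 2) * B x (o.b k y)

theorem IsForm.ht {B : M →ₗ[ℂ] M →ₗ[ℂ] ℂ} (hB : o.IsForm B) (x y : M) :
    B (o.ht x) y = B x (o.ht y) := by
  have : ∀ k, B (o.R k k x) y = B x (o.R k k y) := by
    intro k
    simp only [R_apply, map_sub, LinearMap.sub_apply, hB.z, hB.d, hB.a, hB.b, hB.da, hB.db]
    linear_combination (-B x (o.a k (o.da k y)) + B x (o.b k (o.db k y))) * I_sq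
  simp only [ht_apply, map_sum, LinearMap.sum_apply, map_smul, LinearMap.smul_apply, this]

theorem form_vec_ne_zero {B : M →ₗ[ℂ] M →ₗ[ℂ] ℂ} (hB : o.IsForm B) (hv : o.Vacuum Ω par)
    (h0 : B Ω Ω ≠ 0) {i : ℕ} (hi : i ≤ n) : B (o.vec Ω i) (o.vec Ω i) ≠ 0 := by
  induction i with
  | zero => exact h0
  | succ i ih =>
    rw [vec_succ (by omega), hB.a, o.dcc, if_pos rfl, (vac_vec hv (by omega)).da _ le_rfl,
      map_zero, sub_zero]
    exact mul_ne_zero (by simp) (ih (by omega))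

/-- A contravariant form that does not vanish on the vacuum does not vanish on the highest weight
vectors. -/
theorem form_hvec_ne_zero {B : M →ₗ[ℂ] M →ₗ[ℂ] ℂ} (hB : o.IsForm B)
    {t : Fin n} (ht : (t : ℕ) + 1 = n) (hv : o.Vacuum Ω par) (h0 : B Ω Ω ≠ 0) {s : Fin 2} {i : ℕ}
    (hi : i ≤ n) : B (o.hvec Ω t s i) (o.hvec Ω t s i) ≠ 0 := by
  rw [hvec]
  split_ifs
  · exact form_vec_ne_zero hB hv h0 hi
  · rw [hB.z, o.dz, if_pos rfl, (vac_vec hv hi).d, map_zero, zero_add]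
    exact form_vec_ne_zero hB hv h0 hi
  · have h := vac_pred ht hv
    have h1 := form_vec_ne_zero hB hv h0 (Nat.sub_le n 1)
    have : B (o.topVec Ω t) (o.topVec Ω t) =
        2 * I / 3 * B (o.vec Ω (n - 1)) (o.vec Ω (n - 1)) := by
      simp only [topVec, map_sub, map_smul, LinearMap.sub_apply, LinearMap.smul_apply, hB.z, hB.a,
        hB.b, o.dz, if_true, map_add, o.d_c, h.d, map_zero, zero_add, ← o.zdc, o.dcc, reduceCtorEq,
        if_false, h.da t le_rfl, h.db, sub_zero, smul_eq_mul]
      ring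
    rw [this]
    exact mul_ne_zero (by simp) h1

end Osc

end

section

/-! ### Invariant subspaces and eigenvectors -/

section Weights

variable {M : Type*} [AddCommGroup M] [Module ℂ M]

/-- An invariant subspace contains the eigenvector components of its elements. -/
theorem mem_of_sum_eigen {T : End ℂ M} {N : Submodule ℂ M} (hN : ∀ x ∈ N, T x ∈ N) {f : ℂ → M}
    (hf : ∀ μ, T (f μ) = μ • f μ) (s : Finset ℂ) (h : ∑ μ ∈ s, f μ ∈ N) :
    ∀ μ ∈ s, f μ ∈ N := by
  induction s using Finset.induction_on generalizing f with
  | empty => simp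
  | insert ν s hν ih =>
    rw [Finset.sum_insert hν] at h
    have h1 : ∀ μ ∈ s, f μ ∈ N := by
      intro μ hμ
      have hne : μ - ν ≠ 0 := sub_ne_zero.mpr fun h => hν (h ▸ hμ)
      refine (Submodule.smul_mem_iff _ hne).mp ?_
      refine ih (f := fun μ => (μ - ν) • f μ) (fun μ => ?_) ?_ μ hμ
      · rw [map_smul, hf, smul_comm]
      · have := sub_mem (hN _ h) (Submodule.smul_mem _ ν h)
        convert this using 1
        rw [map_add, map_sum, smul_add, Finset.smul_sum, hf, add_sub_add_left_eq_sub,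
          ← Finset.sum_sub_distrib]
        exact Finset.sum_congr rfl fun μ _ => by rw [hf, sub_smul]
    intro μ hμ
    rcases Finset.mem_insert.mp hμ with rfl | hμ
    · exact (Submodule.add_mem_iff_left _ (sum_mem h1)).mp h
    · exact h1 μ hμ

theorem le_iSup_inf_eigenspace {T : End ℂ M} {N : Submodule ℂ M} (hN : ∀ x ∈ N, T x ∈ N)
    (hle : N ≤ ⨆ μ, End.eigenspace T μ) : N ≤ ⨆ μ, N ⊓ End.eigenspace T μ := by
  intro x hx
  obtain ⟨f, hf, rfl⟩ := (Submodule.mem_iSup_iff_exists_finsupp _ _).mp (hle hx)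
  have := mem_of_sum_eigen hN (f := f) (fun μ => End.mem_eigenspace_iff.mp (hf μ)) f.support hx
  exact sum_mem fun μ hμ => Submodule.mem_iSup_of_mem μ ⟨this μ hμ, hf μ⟩

/-- A nonzero invariant subspace on which the eigenvalues of `T` are integers bounded above contains
an eigenvector for the largest of them. -/
theorem exists_top_eigenvector {T : End ℂ M} {N : Submodule ℂ M} (hN : ∀ x ∈ N, T x ∈ N)
    (hle : N ≤ ⨆ μ, End.eigenspace T μ) (h0 : N ≠ ⊥) {s : ℤ}
    (hs : ∀ x ∈ N, x ≠ 0 → ∀ μ : ℂ, T x = μ • x → ∃ t : ℤ, t ≤ s ∧ μ = t) :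
    ∃ w ∈ N, w ≠ 0 ∧ ∃ t : ℤ, T w = (t : ℂ) • w ∧
      ∀ t' : ℤ, t < t' → ∀ x ∈ N, T x = (t' : ℂ) • x → x = 0 := by
  have hex : ∃ t : ℤ, ∃ w ∈ N, w ≠ 0 ∧ T w = (t : ℂ) • w := by
    by_contra! hne
    refine h0 ((Submodule.eq_bot_iff _).mpr fun x hx => ?_)
    have hb : ⨆ μ, N ⊓ End.eigenspace T μ ≤ ⊥ := by
      refine iSup_le fun μ y hy => ?_
      by_contra hy0
      obtain ⟨t, -, rfl⟩ := hs y hy.1 hy0 μ (End.mem_eigenspace_iff.mp hy.2)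
      exact hne t y hy.1 hy0 (End.mem_eigenspace_iff.mp hy.2)
    exact (Submodule.mem_bot ℂ).mp (hb (le_iSup_inf_eigenspace hN hle hx))
  obtain ⟨t, ⟨w, hw, hw0, hwt⟩, hmax⟩ := Int.exists_greatest_of_bdd (P := fun t : ℤ =>
    ∃ w ∈ N, w ≠ 0 ∧ T w = (t : ℂ) • w) ⟨s, fun t ⟨w, hw, hw0, hwt⟩ => by
      obtain ⟨t', ht', he⟩ := hs w hw hw0 t hwt
      have : t = t' := by exact_mod_cast he
      omega⟩ hex
  refine ⟨w, hw, hw0, t, hwt, fun t' ht' x hx hxt => ?_⟩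
  by_contra hx0
  have := hmax t' ⟨x, hx, hx0, hxt⟩
  omega

/-- Let `K` be a module on which the operator `T` of the Cartan subalgebra acts with
finite-dimensional eigenspaces, let `B` be a contravariant form, and let `v` be a vector with
`B v v ≠ 0` that belongs to all nonzero submodules. Then `K` is irreducible: for a submodule `N`,
the submodules `N ∩ Nᗮ` and `K ∩ Nᗮ` do not contain `v`, hence vanish. -/
theorem eq_of_form {ι : Type*} {σ : ι → End ℂ M} {T : End ℂ M} {B : M →ₗ[ℂ] M →ₗ[ℂ] ℂ}
    {K N : Submodule ℂ M} {v : M}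
    (hσ : ∀ X, ∃ X', ∀ x y, B (σ X x) y = B x (σ X' y))
    (hT : ∀ x y, B (T x) y = B x (T y))
    (hle : K ≤ ⨆ μ, End.eigenspace T μ)
    (hfin : ∀ μ, Module.Finite ℂ ↥(K ⊓ End.eigenspace T μ))
    (hst : ∀ N : Submodule ℂ M, (∀ X, ∀ x ∈ N, σ X x ∈ N) → ∀ x ∈ N, T x ∈ N)
    (hK : ∀ X, ∀ x ∈ K, σ X x ∈ K)
    (hv : ∀ N ≤ K, (∀ X, ∀ x ∈ N, σ X x ∈ N) → N ≠ ⊥ → v ∈ N) (hvv : B v v ≠ 0)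
    (hNK : N ≤ K) (hN : ∀ X, ∀ x ∈ N, σ X x ∈ N) (hN0 : N ≠ ⊥) : N = K := by
  have hvN := hv N hNK hN hN0
  let O : Submodule ℂ M :=
    { carrier := {x | ∀ y ∈ N, B x y = 0}
      add_mem' := fun {a b} ha hb y hy => by rw [map_add, LinearMap.add_apply, ha y hy, hb y hy,
        add_zero]
      zero_mem' := fun y _ => by simp
      smul_mem' := fun c a ha y hy => by rw [map_smul, LinearMap.smul_apply, ha y hy, smul_zero] }
  have hO : ∀ X, ∀ x ∈ O, σ X x ∈ O := fun X x hx y hy => by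
    obtain ⟨X', h⟩ := hσ X
    rw [h]; exact hx _ (hN X' y hy)
  have hO0 : ∀ P : Submodule ℂ M, P ≤ K → P ≤ O → (∀ X, ∀ x ∈ P, σ X x ∈ P) → P = ⊥ := by
    intro P hPK hPO hP
    by_contra h
    exact hvv (hPO (hv P hPK hP h) v hvN)
  have hNO : N ⊓ O = ⊥ := hO0 _ (inf_le_left.trans hNK) inf_le_right
    fun X x hx => ⟨hN X x hx.1, hO X x hx.2⟩
  have hKO : K ⊓ O = ⊥ := hO0 _ inf_le_left inf_le_right
    fun X x hx => ⟨hK X x hx.1, hO X x hx.2⟩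
  have hNw : N ≤ ⨆ μ, N ⊓ End.eigenspace T μ :=
    le_iSup_inf_eigenspace (hst N hN) (hNK.trans hle)
  -- an eigenvector orthogonal to the eigenvectors in `N` for the same eigenvalue is orthogonal to `N`
  have horth : ∀ μ x, T x = μ • x → (∀ y ∈ N ⊓ End.eigenspace T μ, B x y = 0) → x ∈ O := by
    intro μ x hx h y hy
    have hy' := hNw hy
    clear hy
    induction hy' using Submodule.iSup_induction' with
    | mem ν y hy =>
      by_cases hμν : ν = μ
      · subst hμν; exact h y hy
      · have h1 := hT x y
        rw [hx, End.mem_eigenspace_iff.mp hy.2, map_smul, map_smul, LinearMap.smul_apply,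
          smul_eq_mul, smul_eq_mul, ← sub_eq_zero, ← sub_mul] at h1
        exact (mul_eq_zero.mp h1).resolve_left (sub_ne_zero.mpr (Ne.symm hμν))
    | zero => simp
    | add y z _ _ h1 h2 => rw [map_add, h1, h2, add_zero]
  refine le_antisymm hNK ((le_iSup_inf_eigenspace (hst K hK) hle).trans (iSup_le fun μ x hx => ?_))
  let Nμ := N ⊓ End.eigenspace T μ
  have hle' : Nμ ≤ K ⊓ End.eigenspace T μ := inf_le_inf_right _ hNK
  have := hfin μ
  have : Module.Finite ℂ Nμ := Submodule.finiteDimensional_of_le hle'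
  let f : M →ₗ[ℂ] Module.Dual ℂ Nμ := Nμ.subtype.dualMap ∘ₗ B
  have hinj : Function.Injective (f ∘ₗ Nμ.subtype) := by
    refine (injective_iff_map_eq_zero _).mpr fun y hy => ?_
    have hyO : (y : M) ∈ O := horth μ y (End.mem_eigenspace_iff.mp y.2.2) fun z hz =>
      LinearMap.congr_fun hy ⟨z, hz⟩
    have : (y : M) ∈ N ⊓ O := ⟨y.2.1, hyO⟩
    rw [hNO, Submodule.mem_bot] at this
    exact Subtype.ext this
  have hsurj : Function.Surjective (f ∘ₗ Nμ.subtype) :=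
    (LinearMap.injective_iff_surjective_of_finrank_eq_finrank Subspace.dual_finrank_eq.symm).mp hinj
  obtain ⟨y, hy⟩ := hsurj (f x)
  have hd : x - y ∈ K ⊓ O := by
    refine ⟨sub_mem hx.1 (hNK y.2.1), horth μ _ ?_ fun z hz => ?_⟩
    · rw [map_sub, End.mem_eigenspace_iff.mp hx.2, End.mem_eigenspace_iff.mp y.2.2, smul_sub]
    · have := LinearMap.congr_fun hy ⟨z, hz⟩
      rw [map_sub, LinearMap.sub_apply, sub_eq_zero]
      exact this.symm
  rw [hKO, Submodule.mem_bot, sub_eq_zero] at hd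
  rw [hd]
  exact y.2.1

/-- If an invariant subspace contains `t • e + w`, where `e` is an eigenvector for `c` and `w` is a sum
of eigenvectors for smaller eigenvalues, it contains `e`. -/
theorem mem_of_smul_add_mem {T : End ℂ M} {N : Submodule ℂ M} (hN : ∀ x ∈ N, T x ∈ N) {c t : ℂ}
    {e w : M} (he : T e = c • e) (hw : w ∈ ⨆ r : ℕ, End.eigenspace T (c - (r + 1 : ℕ))) (ht : t ≠ 0)
    (h : t • e + w ∈ N) : e ∈ N := by
  obtain ⟨f, hf, rfl⟩ := (Submodule.mem_iSup_iff_exists_finsupp _ _).mp hw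
  let g : ℂ → M := fun μ => (if μ = c then t • e else 0) +
    ∑ r ∈ f.support, if μ = c - (r + 1 : ℕ) then f r else 0
  let s : Finset ℂ := insert c (f.support.image fun r : ℕ => c - (r + 1 : ℕ))
  have hg : ∀ μ, T (g μ) = μ • g μ := by
    intro μ
    simp only [g, map_add, smul_add, map_sum, Finset.smul_sum]
    congr 1
    · split_ifs with h
      · rw [h, map_smul, he, smul_comm]
      · simp
    · refine Finset.sum_congr rfl fun r _ => ?_
      split_ifs with h
      · rw [h]; exact End.mem_eigenspace_iff.mp (hf r)
      · simp
  have hsum : ∑ μ ∈ s, g μ = t • e + f.sum fun _ x => x := by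
    simp only [g, Finset.sum_add_distrib]
    congr 1
    · rw [Finset.sum_ite_eq', if_pos (Finset.mem_insert_self _ _)]
    · rw [Finset.sum_comm]
      refine Finset.sum_congr rfl fun r hr => ?_
      rw [Finset.sum_ite_eq', if_pos]
      exact Finset.mem_insert_of_mem (Finset.mem_image_of_mem _ hr)
  have hgc := mem_of_sum_eigen hN hg s (by rw [hsum]; exact h) c (Finset.mem_insert_self _ _)
  have hgc' : g c = t • e := by
    simp only [g, if_true]
    rw [Finset.sum_eq_zero, add_zero]
    intro r _
    rw [if_neg]
    intro h
    have : ((r + 1 : ℕ) : ℂ) = 0 := by linear_combination h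
    exact absurd this (by exact_mod_cast Nat.succ_ne_zero r)
  rw [hgc'] at hgc
  exact (Submodule.smul_mem_iff _ ht).mp hgc

end Weights

/-! ### Verma modules and their irreducible quotients -/

section Verma

attribute [local instance] LieRing.ofAssociativeRing

variable {n : ℕ}

local notation "ιU" => UniversalEnvelopingAlgebra.ι ℂ

/-- A subspace of the enveloping algebra that contains `1` and is stable under the left
multiplication by Lie algebra elements is everything. -/
theorem eq_top_of_ι_mul_mem {D : Submodule ℂ (U n)} (h1 : 1 ∈ D)
    (h : ∀ X : G n, ∀ u ∈ D, ιU X * u ∈ D) : D = ⊤ := by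
  let A' : Subalgebra ℂ (U n) :=
    { carrier := {a | ∀ u ∈ D, a * u ∈ D}
      mul_mem' := fun {a b} ha hb u hu => by rw [mul_assoc]; exact ha _ (hb u hu)
      add_mem' := fun {a b} ha hb u hu => by rw [add_mul]; exact add_mem (ha u hu) (hb u hu)
      algebraMap_mem' := fun c u hu => by
        rw [← Algebra.smul_def]; exact Submodule.smul_mem _ c hu }
  let f : G n →ₗ⁅ℂ⁆ A' :=
    { toFun := fun X => ⟨ιU X, h X⟩
      map_add' := fun X Y => Subtype.ext (map_add _ X Y)
      map_smul' := fun c X => Subtype.ext (map_smul _ c X)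
      map_lie' := fun {X Y} => Subtype.ext (LieHom.map_lie _ X Y) }
  have hf : A'.val.comp (UniversalEnvelopingAlgebra.lift ℂ f) = AlgHom.id ℂ (U n) := by
    refine UniversalEnvelopingAlgebra.hom_ext (h := LieHom.ext fun X => ?_)
    change A'.val (UniversalEnvelopingAlgebra.lift ℂ f (ιU X)) = ιU X
    rw [UniversalEnvelopingAlgebra.lift_ι_apply]
    rfl
  refine (Submodule.eq_top_iff').mpr fun u => ?_
  have hu := DFunLike.congr_fun hf u
  have := (UniversalEnvelopingAlgebra.lift ℂ f u).2 1 h1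
  rw [mul_one] at this
  change A'.val (UniversalEnvelopingAlgebra.lift ℂ f u) = u at hu
  rw [← hu]
  exact this

/-- The vectors of negative height with respect to `hh`. -/
def NegHt (hh : G n) : Set (G n) := {Y | ∃ r : ℕ, r ≠ 0 ∧ ⁅hh, Y⁆ = -(r : ℂ) • Y}

/-- The positive root vectors. -/
def PosVec (n : ℕ) : Set (G n) := {X | ∃ μ ∈ PosRoots n, HasRoot X μ}

/-- The action of a Lie algebra element on the Verma module. -/
def vermaAct (lam : Fin n → ℂ) (X : G n) : End ℂ (U n ⧸ vermaIdeal lam) :=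
  Algebra.lsmul ℂ ℂ (U n ⧸ vermaIdeal lam) (ιU X)

/-- The map `U → U / vermaIdeal lam`. -/
def vermaMk (lam : Fin n → ℂ) : U n →ₗ[ℂ] U n ⧸ vermaIdeal lam :=
  (vermaIdeal lam).mkQ.restrictScalars ℂ

theorem vermaMk_eq_zero {lam : Fin n → ℂ} {u : U n} : vermaMk lam u = 0 ↔ u ∈ vermaIdeal lam :=
  Submodule.Quotient.mk_eq_zero _

theorem vermaAct_mk (lam : Fin n → ℂ) (X : G n) (u : U n) :
    vermaAct lam X (vermaMk lam u) = vermaMk lam (ιU X * u) := rfl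

theorem ι_mul_ι (X Y : G n) : ιU X * ιU Y = ιU Y * ιU X + ιU ⁅X, Y⁆ := by
  rw [LieHom.map_lie, LieRing.of_associative_ring_bracket]; abel

theorem vermaAct_vermaAct (lam : Fin n → ℂ) (X Y : G n) (x : U n ⧸ vermaIdeal lam) :
    vermaAct lam X (vermaAct lam Y x) = vermaAct lam Y (vermaAct lam X x) + vermaAct lam ⁅X, Y⁆ x := by
  obtain ⟨u, rfl⟩ := Submodule.Quotient.mk_surjective _ x
  change vermaMk lam (ιU X * (ιU Y * u)) = vermaMk lam (ιU Y * (ιU X * u)) +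
    vermaMk lam (ιU ⁅X, Y⁆ * u)
  rw [← map_add, ← mul_assoc, ← mul_assoc, ← add_mul, ι_mul_ι]

/-- The highest weight vector of the Verma module is an eigenvector of the Cartan subalgebra. -/
theorem exists_vermaAct_eq_smul (lam : Fin n → ℂ) {X : G n}
    (hX : X ∈ Submodule.span ℂ (Set.range (H (n := n)))) :
    ∃ c : ℂ, vermaAct lam X (vermaMk lam 1) = c • vermaMk lam 1 := by
  simp only [vermaAct_mk, mul_one]
  induction hX using Submodule.span_induction with
  | mem X hX =>
    obtain ⟨k, rfl⟩ := hX
    refine ⟨lam k, ?_⟩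
    rw [← sub_eq_zero, ← map_smul, ← map_sub, vermaMk_eq_zero]
    refine Submodule.subset_span (Or.inr ⟨k, ?_⟩)
    rw [Algebra.algebraMap_eq_smul_one]
  | zero => exact ⟨0, by simp⟩
  | add X Y _ _ h1 h2 =>
    obtain ⟨c, hc⟩ := h1
    obtain ⟨d, hd⟩ := h2
    exact ⟨c + d, by rw [map_add, map_add, hc, hd, add_smul]⟩
  | smul t X _ h1 =>
    obtain ⟨c, hc⟩ := h1
    exact ⟨t * c, by rw [map_smul, map_smul, hc, mul_smul]⟩

/-- The Verma module is generated from its highest weight vector by vectors of negative height. -/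
theorem verma_induction (lam : Fin n → ℂ) {hh : G n}
    (hspan : ⊤ ≤ Submodule.span ℂ (NegHt hh ∪ (Set.range H ∪ PosVec n)))
    {D : Submodule ℂ (U n ⧸ vermaIdeal lam)} (h1 : vermaMk lam 1 ∈ D)
    (hY : ∀ Y ∈ NegHt hh, ∀ x ∈ D, vermaAct lam Y x ∈ D) (u : U n) : vermaMk lam u ∈ D := by
  let D₀ : Submodule ℂ (U n ⧸ vermaIdeal lam) := sInf {D | vermaMk lam 1 ∈ D ∧
    ∀ Y ∈ NegHt hh, ∀ x ∈ D, vermaAct lam Y x ∈ D}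
  have hD1 : vermaMk lam 1 ∈ D₀ := Submodule.mem_sInf.mpr fun D h => h.1
  have hDY : ∀ Y ∈ NegHt hh, ∀ x ∈ D₀, vermaAct lam Y x ∈ D₀ := fun Y hY u hu =>
    Submodule.mem_sInf.mpr fun D h => h.2 Y hY u (Submodule.mem_sInf.mp hu D h)
  let D' : Submodule ℂ (U n ⧸ vermaIdeal lam) :=
    { carrier := {x | x ∈ D₀ ∧ ∀ X : G n, vermaAct lam X x ∈ D₀}
      add_mem' := fun {a b} ha hb =>
        ⟨add_mem ha.1 hb.1, fun X => by rw [map_add]; exact add_mem (ha.2 X) (hb.2 X)⟩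
      zero_mem' := ⟨zero_mem _, fun X => by simp⟩
      smul_mem' := fun t a ha => ⟨Submodule.smul_mem _ t ha.1, fun X => by
        rw [map_smul]; exact Submodule.smul_mem _ t (ha.2 X)⟩ }
  have hD' : D₀ ≤ D' := by
    refine sInf_le ⟨⟨hD1, fun X => ?_⟩, fun Y hY x hx => ⟨hDY Y hY x hx.1, fun X => ?_⟩⟩
    · rw [vermaAct_mk, mul_one]
      have hX := hspan (Submodule.mem_top (x := X))
      induction hX using Submodule.span_induction with
      | mem X hX =>
        rcases hX with hX | hX | hX
        · have := hDY X hX _ hD1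
          rwa [vermaAct_mk, mul_one] at this
        · obtain ⟨d, hd⟩ := exists_vermaAct_eq_smul lam (Submodule.subset_span hX)
          rw [vermaAct_mk, mul_one] at hd
          rw [hd]
          exact Submodule.smul_mem _ _ hD1
        · rw [vermaMk_eq_zero.mpr (Submodule.subset_span (Or.inl ⟨X, hX, rfl⟩))]
          exact zero_mem _
      | zero => simp
      | add X Y _ _ h1 h2 => rw [map_add, map_add]; exact add_mem h1 h2
      | smul t X _ h1 => rw [map_smul, map_smul]; exact Submodule.smul_mem _ _ h1
    · rw [vermaAct_vermaAct]
      exact add_mem (hDY Y hY _ (hx.2 X)) (hx.2 _)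
  have htop := eq_top_of_ι_mul_mem (D := D₀.comap (vermaMk lam)) hD1 fun X u hu => by
    rw [Submodule.mem_comap, ← vermaAct_mk]
    exact (hD' hu).2 X
  have hu : u ∈ D₀.comap (vermaMk lam) := htop ▸ Submodule.mem_top
  exact Submodule.mem_sInf.mp (Submodule.mem_comap.mp hu) D ⟨h1, hY⟩

/-- Every vector of the Verma module is the sum of a multiple of the highest weight vector and of
eigenvectors of `hh` for strictly smaller eigenvalues. -/
theorem vermaMk_mem_sup (lam : Fin n → ℂ) {hh : G n}
    (hspan : ⊤ ≤ Submodule.span ℂ (NegHt hh ∪ (Set.range H ∪ PosVec n))) {c : ℂ}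
    (hc : vermaAct lam hh (vermaMk lam 1) = c • vermaMk lam 1) (u : U n) :
    vermaMk lam u ∈ Submodule.span ℂ {vermaMk lam 1} ⊔
      ⨆ r : ℕ, End.eigenspace (vermaAct lam hh) (c - (r + 1 : ℕ)) := by
  refine verma_induction lam hspan (Submodule.mem_sup_left (Submodule.mem_span_singleton_self _))
    ?_ u
  rintro Y ⟨r, hr, hY⟩ x hx
  obtain ⟨s, rfl⟩ := Nat.exists_eq_succ_of_ne_zero hr
  have hTy : ∀ x, vermaAct lam hh (vermaAct lam Y x) =
      vermaAct lam Y (vermaAct lam hh x) - ((s + 1 : ℕ) : ℂ) • vermaAct lam Y x := by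
    intro x
    rw [vermaAct_vermaAct, hY, sub_eq_add_neg, ← neg_smul]
    congr 1
    simp only [vermaAct, map_smul]
    rfl
  have hmap : ∀ (μ : ℂ) x, vermaAct lam hh x = μ • x →
      vermaAct lam hh (vermaAct lam Y x) = (μ - (s + 1 : ℕ)) • vermaAct lam Y x :=
    fun μ x hx => by rw [hTy, hx, map_smul, sub_smul]
  obtain ⟨y, hy, w, hw, rfl⟩ := Submodule.mem_sup.mp hx
  obtain ⟨t, rfl⟩ := Submodule.mem_span_singleton.mp hy
  rw [map_add, map_smul]
  refine Submodule.mem_sup_right (add_mem (Submodule.smul_mem _ _ ?_) ?_)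
  · exact Submodule.mem_iSup_of_mem s (End.mem_eigenspace_iff.mpr (hmap c _ hc))
  · clear hx
    induction hw using Submodule.iSup_induction' with
    | mem m x hx =>
      refine Submodule.mem_iSup_of_mem (m + (s + 1)) (End.mem_eigenspace_iff.mpr ?_)
      rw [hmap _ x (End.mem_eigenspace_iff.mp hx)]
      congr 1
      push_cast; ring
    | zero => simp
    | add x y _ _ h1 h2 => rw [map_add]; exact add_mem h1 h2

/-- If `hh` is in the Cartan subalgebra and `sp(2n)` is spanned by vectors of negative height, the
Cartan subalgebra and positive root vectors, then every proper submodule of the Verma module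
is contained in the sum of the weight spaces other than the highest one; so the sum of all
proper submodules is proper. -/
theorem one_notMem_maxIdeal {lam : Fin n → ℂ} {hh : G n}
    (hspan : ⊤ ≤ Submodule.span ℂ (NegHt hh ∪ (Set.range H ∪ PosVec n)))
    (hmem : hh ∈ Submodule.span ℂ (Set.range (H (n := n))))
    (h1 : (1 : U n) ∉ vermaIdeal lam) : (1 : U n) ∉ maxIdeal lam := by
  obtain ⟨c, hc⟩ := exists_vermaAct_eq_smul lam hmem
  have hR : ∀ N : Submodule (U n) (U n), vermaIdeal lam ≤ N → N ≠ ⊤ → ∀ u ∈ N,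
      vermaMk lam u ∈ ⨆ r : ℕ, End.eigenspace (vermaAct lam hh) (c - (r + 1 : ℕ)) := by
    intro N hIN hN u hu
    obtain ⟨y, hy, w, hw, hyw⟩ := Submodule.mem_sup.mp (vermaMk_mem_sup lam hspan hc u)
    obtain ⟨t, rfl⟩ := Submodule.mem_span_singleton.mp hy
    by_cases ht : t = 0
    · rw [← hyw, ht, zero_smul, zero_add]; exact hw
    exfalso
    refine hN ((Submodule.eq_top_iff').mpr fun a => ?_)
    have hN' : ∀ x ∈ (N.restrictScalars ℂ).map (vermaMk lam),
        vermaAct lam hh x ∈ (N.restrictScalars ℂ).map (vermaMk lam) := by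
      rintro _ ⟨x, hx, rfl⟩
      exact ⟨ιU hh * x, N.smul_mem (ιU hh) hx, rfl⟩
    obtain ⟨u', hu', hq'⟩ := mem_of_smul_add_mem hN' hc hw ht (by rw [hyw]; exact ⟨u, hu, rfl⟩)
    have h1N : (1 : U n) ∈ N := by
      have h2 : u' - 1 ∈ vermaIdeal lam := vermaMk_eq_zero.mp (by rw [map_sub, hq', sub_self])
      have h3 := N.sub_mem hu' (hIN h2)
      rwa [sub_sub_cancel] at h3
    have h4 := N.smul_mem a h1N
    rwa [smul_eq_mul, mul_one] at h4
  intro hmax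
  refine h1 (vermaMk_eq_zero.mp ?_)
  by_contra h0
  rw [maxIdeal, sSup_eq_iSup'] at hmax
  have hx : ∀ u ∈ ⨆ N : {N : Submodule (U n) (U n) // vermaIdeal lam ≤ N ∧ N ≠ ⊤}, N.1,
      vermaMk lam u ∈ ⨆ r : ℕ, End.eigenspace (vermaAct lam hh) (c - (r + 1 : ℕ)) := by
    intro u hu
    induction hu using Submodule.iSup_induction' with
    | mem N x hx => exact hR N.1 N.2.1 N.2.2 x hx
    | zero => rw [map_zero]; exact zero_mem _
    | add x y _ _ h1 h2 => rw [map_add]; exact add_mem h1 h2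
  obtain ⟨r, hr⟩ := exists_eq_of_mem_iSup_eigenspace _ _ (hx _ hmax) h0 hc
  have : ((r + 1 : ℕ) : ℂ) = 0 := by linear_combination hr
  exact absurd this (by exact_mod_cast Nat.succ_ne_zero r)

/-- An irreducible module with a highest weight vector of weight `lam` is isomorphic to
`L(lam)`. -/
theorem exists_equiv_L {lam : Fin n → ℂ} {hh : G n}
    (hspan : ⊤ ≤ Submodule.span ℂ (NegHt hh ∪ (Set.range H ∪ PosVec n)))
    (hmem : hh ∈ Submodule.span ℂ (Set.range (H (n := n))))
    {M : Type*} [AddCommGroup M] [Module ℂ M] (σ : G n →ₗ⁅ℂ⁆ End ℂ M) {K : Submodule ℂ M} {v : M}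
    (hvK : v ∈ K) (hv0 : v ≠ 0) (hpos : ∀ X ∈ PosVec n, σ X v = 0)
    (hwt : ∀ k, σ (H k) v = lam k • v)
    (hK : ∀ X, ∀ x ∈ K, σ X x ∈ K)
    (hirr : ∀ N ≤ K, (∀ X, ∀ x ∈ N, σ X x ∈ N) → N ≠ ⊥ → N = K) :
    ∃ φ : L lam ≃ₗ[ℂ] K, ∀ (X : G n) (m : L lam), (φ (actL lam X m) : M) = σ X (φ m) := by
  let ϕ : U n →ₐ[ℂ] End ℂ M := UniversalEnvelopingAlgebra.lift ℂ σ
  have hϕ : ∀ X, ϕ (ιU X) = σ X := fun X => UniversalEnvelopingAlgebra.lift_ι_apply ℂ σ X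
  let ev : U n →ₗ[ℂ] M := LinearMap.applyₗ v ∘ₗ ϕ.toLinearMap
  have hev : ∀ u, ev u = ϕ u v := fun u => rfl
  have hevX : ∀ X u, ev (ιU X * u) = σ X (ev u) := fun X u => by
    rw [hev, map_mul, hϕ]; rfl
  let Ker : Submodule (U n) (U n) :=
    { carrier := {u | ϕ u v = 0}
      add_mem' := fun {a b} ha hb => by
        simp only [Set.mem_ofPred_eq] at *; rw [map_add, LinearMap.add_apply, ha, hb, add_zero]
      zero_mem' := by simp
      smul_mem' := fun c a ha => by
        simp only [Set.mem_ofPred_eq, smul_eq_mul] at *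
        rw [map_mul, End.mul_apply, ha, map_zero] }
  have hKer : ∀ u, u ∈ Ker ↔ ev u = 0 := fun u => Iff.rfl
  have hverma : vermaIdeal lam ≤ Ker := by
    refine Submodule.span_le.mpr ?_
    rintro _ (⟨X, hX, rfl⟩ | ⟨k, rfl⟩)
    · change ϕ (ιU X) v = 0
      rw [hϕ]; exact hpos X hX
    · change ϕ _ v = 0
      rw [map_sub, hϕ, AlgHom.commutes, LinearMap.sub_apply, hwt, Module.algebraMap_end_apply,
        sub_self]
  have h1 : (1 : U n) ∉ Ker := by
    rw [hKer, hev, map_one]; exact hv0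
  have hmax := one_notMem_maxIdeal hspan hmem fun h => h1 (hverma h)
  have hle : Ker ≤ maxIdeal lam :=
    le_sSup ⟨hverma, fun h => h1 (h ▸ Submodule.mem_top)⟩
  have hevK : ∀ u, ev u ∈ K := by
    have := eq_top_of_ι_mul_mem (D := K.comap ev) (by
      rw [Submodule.mem_comap, hev, map_one]; exact hvK) fun X u hu => by
        rw [Submodule.mem_comap, hevX]; exact hK X _ hu
    exact fun u => Submodule.mem_comap.mp (this ▸ Submodule.mem_top)
  have himg : ∀ N : Submodule (U n) (U n), (N.restrictScalars ℂ).map ev ≠ ⊥ →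
      (N.restrictScalars ℂ).map ev = K := by
    intro N hN
    refine hirr _ ?_ ?_ hN
    · rintro _ ⟨u, -, rfl⟩; exact hevK u
    · rintro X _ ⟨u, hu, rfl⟩
      exact ⟨ιU X * u, N.smul_mem _ hu, hevX X u⟩
  have hge : maxIdeal lam ≤ Ker := by
    intro u hu
    by_contra hne
    have hb : ((maxIdeal lam).restrictScalars ℂ).map ev ≠ ⊥ := fun h => hne <| by
      rw [hKer]
      exact (Submodule.mem_bot ℂ).mp (h ▸ Submodule.mem_map_of_mem (f := ev) hu)
    obtain ⟨w, hw, hwv⟩ : v ∈ ((maxIdeal lam).restrictScalars ℂ).map ev := by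
      rw [himg _ hb]; exact hvK
    have : w - 1 ∈ Ker := by
      rw [hKer, map_sub, hwv, hev, map_one]; exact sub_self v
    have := (maxIdeal lam).sub_mem hw (hle this)
    rw [sub_sub_cancel] at this
    exact hmax this
  have heq : Ker = maxIdeal lam := le_antisymm hle hge
  have hsurj : ∀ x ∈ K, ∃ u, ev u = x := by
    have hb : ((⊤ : Submodule (U n) (U n)).restrictScalars ℂ).map ev ≠ ⊥ := fun h => hv0 <| by
      have : ev 1 ∈ ((⊤ : Submodule (U n) (U n)).restrictScalars ℂ).map ev :=
        Submodule.mem_map_of_mem trivial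
      rw [h, Submodule.mem_bot, hev, map_one] at this
      exact this
    intro x hx
    rw [← himg _ hb] at hx
    obtain ⟨u, -, hu⟩ := hx
    exact ⟨u, hu⟩
  let evK : U n →ₗ[ℂ] K := ev.codRestrict K hevK
  have hkerK : LinearMap.ker evK = (maxIdeal lam).restrictScalars ℂ := by
    ext u
    rw [LinearMap.mem_ker, Submodule.restrictScalars_mem, ← heq, hKer]
    exact Subtype.ext_iff
  have hsurjK : Function.Surjective evK := fun x => by
    obtain ⟨u, hu⟩ := hsurj x x.2
    exact ⟨u, Subtype.ext hu⟩
  let e1 : L lam ≃ₗ[ℂ] (U n ⧸ (maxIdeal lam).restrictScalars ℂ) :=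
    (Submodule.Quotient.restrictScalarsEquiv ℂ (maxIdeal lam)).symm
  let e2 : (U n ⧸ (maxIdeal lam).restrictScalars ℂ) ≃ₗ[ℂ] (U n ⧸ LinearMap.ker evK) :=
    Submodule.quotEquivOfEq _ _ hkerK.symm
  let φ := (e1.trans e2).trans (evK.quotKerEquivOfSurjective hsurjK)
  have hφ : ∀ u : U n, φ (Submodule.Quotient.mk u) = evK u := fun u => rfl
  refine ⟨φ, fun X m => ?_⟩
  obtain ⟨u, rfl⟩ := Submodule.Quotient.mk_surjective _ m
  have : actL lam X (Submodule.Quotient.mk u) = Submodule.Quotient.mk (ιU X * u) := rfl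
  rw [this, hφ, hφ]
  exact hevX X u

end Verma

end

section

variable {n : ℕ}

/-! ### The symplectic Lie algebra -/

/-- The covector `ω(v, ·)`, as a coordinate function. -/
def flatV (v : V n) : V n := Sum.elim (fun k => -v (Sum.inr k)) (fun k => v (Sum.inl k))

theorem flatV_dotProduct (v w : V n) : flatV v ⬝ᵥ w = omega n v w := by
  simp only [dotProduct, Fintype.sum_sum_type, flatV, omega, Sum.elim_inl, Sum.elim_inr,
    Finset.sum_sub_distrib, neg_mul, Finset.sum_neg_distrib]
  ring

theorem omega_swap (v w : V n) : omega n v w = -omega n w v := by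
  simp only [omega, ← Finset.sum_neg_distrib]
  exact Finset.sum_congr rfl fun k _ => by ring

theorem J_mulVec (v : V n) : (Matrix.J (Fin n) ℂ).mulVec v = flatV v := by
  ext a
  rcases a with k | k <;>
    simp [Matrix.J, Matrix.fromBlocks_mulVec, flatV, Matrix.neg_mulVec]

theorem vecMul_J (v : V n) : Matrix.vecMul v (Matrix.J (Fin n) ℂ) = -flatV v := by
  ext a
  rcases a with k | k <;>
    simp [Matrix.J, Matrix.vecMul_fromBlocks, flatV, Matrix.vecMul_neg]

theorem tMat_mem (u v : V n) : Matrix.vecMulVec u (flatV v) + Matrix.vecMulVec v (flatV u) ∈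
    LieAlgebra.Symplectic.sp (Fin n) ℂ := by
  rw [LieAlgebra.Symplectic.sp, mem_skewAdjointMatricesLieSubalgebra,
    mem_skewAdjointMatricesSubmodule, Matrix.IsSkewAdjoint, Matrix.IsAdjointPair]
  simp only [Matrix.transpose_add, Matrix.transpose_vecMulVec, Matrix.add_mul, Matrix.vecMulVec_mul,
    vecMul_J, Matrix.mul_neg, Matrix.mul_add, Matrix.mul_vecMulVec, J_mulVec, Matrix.vecMulVec_neg]
  abel

theorem flatV_add (u v : V n) : flatV (u + v) = flatV u + flatV v := by
  ext a; rcases a with k | k <;> simp [flatV]; ring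

theorem flatV_smul (c : ℂ) (v : V n) : flatV (c • v) = c • flatV v := by
  ext a; rcases a with k | k <;> simp [flatV]

/-- The element `w ↦ ω(v, w) u + ω(u, w) v` of the symplectic Lie algebra. -/
def T : V n →ₗ[ℂ] V n →ₗ[ℂ] G n :=
  LinearMap.mk₂ ℂ (fun u v => ⟨_, tMat_mem u v⟩)
    (fun u u' v => Subtype.ext <| by
      simp only [flatV_add, Matrix.add_vecMulVec, Matrix.vecMulVec_add]; exact add_add_add_comm _ _ _ _)
    (fun c u v => Subtype.ext <| by
      simp only [flatV_smul, Matrix.smul_vecMulVec, Matrix.vecMulVec_smul]; exact (smul_add _ _ _).symm)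
    (fun u v v' => Subtype.ext <| by
      simp only [flatV_add, Matrix.add_vecMulVec, Matrix.vecMulVec_add]; exact add_add_add_comm _ _ _ _)
    (fun c u v => Subtype.ext <| by
      simp only [flatV_smul, Matrix.smul_vecMulVec, Matrix.vecMulVec_smul]; exact (smul_add _ _ _).symm)

theorem toMat_T (u v : V n) :
    toMat n (T u v) = Matrix.vecMulVec u (flatV v) + Matrix.vecMulVec v (flatV u) := rfl

/-- The action of the symplectic Lie algebra on `V`. -/
def actV : G n →ₗ[ℂ] End ℂ (V n) := Matrix.toLin'.toLinearMap ∘ₗ toMat n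

theorem actV_apply (X : G n) (w : V n) : actV X w = (toMat n X).mulVec w := rfl

theorem actV_injective : Function.Injective (actV (n := n)) := fun _ _ h =>
  Subtype.ext (Matrix.toLin'.injective h)

theorem actV_lie (X Y : G n) (w : V n) :
    actV ⁅X, Y⁆ w = actV X (actV Y w) - actV Y (actV X w) := by
  have : toMat n ⁅X, Y⁆ = toMat n X * toMat n Y - toMat n Y * toMat n X := rfl
  simp only [actV_apply, this, Matrix.sub_mulVec, Matrix.mulVec_mulVec]

theorem actV_T (u v w : V n) : actV (T u v) w = omega n v w • u + omega n u w • v := by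
  rw [actV_apply, toMat_T, Matrix.add_mulVec, Matrix.vecMulVec_mulVec, Matrix.vecMulVec_mulVec,
    flatV_dotProduct, flatV_dotProduct]
  ext a
  simp [mul_comm]

theorem omega_add_left (u u' v : V n) : omega n (u + u') v = omega n u v + omega n u' v := by
  simp only [← flatV_dotProduct, flatV_add, add_dotProduct]

theorem omega_smul_left (c : ℂ) (u v : V n) : omega n (c • u) v = c * omega n u v := by
  simp only [← flatV_dotProduct, flatV_smul, smul_dotProduct, smul_eq_mul]

theorem omega_add_right (u v v' : V n) : omega n u (v + v') = omega n u v + omega n u v' := by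
  simp only [← flatV_dotProduct, dotProduct_add]

theorem omega_smul_right (c : ℂ) (u v : V n) : omega n u (c • v) = c * omega n u v := by
  simp only [← flatV_dotProduct, dotProduct_smul, smul_eq_mul]

theorem omega_actV (X : G n) (u v : V n) : omega n (actV X u) v = -omega n u (actV X v) := by
  have hX := (mem_skewAdjointMatricesSubmodule _ _).mp
    ((mem_skewAdjointMatricesLieSubalgebra _ _).mp X.2)
  rw [Matrix.IsSkewAdjoint, Matrix.IsAdjointPair] at hX
  have h : ∀ u v : V n, omega n u v = -(u ⬝ᵥ (Matrix.J (Fin n) ℂ).mulVec v) := fun u v => by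
    rw [Matrix.dotProduct_mulVec, vecMul_J, neg_dotProduct, neg_neg, flatV_dotProduct]
  have h2 : (toMat n X).transpose * Matrix.J (Fin n) ℂ = Matrix.J (Fin n) ℂ * -toMat n X := hX
  rw [h, h, actV_apply, actV_apply, ← Matrix.vecMul_transpose, ← Matrix.dotProduct_mulVec,
    Matrix.mulVec_mulVec, h2, ← Matrix.mulVec_mulVec, Matrix.neg_mulVec, Matrix.mulVec_neg,
    dotProduct_neg]

theorem T_swap (u v : V n) : T u v = T v u :=
  actV_injective <| LinearMap.ext fun w => by rw [actV_T, actV_T, add_comm]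

theorem lie_T (X : G n) (u v : V n) : ⁅X, T u v⁆ = T (actV X u) v + T u (actV X v) := by
  refine actV_injective <| LinearMap.ext fun w => ?_
  rw [actV_lie, map_add, LinearMap.add_apply, actV_T, actV_T, actV_T, actV_T, omega_actV,
    omega_actV]
  simp only [map_add, map_smul]
  module

/-- The vector `A_k = (q_k + i p_k) / 2`. -/
def vA (k : Fin n) : V n := (2⁻¹ : ℂ) • (Pi.single (Sum.inl k) 1 + I • Pi.single (Sum.inr k) 1)
/-- The vector `B_k = (q_k - i p_k) / 2`. -/
def vB (k : Fin n) : V n := (2⁻¹ : ℂ) • (Pi.single (Sum.inl k) 1 - I • Pi.single (Sum.inr k) 1)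

theorem single_inl (k : Fin n) : (Pi.single (Sum.inl k) 1 : V n) = vA k + vB k := by
  rw [vA, vB]; module

theorem single_inr (k : Fin n) :
    (Pi.single (Sum.inr k) 1 : V n) = (-I) • vA k + I • vB k := by
  have h : (Pi.single (Sum.inr k) 1 : V n) = (-(I * I)) • Pi.single (Sum.inr k) 1 := by
    rw [I_mul_I, neg_neg, one_smul]
  rw [h, vA, vB]; module

theorem eq_sum (w : V n) : w = ∑ k, ((w (Sum.inl k) - I * w (Sum.inr k)) • vA k +
    (w (Sum.inl k) + I * w (Sum.inr k)) • vB k) := by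
  conv_lhs => rw [pi_eq_sum_univ' w, Fintype.sum_sum_type, ← Finset.sum_add_distrib]
  refine Finset.sum_congr rfl fun k _ => ?_
  rw [single_inl, single_inr]; module

theorem omega_single_inl (k : Fin n) (w : V n) : omega n (Pi.single (Sum.inl k) 1) w = w (Sum.inr k) := by
  simp [omega, Pi.single_apply]

theorem omega_single_inr (k : Fin n) (w : V n) :
    omega n (Pi.single (Sum.inr k) 1) w = -w (Sum.inl k) := by
  simp [omega, Pi.single_apply]

theorem omega_vA (k : Fin n) (w : V n) :
    omega n (vA k) w = -(I / 2) * (w (Sum.inl k) + I * w (Sum.inr k)) := by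
  rw [vA, omega_smul_left, omega_add_left, omega_smul_left, omega_single_inl, omega_single_inr]
  linear_combination (w (Sum.inr k) / 2) * I_sq

theorem omega_vB (k : Fin n) (w : V n) :
    omega n (vB k) w = I / 2 * (w (Sum.inl k) - I * w (Sum.inr k)) := by
  rw [vB, sub_eq_add_neg, ← neg_smul, omega_smul_left, omega_add_left, omega_smul_left, omega_single_inl, omega_single_inr]
  linear_combination (w (Sum.inr k) / 2) * I_sq

/-- The expansion of a vector in the basis `A_k, B_k`, with coefficients given by the symplectic form. -/
theorem sum_omega_smul (w : V n) :
    ∑ k, (omega n (vB k) w • vA k - omega n (vA k) w • vB k) = (I / 2) • w := by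
  conv_rhs => rw [eq_sum w, Finset.smul_sum]
  refine Finset.sum_congr rfl fun k _ => ?_
  rw [omega_vA, omega_vB]
  module

/-- Every `X` is `(1/2) ∑ T(X e_a, e^a)`, for a basis `e_a` with symplectic dual basis `e^a`. -/
theorem eq_sum_T (X : G n) :
    X = (-I) • ∑ k, (T (actV X (vA k)) (vB k) - T (actV X (vB k)) (vA k)) := by
  refine actV_injective <| LinearMap.ext fun w => ?_
  have h1 := congrArg (actV X) (sum_omega_smul w)
  have h2 := sum_omega_smul (actV X w)
  simp only [map_sum, map_sub, map_smul] at h1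
  have h3 : ∑ k, (actV (T (actV X (vA k)) (vB k)) w - actV (T (actV X (vB k)) (vA k)) w) =
      I • actV X w := by
    have : I • actV X w = (I / 2) • actV X w + (I / 2) • actV X w := by module
    rw [this]
    nth_rewrite 1 [← h1]
    rw [← h2, ← Finset.sum_add_distrib]
    refine Finset.sum_congr rfl fun k _ => ?_
    simp only [actV_T, omega_actV]
    module
  simp only [map_smul, map_sum, map_sub, LinearMap.smul_apply, LinearMap.sum_apply,
    LinearMap.sub_apply, h3, smul_smul, neg_mul, I_mul_I, neg_neg, one_smul]

/-- A subspace that contains all `T u v` is everything. -/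
theorem mem_of_T_mem {p : Submodule ℂ (G n)} (h : ∀ u v, T u v ∈ p) (X : G n) : X ∈ p := by
  rw [eq_sum_T X]
  exact p.smul_mem _ (p.sum_mem fun k _ => p.sub_mem (h _ _) (h _ _))

theorem H_eq (k : Fin n) : H k = (2 * I) • T (vB k) (vA k) := by
  refine actV_injective <| LinearMap.ext fun w => ?_
  rw [map_smul, LinearMap.smul_apply, actV_T, omega_vA, omega_vB]
  have h : actV (H k) w = (I * w (Sum.inr k)) • Pi.single (Sum.inl k) 1 -
      (I * w (Sum.inl k)) • Pi.single (Sum.inr k) 1 := by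
    ext a
    rcases a with a | a
    all_goals simp [actV_apply, toMat, H, cartanMatrix, Matrix.fromBlocks_mulVec, Matrix.single_mulVec,
        Pi.single_apply, Function.update_apply, eq_comm]
    split_ifs <;> simp
  rw [h, single_inl, single_inr]
  match_scalars
  · linear_combination (I * w (Sum.inr k)) * I_sq
  · linear_combination (I * w (Sum.inr k)) * I_sq

end

section

variable {n : ℕ}

/-! ### The symplectic spinor representation -/

theorem derX_apply (k : Fin n) (s : S n) (x : EuclideanSpace ℝ (Fin n)) :
    derX k s x = fderiv ℝ s x (EuclideanSpace.single k 1) := rfl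

theorem mulX_comm (k l : Fin n) (s : S n) : mulX k (mulX l s) = mulX l (mulX k s) := by
  ext x; simp only [mulX_apply]; ring

theorem derX_comm (k l : Fin n) (s : S n) : derX k (derX l s) = derX l (derX k s) := by
  ext x
  have h (i j : Fin n) : derX i (derX j s) x =
      fderiv ℝ (fderiv ℝ s) x (EuclideanSpace.single i 1) (EuclideanSpace.single j 1) := by
    have hd : DifferentiableAt ℝ (fderiv ℝ s) x :=
      ((s.smooth 2).fderiv_right (m := 1) (by norm_num)).differentiable (by norm_num) x
    have : ⇑(derX j s) = fun y => fderiv ℝ s y (EuclideanSpace.single j 1) := rfl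
    rw [derX_apply, this, fderiv_clm_apply hd (by fun_prop)]
    simp
  rw [h, h]
  exact ((s.smooth 2).contDiffAt.isSymmSndFDerivAt (by simp)).eq _ _

theorem derX_mulX (k l : Fin n) (s : S n) :
    derX k (mulX l s) = mulX l (derX k s) + if k = l then s else 0 := by
  ext x
  have h : ⇑(mulX l s) = fun y => (y l : ℂ) * s y := funext fun y => mulX_apply l s y
  have hl : HasFDerivAt (fun y : EuclideanSpace ℝ (Fin n) => (y l : ℂ))
      (ofRealCLM.comp (EuclideanSpace.proj l)) x :=
    (ofRealCLM.comp (EuclideanSpace.proj (𝕜 := ℝ) l)).hasFDerivAt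
  have hd : fderiv ℝ (fun y => (y l : ℂ) * s y) x = _ :=
    (hl.mul s.differentiableAt.hasFDerivAt).fderiv
  rw [derX_apply, h, hd]
  have : (if k = l then s else 0) x = (if k = l then 1 else 0) * s x := by
    split_ifs <;> simp
  change _ = mulX l (derX k s) x + (if k = l then s else 0) x
  rw [mulX_apply, derX_apply, this]
  split_ifs with hkl <;> simp [eq_comm, mul_comm, hkl]

/-- `√(2π)` as a complex number. -/
def rt : ℂ := (Real.sqrt (2 * Real.pi) : ℂ)

theorem rt_sq : rt * rt = 2 * Real.pi := by
  rw [rt, ← ofReal_mul, Real.mul_self_sqrt (by positivity)]; push_cast; rfl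

theorem pi_ne : (Real.pi : ℂ) ≠ 0 := ofReal_ne_zero.mpr Real.pi_ne_zero

theorem rt_ne : rt ≠ 0 := fun h => by
  have := rt_sq
  rw [h, mul_zero] at this
  exact mul_ne_zero two_ne_zero pi_ne this.symm

/-- The derivative in the direction of the `q`-part of a vector. -/
def derV : V n →ₗ[ℂ] End ℂ (S n) := ∑ k, (LinearMap.proj (Sum.inl k)).smulRight (derX k)
/-- The multiplication by the `p`-part of a vector. -/
def mulV : V n →ₗ[ℂ] End ℂ (S n) := ∑ k, (LinearMap.proj (Sum.inr k)).smulRight (mulX k)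

theorem derV_apply (v : V n) (s : S n) : derV v s = ∑ k, v (Sum.inl k) • derX k s := by
  simp [derV]
theorem mulV_apply (v : V n) (s : S n) : mulV v s = ∑ k, v (Sum.inr k) • mulX k s := by
  simp [mulV]

theorem cliff_apply (v : V n) (s : S n) :
    cliff n v s = (-I * rt⁻¹) • derV v s + rt • mulV v s := by
  simp only [cliff, LinearMap.sum_apply, LinearMap.add_apply, LinearMap.smulRight_apply,
    LinearMap.smul_apply, LinearMap.proj_apply, Finset.sum_add_distrib, derV_apply, mulV_apply,
    Finset.smul_sum]
  congr 1
  · refine Finset.sum_congr rfl fun k _ => ?_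
    rw [smul_comm]
    congr 1
    rw [one_div, mul_inv, inv_I, rt]
  · refine Finset.sum_congr rfl fun k _ => ?_
    rw [smul_comm]; rfl

theorem derV_mulV (u v : V n) (s : S n) :
    derV u (mulV v s) = mulV v (derV u s) + (∑ k, u (Sum.inl k) * v (Sum.inr k)) • s := by
  simp only [derV_apply, mulV_apply, map_sum, map_smul, derX_mulX, smul_add, Finset.sum_add_distrib,
    Finset.smul_sum, Finset.sum_smul]
  congr 1
  · rw [Finset.sum_comm]
    exact Finset.sum_congr rfl fun k _ => Finset.sum_congr rfl fun l _ => smul_comm _ _ _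
  · refine Finset.sum_congr rfl fun k _ => ?_
    simp [smul_smul, smul_ite, mul_comm]

theorem derV_comm (u v : V n) (s : S n) : derV u (derV v s) = derV v (derV u s) := by
  simp only [derV_apply, map_sum, map_smul, Finset.smul_sum]
  rw [Finset.sum_comm]
  exact Finset.sum_congr rfl fun k _ => Finset.sum_congr rfl fun l _ => by
    rw [smul_comm, derX_comm]

theorem mulV_comm (u v : V n) (s : S n) : mulV u (mulV v s) = mulV v (mulV u s) := by
  simp only [mulV_apply, map_sum, map_smul, Finset.smul_sum]
  rw [Finset.sum_comm]
  exact Finset.sum_congr rfl fun k _ => Finset.sum_congr rfl fun l _ => by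
    rw [smul_comm, mulX_comm]

theorem rt_inv_mul : rt⁻¹ * rt = 1 := inv_mul_cancel₀ rt_ne

/-- The Clifford relation of the symplectic spinor multiplication. -/
theorem cliff_comm (u v : V n) (s : S n) :
    cliff n u (cliff n v s) = cliff n v (cliff n u s) - (I * omega n u v) • s := by
  have ho : omega n u v = (∑ k, u (Sum.inl k) * v (Sum.inr k)) - ∑ k, v (Sum.inl k) * u (Sum.inr k) := by
    rw [omega, Finset.sum_sub_distrib]
    congr 1
    exact Finset.sum_congr rfl fun k _ => mul_comm _ _
  rw [ho]
  simp only [cliff_apply, map_add, map_smul, derV_mulV, smul_add, derV_comm u v, mulV_comm u v]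
  match_scalars
  · rfl
  · ring
  · ring
  · linear_combination (-I * (∑ k, u (Sum.inl k) * v (Sum.inr k)) +
      I * ∑ k, v (Sum.inl k) * u (Sum.inr k)) * rt_inv_mul
  · rfl

theorem rt_inv_sq : rt⁻¹ * rt⁻¹ = (2 * Real.pi : ℂ)⁻¹ := by rw [← mul_inv, rt_sq]

theorem entry_T (u v : V n) (a c : Fin n ⊕ Fin n) :
    entry a c (T u v) = u a * flatV v c + v a * flatV u c := rfl

/-- The spinor representation is quadratic in the spinor multiplication. -/
theorem sigmaS_T (u v : V n) (s : S n) :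
    sigmaS n (T u v) s = (I / 2) • (cliff n u (cliff n v s) + cliff n v (cliff n u s)) := by
  have h1 (u v : V n) : derV u (derV v s) = ∑ i, ∑ j, (u (Sum.inl i) * v (Sum.inl j)) • derX i (derX j s) := by
    simp only [derV_apply, map_sum, map_smul, Finset.smul_sum, smul_smul]
    exact Finset.sum_comm.trans (Finset.sum_congr rfl fun i _ => Finset.sum_congr rfl fun j _ => by rw [mul_comm])
  have h2 (u v : V n) : mulV u (mulV v s) = ∑ i, ∑ j, (u (Sum.inr i) * v (Sum.inr j)) • mulX i (mulX j s) := by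
    simp only [mulV_apply, map_sum, map_smul, Finset.smul_sum, smul_smul]
    exact Finset.sum_comm.trans (Finset.sum_congr rfl fun i _ => Finset.sum_congr rfl fun j _ => by rw [mul_comm])
  have h3 (u v : V n) : mulV v (derV u s) = ∑ i, ∑ j, (u (Sum.inl i) * v (Sum.inr j)) • mulX j (derX i s) := by
    simp only [mulV_apply, derV_apply, map_sum, map_smul, Finset.smul_sum, smul_smul]
  have hs : sigmaS n (T u v) s = (1 / (4 * Real.pi * I) : ℂ) • (derV u (derV v s) + derV v (derV u s)) +
      (Real.pi * I : ℂ) • (mulV u (mulV v s) + mulV v (mulV u s)) +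
      (mulV v (derV u s) + mulV u (derV v s)) +
      (1 / 2 : ℂ) • (((∑ k, u (Sum.inl k) * v (Sum.inr k)) + ∑ k, v (Sum.inl k) * u (Sum.inr k)) • s) := by
    simp only [sigmaS, LinearMap.sub_apply, LinearMap.smul_apply, LinearMap.sum_apply,
      LinearMap.smulRight_apply, entry_T, flatV, Sum.elim_inl, Sum.elim_inr, h1, h2, h3,
      ← Finset.sum_add_distrib, ← add_smul, mul_neg, ← neg_add, neg_smul, Finset.sum_neg_distrib,
      smul_neg, sub_neg_eq_add, ← Finset.sum_smul]
    simp only [LinearMap.add_apply, LinearMap.smul_apply, LinearMap.sum_apply, End.mul_apply, End.one_apply]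
  rw [hs]
  simp only [cliff_apply, map_add, map_smul, derV_mulV, smul_add, derV_comm v u, mulV_comm v u]
  have hpi : (1 / (4 * Real.pi * I) : ℂ) = -(I / 2) * (2 * Real.pi : ℂ)⁻¹ := by
    have := pi_ne
    field_simp
    linear_combination 4 * I_sq
  match_scalars
  · rw [hpi]
    linear_combination (-I * I * I) * rt_inv_sq - I * (2 * Real.pi : ℂ)⁻¹ * I_sq
  · linear_combination -I * rt_sq
  · linear_combination I * I * rt_inv_mul + I_sq
  · linear_combination I * I * rt_inv_mul + I_sq
  · linear_combination (1 / 2 * ((∑ k, u (Sum.inl k) * v (Sum.inr k)) +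
      ∑ k, v (Sum.inl k) * u (Sum.inr k))) * (I * I * rt_inv_mul + I_sq)

/-- The spinor multiplication is equivariant. -/
theorem sigmaS_cliff (X : G n) (w : V n) (s : S n) :
    sigmaS n X (cliff n w s) = cliff n w (sigmaS n X s) + cliff n (actV X w) s := by
  let p : Submodule ℂ (G n) :=
    { carrier := {X | ∀ w s, sigmaS n X (cliff n w s) =
        cliff n w (sigmaS n X s) + cliff n (actV X w) s}
      add_mem' := fun {X Y} hX hY w s => by
        simp only [map_add, LinearMap.add_apply, hX w s, hY w s]; abel
      zero_mem' := fun w s => by simp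
      smul_mem' := fun c X hX w s => by
        simp only [map_smul, LinearMap.smul_apply, hX w s, smul_add] }
  refine mem_of_T_mem (p := p) (fun u v w s => ?_) X w s
  have h (u v : V n) : cliff n u (cliff n v (cliff n w s)) = cliff n w (cliff n u (cliff n v s)) -
      (I * omega n u w) • cliff n v s - (I * omega n v w) • cliff n u s := by
    rw [cliff_comm v w, map_sub, map_smul, cliff_comm u w]
  simp only [sigmaS_T, h u v, h v u, actV_T, map_add, map_smul, LinearMap.add_apply,
    LinearMap.smul_apply]
  match_scalars
  all_goals first | linear_combination -omega n u w * I_sq |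
    linear_combination -omega n v w * I_sq | ring

/-- For `Y = T u v` both sides are expressed through the spinor multiplication by `sigmaS_T`, and
`sigmaS_cliff` moves the action of `X` past it. -/
theorem sigmaS_lie (X Y : G n) (s : S n) :
    sigmaS n ⁅X, Y⁆ s = sigmaS n X (sigmaS n Y s) - sigmaS n Y (sigmaS n X s) := by
  let p : Submodule ℂ (G n) :=
    { carrier := {Y | ∀ s, sigmaS n ⁅X, Y⁆ s = sigmaS n X (sigmaS n Y s) - sigmaS n Y (sigmaS n X s)}
      add_mem' := fun {Y Z} hY hZ s => by
        simp only [lie_add, map_add, LinearMap.add_apply, hY s, hZ s]; abel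
      zero_mem' := fun s => by simp
      smul_mem' := fun c Y hY s => by
        simp only [lie_smul, map_smul, LinearMap.smul_apply, hY s, smul_sub] }
  refine mem_of_T_mem (p := p) (fun u v s => ?_) Y s
  simp only [lie_T, map_add, LinearMap.add_apply, sigmaS_T, map_smul, sigmaS_cliff]
  module

/-! ### The representation on exterior forms -/

theorem wedge_apply (ε : Module.Dual ℂ (V n)) (α : Forms n) :
    wedge ε α = ExteriorAlgebra.ι ℂ ε * α := rfl

theorem wedge_wedge (ε δ : Module.Dual ℂ (V n)) (α : Forms n) :
    wedge ε (wedge δ α) = -wedge δ (wedge ε α) := by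
  simp only [wedge_apply, ← mul_assoc]
  rw [← neg_mul, eq_neg_of_add_eq_zero_left (ExteriorAlgebra.ι_add_mul_swap (R := ℂ) ε δ)]

theorem contract_wedge (v : V n) (ε : Module.Dual ℂ (V n)) (α : Forms n) :
    contract v (wedge ε α) = ε v • α - wedge ε (contract v α) :=
  CliffordAlgebra.contractLeft_ι_mul _ _ _

theorem contract_contract (u v : V n) (α : Forms n) :
    contract u (contract v α) = -contract v (contract u α) :=
  CliffordAlgebra.contractLeft_comm _ _ _

theorem contract_one (v : V n) : contract v (1 : Forms n) = 0 :=
  by simp [contract]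

theorem contract_add (u v : V n) : contract (u + v) = contract u + contract v := by
  ext1 α
  simp [contract]

theorem contract_smul (c : ℂ) (v : V n) : contract (c • v) = c • contract v := by
  ext1 α
  simp [contract]

/-- Induction on exterior forms. -/
theorem forms_induction {p : Forms n → Prop} (h1 : p 1) (hs : ∀ (c : ℂ) α, p α → p (c • α))
    (ha : ∀ α β, p α → p β → p (α + β))
    (hw : ∀ ε α, p α → p (wedge ε α)) (α : Forms n) : p α := by
  induction α using CliffordAlgebra.left_induction with
  | algebraMap r => rw [Algebra.algebraMap_eq_smul_one]; exact hs _ _ h1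
  | add x y hx hy => exact ha _ _ hx hy
  | ι_mul x m hx => exact hw _ _ hx

theorem actForms_wedge (X : G n) (ε : Module.Dual ℂ (V n)) (α : Forms n) :
    actForms n X (wedge ε α) = wedge (dualAct ε X) α + wedge ε (actForms n X α) :=
  actForms_ι_mul X ε α

theorem dualAct_apply_actV (ε : Module.Dual ℂ (V n)) (X : G n) (v : V n) :
    dualAct ε X v = -ε (actV X v) := rfl

theorem actForms_contract (X : G n) (v : V n) (α : Forms n) :
    actForms n X (contract v α) = contract (actV X v) α + contract v (actForms n X α) := by
  induction α using forms_induction with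
  | h1 => simp [contract_one, actForms_one]
  | hs c α h => simp only [map_smul, h, smul_add]
  | ha α β h h' => simp only [map_add, h, h']; abel
  | hw ε α h =>
    simp only [contract_wedge, actForms_wedge, map_sub, map_smul, map_add, h, dualAct_apply_actV]
    module

theorem actForms_lie (X Y : G n) (α : Forms n) :
    actForms n ⁅X, Y⁆ α = actForms n X (actForms n Y α) - actForms n Y (actForms n X α) := by
  induction α using forms_induction with
  | h1 => simp [actForms_one]
  | hs c α h => simp only [map_smul, h, smul_sub]
  | ha α β h h' => simp only [map_add, h, h']; abel
  | hw ε α h =>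
    have hd : dualAct ε ⁅X, Y⁆ = dualAct (dualAct ε Y) X - dualAct (dualAct ε X) Y := by
      refine LinearMap.ext fun v => ?_
      simp only [LinearMap.sub_apply, dualAct_apply_actV, actV_lie, map_sub]
      abel
    simp only [actForms_wedge, map_add, h, hd, map_sub, LinearMap.sub_apply]
    abel

/-- The covector `ω(v, ·)`. -/
def flatF (v : V n) : Module.Dual ℂ (V n) :=
  { toFun := omega n v
    map_add' := omega_add_right v
    map_smul' := fun c w => omega_smul_right c v w }

theorem flatF_apply (v w : V n) : flatF v w = omega n v w := rfl

/-- The action on forms is quadratic in the exterior multiplications and contractions. -/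
theorem actForms_T (u v : V n) (α : Forms n) :
    actForms n (T u v) α = -(wedge (flatF v) (contract u α) + wedge (flatF u) (contract v α)) := by
  induction α using forms_induction with
  | h1 => simp [actForms_one, contract_one]
  | hs c α h => simp only [map_smul, h, smul_add, smul_neg]
  | ha α β h h' => simp only [map_add, h, h']; abel
  | hw ε α h =>
    have hd : dualAct ε (T u v) = -(ε u • flatF v + ε v • flatF u) := by
      refine LinearMap.ext fun w => ?_
      simp only [LinearMap.add_apply, LinearMap.neg_apply, LinearMap.smul_apply, flatF_apply,
        dualAct_apply_actV, actV_T, map_add, map_smul, smul_eq_mul]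
      ring
    simp only [actForms_wedge, h, hd, contract_wedge, map_sub, map_smul, map_neg, map_add,
      LinearMap.add_apply, LinearMap.neg_apply, LinearMap.smul_apply, wedge_wedge ε (flatF v),
      wedge_wedge ε (flatF u)]
    module

/-! ### The tensor product representation -/

theorem sigmaE_tmul (X : G n) (α : Forms n) (s : S n) :
    sigmaE n X (α ⊗ₜ s) = actForms n X α ⊗ₜ s + α ⊗ₜ sigmaS n X s := rfl

theorem sigmaE_lie (X Y : G n) :
    sigmaE n ⁅X, Y⁆ = sigmaE n X * sigmaE n Y - sigmaE n Y * sigmaE n X := by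
  refine TensorProduct.ext' fun α s => ?_
  simp only [LinearMap.sub_apply, End.mul_apply, sigmaE_tmul, map_add, actForms_lie, sigmaS_lie,
    TensorProduct.sub_tmul, TensorProduct.tmul_sub]
  abel

/-- The canonical element `∑ ε^a ⊗ e_a` of `V^* ⊗ V` does not depend on the basis. -/
theorem sum_coord_eq {M : Type*} [AddCommMonoid M] [Module ℂ M]
    (β : Module.Dual ℂ (V n) →ₗ[ℂ] V n →ₗ[ℂ] M) (e : Module.Basis (Fin n ⊕ Fin n) ℂ (V n)) :
    ∑ a, β (e.coord a) (e a) = ∑ a, β (LinearMap.proj a) (Pi.single a 1) := by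
  have h1 (a) : e a = ∑ c, e a c • Pi.single c (1 : ℂ) := pi_eq_sum_univ' _
  have h2 (c : Fin n ⊕ Fin n) : (LinearMap.proj c : Module.Dual ℂ (V n)) = ∑ a, e a c • e.coord a := by
    refine e.ext fun b => ?_
    simp only [LinearMap.sum_apply, LinearMap.smul_apply, Module.Basis.coord_apply,
      Module.Basis.repr_self, Finsupp.single_apply, smul_eq_mul, mul_ite, mul_one, mul_zero,
      Finset.sum_ite_eq, Finset.mem_univ, if_true, LinearMap.proj_apply]
  calc ∑ a, β (e.coord a) (e a) = ∑ a, ∑ c, e a c • β (e.coord a) (Pi.single c 1) := by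
        refine Finset.sum_congr rfl fun a _ => ?_
        conv_lhs => rw [h1 a]
        simp only [map_sum, map_smul]
    _ = _ := by
        rw [Finset.sum_comm]
        refine Finset.sum_congr rfl fun c _ => ?_
        rw [h2 c]
        simp only [map_sum, map_smul, LinearMap.sum_apply, LinearMap.smul_apply]

/-- The canonical element of `V^* ⊗ V` is invariant. -/
theorem sum_coord_invariant {M : Type*} [AddCommMonoid M] [Module ℂ M]
    (β : Module.Dual ℂ (V n) →ₗ[ℂ] V n →ₗ[ℂ] M) (X : G n) :
    ∑ a, (β (dualAct (LinearMap.proj a) X) (Pi.single a 1) +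
      β (LinearMap.proj a) (actV X (Pi.single a 1))) = 0 := by
  have h1 (a) : actV X (Pi.single a 1) = ∑ c, toMat n X c a • (Pi.single c (1 : ℂ) : V n) := by
    rw [actV_apply, Matrix.mulVec_single_one]
    exact pi_eq_sum_univ' _
  have h2 (a : Fin n ⊕ Fin n) : dualAct (LinearMap.proj a) X =
      ∑ c, (-toMat n X a c) • (LinearMap.proj c : Module.Dual ℂ (V n)) := by
    refine LinearMap.ext fun v => ?_
    simp only [dualAct_apply, Matrix.mulVec, dotProduct, LinearMap.sum_apply,
      LinearMap.smul_apply, LinearMap.proj_apply, smul_eq_mul, neg_mul, Finset.sum_neg_distrib]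
  have h3 (a : Fin n ⊕ Fin n) : β (dualAct (LinearMap.proj a) X) (Pi.single a 1) =
      ∑ c, (-toMat n X a c) • β (LinearMap.proj c) (Pi.single a 1) := by
    rw [h2]
    simp only [map_sum, map_smul, LinearMap.sum_apply, LinearMap.smul_apply]
  have h4 (a : Fin n ⊕ Fin n) : β (LinearMap.proj a) (actV X (Pi.single a 1)) =
      ∑ c, toMat n X c a • β (LinearMap.proj a) (Pi.single c 1) := by
    rw [h1]
    simp only [map_sum, map_smul]
  rw [Finset.sum_add_distrib, Finset.sum_congr rfl fun a _ => h3 a,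
    Finset.sum_congr rfl fun a _ => h4 a, Finset.sum_comm (f := fun a c => toMat n X c a • _),
    ← Finset.sum_add_distrib]
  refine Finset.sum_eq_zero fun a _ => ?_
  rw [← Finset.sum_add_distrib]
  exact Finset.sum_eq_zero fun c _ => by rw [← add_smul, neg_add_cancel, zero_smul]

end

section

variable {n : ℕ}

/-! ### The Gaussian -/

/-- The Gaussian decays faster than every polynomial. -/
theorem one_add_pow_mul_exp_le (M : ℕ) {r : ℝ} (hr : 0 ≤ r) :
    (1 + r) ^ M * Real.exp (-Real.pi * r ^ 2) ≤ M.factorial * Real.exp 2 := by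
  have h1 : (1 + r) ^ M ≤ M.factorial * Real.exp (1 + r) := by
    have := Real.pow_div_factorial_le_exp (1 + r) (by positivity) M
    rwa [div_le_iff₀' (by positivity)] at this
  have h2 : 1 + r + -Real.pi * r ^ 2 ≤ 2 := by
    nlinarith [Real.pi_gt_three, sq_nonneg r, sq_nonneg (r - 1)]
  calc (1 + r) ^ M * Real.exp (-Real.pi * r ^ 2)
      ≤ M.factorial * Real.exp (1 + r) * Real.exp (-Real.pi * r ^ 2) := by gcongr
    _ = M.factorial * Real.exp (1 + r + -Real.pi * r ^ 2) := by rw [mul_assoc, ← Real.exp_add]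
    _ ≤ M.factorial * Real.exp 2 := by gcongr

/-- The real-valued Gaussian `exp (-π |x|²)` is a Schwartz function, since its derivatives are
bounded by polynomials times the Gaussian. -/
def gaussR (n : ℕ) : 𝓢(EuclideanSpace ℝ (Fin n), ℝ) where
  toFun x := Real.exp (-Real.pi * ‖x‖ ^ 2)
  smooth' := Real.contDiff_exp.comp (contDiff_const.mul (contDiff_norm_sq ℝ))
  decay' := by
    intro m N
    let f : EuclideanSpace ℝ (Fin n) → ℝ := fun x => -Real.pi * ‖x‖ ^ 2
    have hf : f.HasTemperateGrowth :=
      (Function.HasTemperateGrowth.const (-Real.pi)).mul (Function.hasTemperateGrowth_norm_sq _)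
    obtain ⟨k, C, hC, h⟩ := hf.norm_iteratedFDeriv_le_uniform N
    refine ⟨N.factorial * (1 + C) ^ N * ((m + k * N).factorial * Real.exp 2), fun x => ?_⟩
    have h1 : ‖iteratedFDeriv ℝ N (Real.exp ∘ f) x‖ ≤
        N.factorial * Real.exp (f x) * ((1 + C) * (1 + ‖x‖) ^ k) ^ N := by
      refine norm_iteratedFDeriv_comp_le (N := ((⊤ : ℕ∞) : WithTop ℕ∞)) Real.contDiff_exp hf.1 (by exact_mod_cast le_top) x
        (fun i _ => ?_) fun i hi hiN => ?_
      · rw [norm_iteratedFDeriv_eq_norm_iteratedDeriv, iteratedDeriv_eq_iterate, Real.iter_deriv_exp,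
          Real.norm_of_nonneg (Real.exp_pos _).le]
      · refine (h i hiN x).trans ?_
        have h0 : 1 ≤ (1 + C) * (1 + ‖x‖) ^ k :=
          one_le_mul_of_one_le_of_one_le (by linarith) (one_le_pow₀ (by linarith [norm_nonneg x]))
        calc C * (1 + ‖x‖) ^ k ≤ (1 + C) * (1 + ‖x‖) ^ k := by gcongr; linarith
          _ ≤ _ := le_self_pow₀ h0 (by omega)
    have h2 := one_add_pow_mul_exp_le (m + k * N) (norm_nonneg x)
    calc ‖x‖ ^ m * ‖iteratedFDeriv ℝ N (Real.exp ∘ f) x‖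
        ≤ (1 + ‖x‖) ^ m * (N.factorial * Real.exp (f x) * ((1 + C) * (1 + ‖x‖) ^ k) ^ N) := by
          gcongr; linarith
      _ = N.factorial * (1 + C) ^ N * ((1 + ‖x‖) ^ (m + k * N) * Real.exp (-Real.pi * ‖x‖ ^ 2)) := by
          rw [mul_pow, ← pow_mul, pow_add]; ring
      _ ≤ _ := by gcongr

/-- The Gaussian `exp (-π |x|²)`. -/
def gauss (n : ℕ) : S n := (gaussR n).postcompCLM Complex.ofRealCLM

theorem gauss_apply (x : EuclideanSpace ℝ (Fin n)) :
    gauss n x = (Real.exp (-Real.pi * ‖x‖ ^ 2) : ℂ) := rfl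

theorem derX_gauss (k : Fin n) : derX k (gauss n) = (-2 * Real.pi : ℂ) • mulX k (gauss n) := by
  ext x
  have h1 : HasFDerivAt (fun x : EuclideanSpace ℝ (Fin n) => -Real.pi * ‖x‖ ^ 2)
      ((-Real.pi) • (2 • innerSL ℝ x)) x :=
    (hasStrictFDerivAt_norm_sq x).hasFDerivAt.const_mul _
  have h2 := ofRealCLM.hasFDerivAt.comp x h1.exp
  have h3 : ⇑(gauss n) = ofRealCLM ∘ fun x => Real.exp (-Real.pi * ‖x‖ ^ 2) := rfl
  rw [derX_apply, h3, h2.fderiv]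
  change _ = (-2 * Real.pi : ℂ) * mulX k (gauss n) x
  rw [mulX_apply, gauss_apply]
  simp [EuclideanSpace.inner_single_right]
  ring

/-- `S_K` is generated from the Gaussian by the multiplications with coordinate functions. -/
theorem SK_le {p : Submodule ℂ (S n)} (h0 : gauss n ∈ p) (hx : ∀ k, ∀ s ∈ p, mulX k s ∈ p) :
    SK n ≤ p := by
  rintro s ⟨P, hP⟩
  have h (P : MvPolynomial (Fin n) ℂ) : ∃ t ∈ p, ∀ x : EuclideanSpace ℝ (Fin n),
      t x = MvPolynomial.eval (fun k => (x k : ℂ)) P * Real.exp (-Real.pi * ‖x‖ ^ 2) := by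
    induction P using MvPolynomial.induction_on with
    | C c => exact ⟨c • gauss n, p.smul_mem _ h0, fun x => by
        rw [smul_apply, gauss_apply, MvPolynomial.eval_C, smul_eq_mul]⟩
    | add P Q hP hQ =>
      obtain ⟨t, ht, ht'⟩ := hP
      obtain ⟨u, hu, hu'⟩ := hQ
      exact ⟨t + u, p.add_mem ht hu, fun x => by rw [add_apply, ht', hu', map_add, add_mul]⟩
    | mul_X P k hP =>
      obtain ⟨t, ht, ht'⟩ := hP
      exact ⟨mulX k t, hx k t ht, fun x => by
        rw [mulX_apply, ht', map_mul, MvPolynomial.eval_X]; ring⟩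
  obtain ⟨t, ht, ht'⟩ := h P
  have : s = t := by ext x; rw [hP, ht']
  exact this ▸ ht

theorem gauss_mem_SK : gauss n ∈ SK n := ⟨1, fun x => by rw [gauss_apply, map_one, one_mul]⟩

theorem mulX_mem_SK (k : Fin n) {s : S n} (hs : s ∈ SK n) : mulX k s ∈ SK n := by
  obtain ⟨P, hP⟩ := hs
  exact ⟨MvPolynomial.X k * P, fun x => by
    rw [mulX_apply, hP, map_mul, MvPolynomial.eval_X, mul_assoc]⟩

theorem derX_mem_SK (k : Fin n) {s : S n} (hs : s ∈ SK n) : derX k s ∈ SK n := by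
  let p : Submodule ℂ (S n) := SK n ⊓ (SK n).comap (derX k)
  have h : SK n ≤ p := by
    refine SK_le ⟨gauss_mem_SK, ?_⟩ fun l t ht => ⟨mulX_mem_SK l ht.1, ?_⟩
    · change derX k (gauss n) ∈ SK n
      rw [derX_gauss]
      exact Submodule.smul_mem _ _ (mulX_mem_SK k gauss_mem_SK)
    · change derX k (mulX l t) ∈ SK n
      rw [derX_mulX]
      refine add_mem (mulX_mem_SK l ht.2) ?_
      split_ifs
      exacts [ht.1, zero_mem _]
  exact (h hs).2

theorem cliff_mem_SK (v : V n) {s : S n} (hs : s ∈ SK n) : cliff n v s ∈ SK n := by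
  rw [cliff_apply, derV_apply, mulV_apply]
  exact add_mem (Submodule.smul_mem _ _ (sum_mem fun k _ => Submodule.smul_mem _ _ (derX_mem_SK k hs)))
    (Submodule.smul_mem _ _ (sum_mem fun k _ => Submodule.smul_mem _ _ (mulX_mem_SK k hs)))

/-! ### The parity of Schwartz functions -/

/-- The map `s(x) ↦ s(-x)`. -/
def refl (n : ℕ) : End ℂ (S n) :=
  (SchwartzMap.compCLMOfContinuousLinearEquiv ℂ
    (LinearIsometryEquiv.neg ℝ (E := EuclideanSpace ℝ (Fin n))).toContinuousLinearEquiv).toLinearMap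

theorem refl_apply (s : S n) (x : EuclideanSpace ℝ (Fin n)) : refl n s x = s (-x) := rfl

theorem refl_mulX (k : Fin n) (s : S n) : refl n (mulX k s) = -mulX k (refl n s) := by
  ext x
  rw [refl_apply, mulX_apply, neg_apply, mulX_apply, refl_apply]
  simp

theorem refl_derX (k : Fin n) (s : S n) : refl n (derX k s) = -derX k (refl n s) := by
  ext x
  have h : ⇑(refl n s) = fun x => s (-x) := rfl
  have h2 : HasFDerivAt (fun x => s (-x))
      ((fderiv ℝ s (-x)).comp (-ContinuousLinearMap.id ℝ (EuclideanSpace ℝ (Fin n)))) x :=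
    s.differentiableAt.hasFDerivAt.comp x (hasFDerivAt_id x).neg
  rw [refl_apply, derX_apply, neg_apply, derX_apply, h, h2.fderiv]
  simp

theorem refl_cliff (v : V n) (s : S n) : refl n (cliff n v s) = -cliff n v (refl n s) := by
  simp only [cliff_apply, derV_apply, mulV_apply, map_add, map_smul, map_sum, refl_mulX, refl_derX,
    smul_neg, Finset.sum_neg_distrib, neg_add]

theorem mem_Spar {p : Fin 2} {s : S n} : s ∈ Spar n p ↔ refl n s = (-1 : ℂ) ^ (p : ℕ) • s :=
  ⟨fun h => by ext x; exact h x, fun h x => by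
    rw [← refl_apply, h]; rfl⟩

theorem refl_gauss : refl n (gauss n) = gauss n := by
  ext x
  rw [refl_apply, gauss_apply, gauss_apply, norm_neg]

theorem refl_refl (s : S n) : refl n (refl n s) = s := by
  ext x
  rw [refl_apply, refl_apply, neg_neg]

theorem integrable_mul (s t : S n) : MeasureTheory.Integrable fun x => s x * t x :=
  (SchwartzMap.pairing (ContinuousLinearMap.mul ℂ ℂ) s t).integrable

/-- The bilinear form `∫ s t` on Schwartz functions. -/
def formS (n : ℕ) : S n →ₗ[ℂ] S n →ₗ[ℂ] ℂ :=
  LinearMap.mk₂ ℂ (fun s t => ∫ x, s x * t x)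
    (fun s s' t => by
      simp only [add_apply, add_mul]
      exact MeasureTheory.integral_add (integrable_mul s t) (integrable_mul s' t))
    (fun c s t => by
      simp only [smul_apply, smul_eq_mul, mul_assoc]
      exact MeasureTheory.integral_const_mul c _)
    (fun s t t' => by
      simp only [add_apply, mul_add]
      exact MeasureTheory.integral_add (integrable_mul s t) (integrable_mul s t'))
    (fun c s t => by
      simp only [smul_apply, smul_eq_mul, mul_left_comm _ c]
      exact MeasureTheory.integral_const_mul c _)

theorem formS_apply (s t : S n) : formS n s t = ∫ x, s x * t x := rfl

theorem formS_mulX (k : Fin n) (s t : S n) : formS n (mulX k s) t = formS n s (mulX k t) := by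
  rw [formS_apply, formS_apply]
  congr 1 with x
  rw [mulX_apply, mulX_apply]; ring

theorem formS_derX (k : Fin n) (s t : S n) : formS n (derX k s) t = -formS n s (derX k t) := by
  rw [formS_apply, formS_apply, ← neg_eq_iff_eq_neg]
  exact (SchwartzMap.integral_mul_lineDerivOp_right_eq_neg_left s t (EuclideanSpace.single k 1)).symm

theorem formS_gauss : formS n (gauss n) (gauss n) ≠ 0 := by
  have h : formS n (gauss n) (gauss n) = ((∫ x, gaussR n x * gaussR n x : ℝ) : ℂ) := by
    have h2 := integral_ofReal (𝕜 := ℂ) (μ := MeasureTheory.volume)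
      (f := fun x => gaussR n x * gaussR n x)
    rw [formS_apply]
    refine Eq.trans ?_ h2
    congr 1 with x
    exact (ofReal_mul _ _).symm
  have hpos : ∀ x, 0 < gaussR n x * gaussR n x := fun x => mul_pos (Real.exp_pos _) (Real.exp_pos _)
  rw [h, ofReal_ne_zero]
  refine ne_of_gt ((MeasureTheory.integral_pos_iff_support_of_nonneg (fun x => (hpos x).le)
    (SchwartzMap.pairing (ContinuousLinearMap.mul ℝ ℝ) (gaussR n) (gaussR n)).integrable).mpr ?_)
  rw [Function.support_eq_univ fun x => (hpos x).ne']
  exact isOpen_univ.measure_pos _ Set.univ_nonempty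

end

section

variable {n : ℕ}

/-! ### Oscillators on the spinor-valued exterior forms -/

theorem end_tensor_ext {f g : End ℂ (E n)} (h : ∀ α s, f (α ⊗ₜ s) = g (α ⊗ₜ s)) (x : E n) :
    f x = g x := DFunLike.congr_fun (TensorProduct.ext' h) x

/-- The basis `A_k, B_k` of `V`. -/
def vAB : Fin n ⊕ Fin n → V n := Sum.elim vA vB

/-- The basis of `V^*` dual to the basis `A_k, B_k`. -/
def cov : Fin n ⊕ Fin n → Module.Dual ℂ (V n) :=
  Sum.elim (fun k => LinearMap.proj (Sum.inl k) - I • LinearMap.proj (Sum.inr k))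
    (fun k => LinearMap.proj (Sum.inl k) + I • LinearMap.proj (Sum.inr k))

theorem cov_inl (k : Fin n) (v : V n) : cov (Sum.inl k) v = v (Sum.inl k) - I * v (Sum.inr k) := rfl
theorem cov_inr (k : Fin n) (v : V n) : cov (Sum.inr k) v = v (Sum.inl k) + I * v (Sum.inr k) := rfl

theorem cov_vAB (r s : Fin n ⊕ Fin n) : cov r (vAB s : V n) = if r = s then 1 else 0 := by
  rcases r with k | k <;> rcases s with l | l
  all_goals
    simp only [cov_inl, cov_inr, vAB, Sum.elim_inl, Sum.elim_inr, vA, vB, Pi.smul_apply,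
      Pi.add_apply, Pi.sub_apply, Pi.single_apply, smul_eq_mul, Sum.inl.injEq, Sum.inr.injEq,
      reduceCtorEq, if_false]
    by_cases h : k = l
    · simp only [h, if_true]
      first | linear_combination (1 / 2 : ℂ) * I_sq | linear_combination (-1 / 2 : ℂ) * I_sq
    · simp [h]

theorem omega_vA' (k : Fin n) (w : V n) : omega n (vA k) w = -(I / 2) * cov (Sum.inr k) w :=
  omega_vA k w
theorem omega_vB' (k : Fin n) (w : V n) : omega n (vB k) w = I / 2 * cov (Sum.inl k) w :=
  omega_vB k w

/-- `√2` as a complex number. -/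
def r2 : ℂ := (Real.sqrt 2 : ℂ)

theorem r2_sq : r2 * r2 = 2 := by
  rw [r2, ← ofReal_mul, Real.mul_self_sqrt (by norm_num)]; norm_num

theorem r2_ne : r2 ≠ 0 := fun h => by
  have := r2_sq
  rw [h, mul_zero] at this
  exact two_ne_zero this.symm

/-- The bosonic creation operators `√π (x_k - ∂_k / 2π)`. -/
def zS (k : Fin n) : End ℂ (S n) := (-(I * r2)) • cliff n (vA k)
/-- The bosonic annihilation operators `√π (x_k + ∂_k / 2π)`. -/
def dS (k : Fin n) : End ℂ (S n) := (I * r2) • cliff n (vB k)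

theorem zS_apply (k : Fin n) (s : S n) : zS k s = (-(I * r2)) • cliff n (vA k) s := rfl
theorem dS_apply (k : Fin n) (s : S n) : dS k s = (I * r2) • cliff n (vB k) s := rfl

theorem cliff_vA (k : Fin n) (s : S n) : cliff n (vA k) s = (I / 2 * r2) • zS k s := by
  rw [zS_apply, smul_smul]
  have : I / 2 * r2 * -(I * r2) = 1 := by linear_combination (-I * I / 2) * r2_sq - I_sq
  rw [this, one_smul]

theorem cliff_vB (k : Fin n) (s : S n) : cliff n (vB k) s = (-(I / 2 * r2)) • dS k s := by
  rw [dS_apply, smul_smul]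
  have : -(I / 2 * r2) * (I * r2) = 1 := by linear_combination (-I * I / 2) * r2_sq - I_sq
  rw [this, one_smul]

theorem vA_eq (k : Fin n) : vA k = vAB (Sum.inl k) := rfl
theorem vB_eq (k : Fin n) : vB k = vAB (Sum.inr k) := rfl

theorem zS_zS (k l : Fin n) (s : S n) : zS k (zS l s) = zS l (zS k s) := by
  have h : omega n (vA k) (vA l) = 0 := by rw [omega_vA', vA_eq, cov_vAB]; simp
  simp only [zS_apply, map_smul, cliff_comm (vA k), h, mul_zero, zero_smul, sub_zero]

theorem dS_dS (k l : Fin n) (s : S n) : dS k (dS l s) = dS l (dS k s) := by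
  have h : omega n (vB k) (vB l) = 0 := by rw [omega_vB', vB_eq, cov_vAB]; simp
  simp only [dS_apply, map_smul, cliff_comm (vB k), h, mul_zero, zero_smul, sub_zero]

theorem dS_zS (k l : Fin n) (s : S n) : dS k (zS l s) = zS l (dS k s) + if k = l then s else 0 := by
  have h : omega n (vB k) (vA l) = if k = l then I / 2 else 0 := by
    rw [omega_vB', vA_eq, cov_vAB]; simp
  have h1 : I * r2 * -(I * r2) * -(I * (I / 2)) = 1 := by
    linear_combination (I ^ 4 / 2) * r2_sq + (I ^ 2 - 1) * I_sq
  simp only [dS_apply, zS_apply, map_smul, cliff_comm (vB k), h, smul_smul, sub_eq_add_neg,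
    ← neg_smul, smul_add]
  congr 1
  · rw [mul_comm]
  · split_ifs
    · conv_rhs => rw [← one_smul ℂ s, ← h1]
      module
    · simp

/-- Exterior multiplication by a one-form on `E`. -/
def wedgeE (ε : Module.Dual ℂ (V n)) : End ℂ (E n) := TensorProduct.map (wedge ε) LinearMap.id
/-- The contraction by a vector on `E`. -/
def contractE (v : V n) : End ℂ (E n) := TensorProduct.map (contract v) LinearMap.id
/-- An operator on the second factor of `E`. -/
def onS (f : End ℂ (S n)) : End ℂ (E n) := TensorProduct.map LinearMap.id f

theorem wedgeE_tmul (ε : Module.Dual ℂ (V n)) (α : Forms n) (s : S n) :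
    wedgeE ε (α ⊗ₜ s) = wedge ε α ⊗ₜ s := rfl
theorem contractE_tmul (v : V n) (α : Forms n) (s : S n) :
    contractE v (α ⊗ₜ s) = contract v α ⊗ₜ s := rfl
theorem onS_tmul (f : End ℂ (S n)) (α : Forms n) (s : S n) :
    onS f (α ⊗ₜ s) = α ⊗ₜ f s := rfl

/-- The oscillator algebra acting on `E`. -/
def osc (n : ℕ) : Osc n (E n) where
  z k := onS (zS k)
  d k := onS (dS k)
  c r := wedgeE (cov r)
  dc r := contractE (vAB r)
  zz k l := end_tensor_ext (f := onS (zS k) * onS (zS l)) (g := onS (zS l) * onS (zS k))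
    fun α s => by simp only [End.mul_apply, onS_tmul, zS_zS k l]
  dd k l := end_tensor_ext (f := onS (dS k) * onS (dS l)) (g := onS (dS l) * onS (dS k))
    fun α s => by simp only [End.mul_apply, onS_tmul, dS_dS k l]
  dz k l x := by
    have := end_tensor_ext (f := onS (dS k) * onS (zS l))
      (g := onS (zS l) * onS (dS k) + if k = l then 1 else 0)
      (fun α s => by
        simp only [End.mul_apply, onS_tmul, dS_zS k l, LinearMap.add_apply, TensorProduct.tmul_add]
        split_ifs <;> simp) x
    rw [End.mul_apply, LinearMap.add_apply, End.mul_apply] at this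
    rw [this]
    split_ifs <;> rfl
  cc r s := end_tensor_ext (f := wedgeE (cov r) * wedgeE (cov s))
    (g := -(wedgeE (cov s) * wedgeE (cov r)))
    fun α t => by
      simp only [End.mul_apply, LinearMap.neg_apply, wedgeE_tmul, wedge_wedge (cov r),
        TensorProduct.neg_tmul]
  dcdc r s := end_tensor_ext (f := contractE (vAB r) * contractE (vAB s))
    (g := -(contractE (vAB s) * contractE (vAB r)))
    fun α t => by
      simp only [End.mul_apply, LinearMap.neg_apply, contractE_tmul, contract_contract (vAB r),
        TensorProduct.neg_tmul]
  dcc r s x := by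
    have := end_tensor_ext (f := contractE (vAB r) * wedgeE (cov s))
      (g := (if r = s then 1 else 0) - wedgeE (cov s) * contractE (vAB r))
      (fun α t => by
        simp only [End.mul_apply, wedgeE_tmul, contractE_tmul, contract_wedge, LinearMap.sub_apply,
          TensorProduct.sub_tmul, cov_vAB, eq_comm (a := r)]
        split_ifs <;> simp) x
    rw [End.mul_apply, LinearMap.sub_apply, End.mul_apply] at this
    rw [this]
    split_ifs <;> rfl
  zc k r := end_tensor_ext (f := onS (zS k) * wedgeE (cov r)) (g := wedgeE (cov r) * onS (zS k))
    fun α s => rfl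
  zdc k r := end_tensor_ext (f := onS (zS k) * contractE (vAB r))
    (g := contractE (vAB r) * onS (zS k)) fun α s => rfl
  d_c k r := end_tensor_ext (f := onS (dS k) * wedgeE (cov r)) (g := wedgeE (cov r) * onS (dS k))
    fun α s => rfl
  ddc k r := end_tensor_ext (f := onS (dS k) * contractE (vAB r))
    (g := contractE (vAB r) * onS (dS k)) fun α s => rfl

theorem osc_z (k : Fin n) (α : Forms n) (s : S n) : (osc n).z k (α ⊗ₜ s) = α ⊗ₜ zS k s := rfl
theorem osc_d (k : Fin n) (α : Forms n) (s : S n) : (osc n).d k (α ⊗ₜ s) = α ⊗ₜ dS k s := rfl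
theorem osc_c (r) (α : Forms n) (s : S n) : (osc n).c r (α ⊗ₜ s) = wedge (cov r) α ⊗ₜ s := rfl
theorem osc_dc (r) (α : Forms n) (s : S n) : (osc n).dc r (α ⊗ₜ s) = contract (vAB r) α ⊗ₜ s := rfl

/-- The parity operator on `E`. -/
def parE (n : ℕ) : End ℂ (E n) := onS (refl n)

/-- The vacuum vector `1 ⊗ exp (-π |x|²)`. -/
def vac (n : ℕ) : E n := 1 ⊗ₜ gauss n

theorem dS_gauss (k : Fin n) : dS k (gauss n) = 0 := by
  have h : cliff n (vB k) (gauss n) = 0 := by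
    have h1 : derV (vB k) (gauss n) = (2⁻¹ : ℂ) • derX k (gauss n) := by
      simp [derV_apply, vB, Pi.single_apply]
    have h2 : mulV (vB k) (gauss n) = (-(2⁻¹ * I) : ℂ) • mulX k (gauss n) := by
      simp [mulV_apply, vB, Pi.single_apply, smul_smul]
    have h3 : rt = rt⁻¹ * (2 * Real.pi) := by rw [← rt_sq, ← mul_assoc, rt_inv_mul, one_mul]
    rw [cliff_apply, h1, h2, derX_gauss]
    nth_rewrite 2 [h3]
    module
  rw [dS_apply, h, smul_zero]

theorem vacuum (n : ℕ) : (osc n).Vacuum (vac n) (parE n) where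
  d k := by rw [vac, osc_d, dS_gauss, TensorProduct.tmul_zero]
  dc r := by rw [vac, osc_dc, contract_one, TensorProduct.zero_tmul]
  par_z k := end_tensor_ext (f := parE n * (osc n).z k) (g := -((osc n).z k * parE n))
    fun α s => by
      simp only [End.mul_apply, LinearMap.neg_apply, parE, onS_tmul, osc_z, zS_apply, map_smul,
        refl_cliff, smul_neg, TensorProduct.tmul_neg]
  par_c r := end_tensor_ext (f := parE n * (osc n).c r) (g := (osc n).c r * parE n)
    fun α s => rfl
  par_vac := by rw [vac, parE, onS_tmul, refl_gauss]

/-! ### The symplectic Lie algebra and oscillators -/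

attribute [local instance] LieRing.ofAssociativeRing

/-- The representation `σ` as a homomorphism of Lie algebras. -/
def sigmaHom (n : ℕ) : G n →ₗ⁅ℂ⁆ End ℂ (E n) where
  toFun := sigmaE n
  map_add' X Y := TensorProduct.ext' fun α s => by
    simp only [LinearMap.add_apply, sigmaE_tmul, map_add, TensorProduct.add_tmul,
      TensorProduct.tmul_add]
    abel
  map_smul' c X := TensorProduct.ext' fun α s => by
    simp only [LinearMap.smul_apply, sigmaE_tmul, map_smul, RingHom.id_apply, smul_add,
      TensorProduct.smul_tmul', TensorProduct.tmul_smul]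
  map_lie' {X Y} := sigmaE_lie X Y

theorem sigmaHom_apply (X : G n) : sigmaHom n X = sigmaE n X := rfl

theorem sigmaE_T_tmul (u v : V n) (α : Forms n) (s : S n) :
    sigmaE n (T u v) (α ⊗ₜ s) =
      -(wedge (flatF v) (contract u α) ⊗ₜ[ℂ] s) - wedge (flatF u) (contract v α) ⊗ₜ[ℂ] s +
      ((I / 2) • (α ⊗ₜ[ℂ] cliff n u (cliff n v s)) +
        (I / 2) • (α ⊗ₜ[ℂ] cliff n v (cliff n u s))) := by
  rw [sigmaE_tmul, actForms_T, sigmaS_T, TensorProduct.neg_tmul, TensorProduct.add_tmul,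
    TensorProduct.tmul_smul, TensorProduct.tmul_add]
  module

theorem flatF_vA (k : Fin n) : flatF (vA k) = (-(I / 2)) • cov (Sum.inr k) :=
  LinearMap.ext fun w => omega_vA' k w
theorem flatF_vB (k : Fin n) : flatF (vB k) = (I / 2) • cov (Sum.inl k) :=
  LinearMap.ext fun w => omega_vB' k w

theorem I_sq_mul_r2 : 2 * I * (I / 2 * (I / 2 * r2 * (I / 2 * r2))) = 1 / 2 := by
  linear_combination (I ^ 4 / 4) * r2_sq + ((I ^ 2 - 1) / 2) * I_sq

/-- The positive root vectors of weight `ε_k + ε_l` act by the operators `Osc.X`. -/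
theorem sigmaE_BB (k l : Fin n) (x : E n) :
    sigmaE n ((2 * I) • T (vB k) (vB l)) x = (osc n).X k l x := by
  rw [← sigmaHom_apply, map_smul, sigmaHom_apply]
  refine end_tensor_ext (f := (2 * I) • sigmaE n (T (vB k) (vB l))) (fun α s => ?_) x
  simp only [LinearMap.smul_apply, sigmaE_T_tmul, Osc.X_apply, Osc.XF_apply, osc_d, osc_c, osc_dc,
    flatF_vB, map_smul, cliff_vB, ← vB_eq, dS_dS l k, TensorProduct.tmul_smul,
    ← TensorProduct.smul_tmul']
  match_scalars
  · linear_combination -I_sq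
  · linear_combination -I_sq
  · linear_combination 2 * I_sq_mul_r2

/-- The Levi subalgebra `gl(n)` acts by the operators `Osc.R`, up to the zero-point energy `1 / 2`. -/
theorem sigmaE_BA (k l : Fin n) (x : E n) :
    sigmaE n ((2 * I) • T (vB k) (vA l)) x =
      (osc n).R k l x - (if k = l then (1 / 2 : ℂ) else 0) • x := by
  rw [← sigmaHom_apply, map_smul, sigmaHom_apply]
  refine end_tensor_ext (f := (2 * I) • sigmaE n (T (vB k) (vA l)))
    (g := (osc n).R k l - (if k = l then (1 / 2 : ℂ) else 0) • 1) (fun α s => ?_) x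
  have h3 : (if k = l then s else 0) = (if k = l then (1 : ℂ) else 0) • s := by
    split_ifs <;> simp
  simp only [LinearMap.smul_apply, LinearMap.sub_apply, End.one_apply, sigmaE_T_tmul, Osc.R_apply,
    osc_d, osc_z, osc_c, osc_dc, flatF_vB, flatF_vA, map_smul, cliff_vB, cliff_vA, ← vB_eq, ← vA_eq,
    dS_zS, h3, TensorProduct.tmul_add, TensorProduct.tmul_smul, ← TensorProduct.smul_tmul']
  split_ifs
  all_goals match_scalars
  all_goals first | linear_combination I_sq | linear_combination -I_sq |
    linear_combination -2 * I_sq_mul_r2 | linear_combination -I_sq_mul_r2 | ring1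

end

section

/-! ### The anticommutator of `D` and `D'` -/

namespace Osc

variable {n : ℕ} {M : Type*} [AddCommGroup M] [Module ℂ M] (o : Osc n M)

/-- The operator `∑ (a_k z_k - b_k ∂_{z_k})`, dual to `D`. -/
def D' : End ℂ M := ∑ k, (o.a k * o.z k - o.b k * o.d k)

theorem D'_apply (x : M) : o.D' x = ∑ k, (o.a k (o.z k x) - o.b k (o.d k x)) := by simp [D']

/-- In `D D' + D' D` all terms with `k ≠ l` cancel, and what remains counts the empty modes of type `a`
against the filled modes of type `b`. -/
theorem D_D' (x : M) : o.D (o.D' x) + o.D' (o.D x) = (n : ℂ) • x - o.NF x := by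
  have h (k l : Fin n) :
      (o.db k (o.z k (o.a l (o.z l x) - o.b l (o.d l x))) +
        o.da k (o.d k (o.a l (o.z l x) - o.b l (o.d l x)))) +
      (o.a l (o.z l (o.db k (o.z k x) + o.da k (o.d k x))) -
        o.b l (o.d l (o.db k (o.z k x) + o.da k (o.d k x)))) =
      if k = l then x - o.num (Sum.inl k) x - o.num (Sum.inr k) x else 0 := by
    simp only [map_add, map_sub, o.zc, o.zdc, o.d_c, o.ddc, o.dcc, o.dz, Sum.inl.injEq,
      Sum.inr.injEq, reduceCtorEq, if_false, zero_sub, o.zz l k, o.dd l k, num_apply]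
    by_cases hkl : k = l
    · subst hkl
      simp only [if_true]
      abel
    · simp only [if_neg hkl, if_neg (Ne.symm hkl), add_zero, zero_sub, map_zero]
      abel
  have h1 : o.D (o.D' x) + o.D' (o.D x) =
      ∑ k, ∑ l, if k = l then x - o.num (Sum.inl k) x - o.num (Sum.inr k) x else 0 := by
    have h2 : o.D (o.D' x) = ∑ k, ∑ l, (o.db k (o.z k (o.a l (o.z l x) - o.b l (o.d l x))) +
        o.da k (o.d k (o.a l (o.z l x) - o.b l (o.d l x)))) := by
      rw [D'_apply, D_apply]
      exact Finset.sum_congr rfl fun k _ => by simp only [map_sum, Finset.sum_add_distrib]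
    have h3 : o.D' (o.D x) = ∑ k, ∑ l, (o.a l (o.z l (o.db k (o.z k x) + o.da k (o.d k x))) -
        o.b l (o.d l (o.db k (o.z k x) + o.da k (o.d k x)))) := by
      rw [D_apply, D'_apply, Finset.sum_comm]
      exact Finset.sum_congr rfl fun k _ => by simp only [map_sum, Finset.sum_sub_distrib]
    rw [h2, h3, ← Finset.sum_add_distrib]
    refine Finset.sum_congr rfl fun k _ => ?_
    rw [← Finset.sum_add_distrib]
    exact Finset.sum_congr rfl fun l _ => h k l
  rw [h1, NF_apply]
  simp only [Finset.sum_ite_eq, Finset.mem_univ, if_true, Finset.sum_sub_distrib, num_apply,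
    Finset.sum_const, Finset.card_univ, Fintype.card_fin, Nat.cast_smul_eq_nsmul]
  abel

end Osc

variable {n : ℕ}

/-! ### The operators `ρ(f^±)` -/

/-- The vector corresponding to a one-form under the symplectic form. -/
def sharp : Module.Dual ℂ (V n) →ₗ[ℂ] V n where
  toFun ε := Sum.elim (fun k => ε (Pi.single (Sum.inr k) 1)) (fun k => -ε (Pi.single (Sum.inl k) 1))
  map_add' ε δ := by ext a; rcases a with k | k <;> simp; ring
  map_smul' c ε := by ext a; rcases a with k | k <;> simp

theorem flatF_sharp (ε : Module.Dual ℂ (V n)) : flatF (sharp ε) = ε := by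
  ext a
  rcases a with k | k <;> simp [flatF_apply, omega, sharp, Pi.single_apply]

theorem flatF_injective : Function.Injective (flatF (n := n)) := fun u v h => by
  ext a
  rcases a with k | k
  · have := LinearMap.congr_fun h (Pi.single (Sum.inr k) 1)
    simpa [flatF_apply, omega, Pi.single_apply] using this
  · have := LinearMap.congr_fun h (Pi.single (Sum.inl k) 1)
    simpa [flatF_apply, omega, Pi.single_apply] using this

theorem sharp_dualAct (ε : Module.Dual ℂ (V n)) (X : G n) :
    sharp (dualAct ε X) = actV X (sharp ε) := by
  refine flatF_injective (LinearMap.ext fun w => ?_)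
  rw [flatF_sharp, flatF_apply, omega_actV, ← flatF_apply (sharp ε), flatF_sharp]
  rfl

/-- The operator `ε ⊗ v ↦ (ε ∧ ·) ⊗ (v · )`. -/
def betaP : Module.Dual ℂ (V n) →ₗ[ℂ] V n →ₗ[ℂ] End ℂ (E n) :=
  LinearMap.mk₂ ℂ (fun ε v => TensorProduct.map (wedge ε) (cliff n v))
    (fun ε δ v => by rw [map_add, TensorProduct.map_add_left])
    (fun c ε v => by rw [map_smul, TensorProduct.map_smul_left])
    (fun ε u v => by rw [map_add, TensorProduct.map_add_right])
    (fun c ε v => by rw [map_smul, TensorProduct.map_smul_right])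

theorem betaP_apply (ε : Module.Dual ℂ (V n)) (v : V n) :
    betaP ε v = TensorProduct.map (wedge ε) (cliff n v) := rfl

/-- The operator `ε ⊗ v ↦ ι_v ⊗ (ε^♯ · )`. -/
def betaM : Module.Dual ℂ (V n) →ₗ[ℂ] V n →ₗ[ℂ] End ℂ (E n) :=
  LinearMap.mk₂ ℂ (fun ε v => TensorProduct.map (contract v) (cliff n (sharp ε)))
    (fun ε δ v => by rw [map_add, map_add, TensorProduct.map_add_right])
    (fun c ε v => by rw [map_smul, map_smul, TensorProduct.map_smul_right])
    (fun ε u v => by rw [contract_add, TensorProduct.map_add_left])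
    (fun c ε v => by rw [contract_smul, TensorProduct.map_smul_left])

theorem betaM_apply (ε : Module.Dual ℂ (V n)) (v : V n) :
    betaM ε v = TensorProduct.map (contract v) (cliff n (sharp ε)) := rfl

/-- `ρ(f^+)` is the image of the canonical element of `V^* ⊗ V`; the basis `e` does not matter. -/
theorem rhoFp_eq_sum (e : Module.Basis (Fin n ⊕ Fin n) ℂ (V n)) :
    rhoFp e = (I / 2) • ∑ a, betaP (LinearMap.proj a) (Pi.single a 1) :=
  congrArg ((I / 2) • ·) (sum_coord_eq betaP e)

/-- `ρ(f^-)` is the image of the canonical element of `V^* ⊗ V`; the symplectic basis `e` does not matter. -/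
theorem rhoFm_eq_sum {e : Module.Basis (Fin n ⊕ Fin n) ℂ (V n)} (he : IsSymplecticBasis e) :
    rhoFm e = (-(1 / 2) : ℂ) • ∑ a, betaM (LinearMap.proj a) (Pi.single a 1) := by
  have h (a) : ∑ b, omegaMat n a b • e b = -sharp (e.coord a) := by
    refine flatF_injective (e.ext fun c => ?_)
    have h1 : flatF (-sharp (e.coord a)) = -e.coord a := by
      refine LinearMap.ext fun w => ?_
      rw [← neg_one_smul ℂ (sharp _), flatF_apply, omega_smul_left, ← flatF_apply, flatF_sharp,
        neg_one_mul, LinearMap.neg_apply]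
    have h2 : flatF (∑ b, omegaMat n a b • e b) (e c) = (omegaMat n * omegaMat n) a c := by
      have h4 (w : V n) : flatF (∑ b, omegaMat n a b • e b) w =
          ∑ b, omegaMat n a b * omega n (e b) w := by
        simp only [flatF_apply, omega_swap _ w, ← flatV_dotProduct, dotProduct_sum,
          dotProduct_smul, smul_eq_mul, mul_neg, Finset.sum_neg_distrib]
      rw [h4, Matrix.mul_apply]
      exact Finset.sum_congr rfl fun b _ => by rw [he]
    have h3 : omegaMat n * omegaMat n = -1 := by
      simp [omegaMat, Matrix.fromBlocks_multiply, ← Matrix.fromBlocks_one, Matrix.fromBlocks_neg]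
    rw [h1, h2, h3]
    simp [Matrix.one_apply, Finsupp.single_apply, eq_comm]
  have h1 (a) : ∑ b, omegaMat n a b • TensorProduct.map (contract (e a)) (cliff n (e b)) =
      (-1 : ℂ) • betaM (e.coord a) (e a) := by
    have h5 := congrArg (cliff n) (h a)
    rw [map_neg, map_sum] at h5
    refine TensorProduct.ext' fun α s => ?_
    have h6 := LinearMap.congr_fun h5 s
    simp only [LinearMap.sum_apply, map_smul, LinearMap.smul_apply, LinearMap.neg_apply] at h6
    have h7 := congrArg (contract (e a) α ⊗ₜ[ℂ] ·) h6
    simp only [TensorProduct.tmul_sum, TensorProduct.tmul_smul, TensorProduct.tmul_neg] at h7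
    simp only [LinearMap.sum_apply, LinearMap.smul_apply, TensorProduct.map_tmul, betaM_apply,
      neg_one_smul, h7]
  have h2 : ∑ a, betaM (e.coord a) (e a) = ∑ a, betaM (LinearMap.proj a) (Pi.single a 1) :=
    sum_coord_eq betaM e
  rw [← h2, rhoFm]
  have h3 : ∑ a, ∑ b, omegaMat n a b • TensorProduct.map (contract (e a)) (cliff n (e b)) =
      (-1 : ℂ) • ∑ a, betaM (e.coord a) (e a) := by
    rw [Finset.smul_sum]
    exact Finset.sum_congr rfl fun a _ => h1 a
  rw [h3, smul_smul, mul_neg_one]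

/-- The canonical element of `V^* ⊗ V` in the basis `A_k, B_k`. -/
theorem sum_eq_sum_cov {M : Type*} [AddCommMonoid M] [Module ℂ M]
    (β : Module.Dual ℂ (V n) →ₗ[ℂ] V n →ₗ[ℂ] M) :
    ∑ a, β (LinearMap.proj a) (Pi.single a 1) =
      ∑ k, (β (cov (Sum.inl k)) (vA k) + β (cov (Sum.inr k)) (vB k)) := by
  rw [Fintype.sum_sum_type, ← Finset.sum_add_distrib]
  refine Finset.sum_congr rfl fun k _ => ?_
  have h1 : cov (Sum.inl k) = LinearMap.proj (Sum.inl k) + (-I) • LinearMap.proj (Sum.inr k) := by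
    rw [neg_smul, ← sub_eq_add_neg]; rfl
  have h2 : cov (Sum.inr k) = LinearMap.proj (Sum.inl k) + I • LinearMap.proj (Sum.inr k) := rfl
  rw [single_inl, single_inr, h1, h2]
  simp only [map_add, map_smul, LinearMap.add_apply, LinearMap.smul_apply]
  abel

theorem rhoFp_eq (e : Module.Basis (Fin n ⊕ Fin n) ℂ (V n)) :
    rhoFp e = (-(r2 / 4)) • (osc n).D' := by
  rw [rhoFp_eq_sum, show _ = _ from sum_eq_sum_cov betaP]
  refine TensorProduct.ext' fun α s => ?_
  simp only [LinearMap.smul_apply, LinearMap.sum_apply, LinearMap.add_apply, betaP_apply,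
    TensorProduct.map_tmul, cliff_vA, cliff_vB, Osc.D'_apply, osc_z, osc_d, osc_c,
    TensorProduct.tmul_smul, Finset.smul_sum]
  refine Finset.sum_congr rfl fun k _ => ?_
  match_scalars
  · linear_combination (r2 / 4) * I_sq
  · linear_combination -(r2 / 4) * I_sq

theorem sharp_cov_inl (k : Fin n) : sharp (cov (Sum.inl k)) = (-(2 * I)) • vB k := by
  refine flatF_injective (LinearMap.ext fun w => ?_)
  rw [flatF_sharp, flatF_apply, omega_smul_left, omega_vB']
  linear_combination (cov (Sum.inl k) w) * I_sq

theorem sharp_cov_inr (k : Fin n) : sharp (cov (Sum.inr k)) = (2 * I) • vA k := by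
  refine flatF_injective (LinearMap.ext fun w => ?_)
  rw [flatF_sharp, flatF_apply, omega_smul_left, omega_vA']
  linear_combination (cov (Sum.inr k) w) * I_sq

theorem rhoFm_eq {e : Module.Basis (Fin n ⊕ Fin n) ℂ (V n)} (he : IsSymplecticBasis e) :
    rhoFm e = (r2 / 2) • (osc n).D := by
  rw [rhoFm_eq_sum he, show _ = _ from sum_eq_sum_cov betaM]
  refine TensorProduct.ext' fun α s => ?_
  simp only [LinearMap.smul_apply, LinearMap.sum_apply, LinearMap.add_apply, betaM_apply,
    TensorProduct.map_tmul, cliff_vA, cliff_vB, Osc.D_apply, osc_z, osc_d, osc_dc, sharp_cov_inl,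
    sharp_cov_inr, map_smul, TensorProduct.tmul_smul, Finset.smul_sum, ← vA_eq, ← vB_eq]
  refine Finset.sum_congr rfl fun k _ => ?_
  match_scalars
  · linear_combination (-r2 / 2) * I_sq
  · linear_combination (-r2 / 2) * I_sq

/-- `ρ(f^+)` is built from the invariant element of `V^* ⊗ V` by equivariant operations. -/
theorem commute_sigmaE_rhoFp (X : G n) (e : Module.Basis (Fin n ⊕ Fin n) ℂ (V n)) :
    Commute (sigmaE n X) (rhoFp e) := by
  rw [rhoFp_eq_sum]
  refine Commute.smul_right ?_ _
  have h (ε : Module.Dual ℂ (V n)) (v : V n) : sigmaE n X * betaP ε v = betaP ε v * sigmaE n X +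
      (betaP (dualAct ε X) v + betaP ε (actV X v)) := by
    refine TensorProduct.ext' fun α s => ?_
    simp only [End.mul_apply, LinearMap.add_apply, betaP_apply, TensorProduct.map_tmul, sigmaE_tmul,
      actForms_wedge, sigmaS_cliff, TensorProduct.add_tmul, TensorProduct.tmul_add, map_add]
    abel
  rw [Commute, SemiconjBy, Finset.mul_sum, Finset.sum_mul]
  simp only [h]
  have h2 : ∑ a, (betaP (dualAct (LinearMap.proj a) X) (Pi.single a 1) +
      betaP (LinearMap.proj a) (actV X (Pi.single a 1))) = 0 := sum_coord_invariant betaP X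
  rw [Finset.sum_add_distrib, h2, add_zero]

/-- `ρ(f^-)` is built from the invariant element of `V^* ⊗ V` by equivariant operations. -/
theorem commute_sigmaE_rhoFm (X : G n) {e : Module.Basis (Fin n ⊕ Fin n) ℂ (V n)}
    (he : IsSymplecticBasis e) : Commute (sigmaE n X) (rhoFm e) := by
  rw [rhoFm_eq_sum he]
  refine Commute.smul_right ?_ _
  have h (ε : Module.Dual ℂ (V n)) (v : V n) : sigmaE n X * betaM ε v = betaM ε v * sigmaE n X +
      (betaM (dualAct ε X) v + betaM ε (actV X v)) := by
    refine TensorProduct.ext' fun α s => ?_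
    simp only [End.mul_apply, LinearMap.add_apply, betaM_apply, TensorProduct.map_tmul, sigmaE_tmul,
      actForms_contract, sigmaS_cliff, TensorProduct.add_tmul, TensorProduct.tmul_add, map_add,
      sharp_dualAct]
    abel
  rw [Commute, SemiconjBy, Finset.mul_sum, Finset.sum_mul]
  simp only [h]
  have h2 : ∑ a, (betaM (dualAct (LinearMap.proj a) X) (Pi.single a 1) +
      betaM (LinearMap.proj a) (actV X (Pi.single a 1))) = 0 := sum_coord_invariant betaM X
  rw [Finset.sum_add_distrib, h2, add_zero]

end

section

variable {n : ℕ}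

/-! ### The Fock space and the degree of forms -/

theorem tmul_mem_tensorSub {A : Submodule ℂ (Forms n)} {B : Submodule ℂ (S n)} {α : Forms n} {s : S n}
    (hα : α ∈ A) (hs : s ∈ B) : α ⊗ₜ[ℂ] s ∈ tensorSub A B :=
  ⟨(⟨α, hα⟩ : A) ⊗ₜ[ℂ] (⟨s, hs⟩ : B), rfl⟩

theorem tensorSub_le {A : Submodule ℂ (Forms n)} {B : Submodule ℂ (S n)} {p : Submodule ℂ (E n)}
    (h : ∀ α ∈ A, ∀ s ∈ B, α ⊗ₜ[ℂ] s ∈ p) : tensorSub A B ≤ p := by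
  rintro _ ⟨t, rfl⟩
  induction t using TensorProduct.induction_on with
  | zero => rw [map_zero]; exact p.zero_mem
  | tmul α s => exact h α α.2 s s.2
  | add x y hx hy => rw [map_add]; exact p.add_mem hx hy

theorem tensorSub_mono {A A' : Submodule ℂ (Forms n)} {B B' : Submodule ℂ (S n)} (hA : A ≤ A')
    (hB : B ≤ B') : tensorSub A B ≤ tensorSub A' B' :=
  tensorSub_le fun _ hα _ hs => tmul_mem_tensorSub (hA hα) (hB hs)

theorem map_mem_tensorSub {A A' : Submodule ℂ (Forms n)} {B B' : Submodule ℂ (S n)}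
    {f : End ℂ (Forms n)} {g : End ℂ (S n)} (hf : ∀ α ∈ A, f α ∈ A') (hg : ∀ s ∈ B, g s ∈ B')
    {x : E n} (hx : x ∈ tensorSub A B) : TensorProduct.map f g x ∈ tensorSub A' B' := by
  have : tensorSub A B ≤ (tensorSub A' B').comap (TensorProduct.map f g) :=
    tensorSub_le fun α hα s hs => tmul_mem_tensorSub (hf α hα) (hg s hs)
  exact this hx

/-- The expansion of a covector in the basis dual to `A_k, B_k`. -/
theorem dual_eq_sum_cov (ε : Module.Dual ℂ (V n)) : ε = ∑ r, ε (vAB r) • cov r := by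
  refine LinearMap.ext fun v => ?_
  conv_lhs => rw [eq_sum v]
  rw [LinearMap.sum_apply, Fintype.sum_sum_type, ← Finset.sum_add_distrib, map_sum]
  refine Finset.sum_congr rfl fun k _ => ?_
  rw [map_add, map_smul, map_smul]
  simp only [LinearMap.smul_apply, smul_eq_mul, cov_inl, cov_inr, ← vA_eq, ← vB_eq]
  ring

theorem mulX_eq (k : Fin n) (s : S n) :
    mulX k s = (r2 / 2 * rt⁻¹) • (zS k s + dS k s) := by
  have h1 : cliff n (Pi.single (Sum.inr k) 1) s = rt • mulX k s := by
    rw [cliff_apply, derV_apply, mulV_apply]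
    simp [Pi.single_apply]
  have h2 : rt • mulX k s = (r2 / 2) • (zS k s + dS k s) := by
    rw [← h1, single_inr, map_add, map_smul, map_smul, LinearMap.add_apply, LinearMap.smul_apply,
      LinearMap.smul_apply, cliff_vA, cliff_vB]
    match_scalars
    · linear_combination -(r2 / 2) * I_sq
    · linear_combination -(r2 / 2) * I_sq
  rw [mul_comm, ← smul_smul, ← h2, smul_smul, inv_mul_cancel₀ rt_ne, one_smul]

/-- `E_K` is the Fock space: multiplication by `x_k` is a multiple of `z_k + d_k`, and the `cov r`
span `V^*`. -/
theorem fock_eq_EK (n : ℕ) : (osc n).fock (vac n) = EK n := by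
  refine le_antisymm ?_ ?_
  · refine Osc.fock_le (tmul_mem_tensorSub trivial gauss_mem_SK) (fun k x hx => ?_)
      fun r x hx => ?_
    · exact map_mem_tensorSub (fun α h => h)
        (fun s hs => Submodule.smul_mem _ _ (cliff_mem_SK _ hs)) hx
    · exact map_mem_tensorSub (A' := ⊤) (f := wedge (cov r)) (g := LinearMap.id)
        (fun α _ => Submodule.mem_top) (fun s hs => hs) hx
  · have h1 : SK n ≤ ((osc n).fock (vac n)).comap (TensorProduct.mk ℂ (Forms n) (S n) 1) := by
      refine SK_le Osc.vac_mem_fock fun k s hs => ?_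
      rw [mulX_eq]
      refine Submodule.smul_mem _ _ (add_mem ?_ ?_)
      · exact Osc.z_mem_fock k (x := 1 ⊗ₜ s) hs
      · exact Osc.d_mem_fock (vacuum n) k (x := 1 ⊗ₜ s) hs
    refine tensorSub_le fun α hα s hs => ?_
    clear hα
    induction α using forms_induction with
    | h1 => exact h1 hs
    | hs c α h => rw [← TensorProduct.smul_tmul']; exact Submodule.smul_mem _ _ h
    | ha α β h h' => rw [TensorProduct.add_tmul]; exact add_mem h h'
    | hw ε α h =>
      rw [dual_eq_sum_cov ε, map_sum, LinearMap.sum_apply, TensorProduct.sum_tmul]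
      refine sum_mem fun r _ => ?_
      rw [map_smul, LinearMap.smul_apply, ← TensorProduct.smul_tmul']
      exact Submodule.smul_mem _ _ (Osc.c_mem_fock r h)

theorem wedge_mem_exteriorPower {k : ℕ} (ε : Module.Dual ℂ (V n)) {α : Forms n}
    (hα : α ∈ ⋀[ℂ]^k (Module.Dual ℂ (V n))) : wedge ε α ∈ ⋀[ℂ]^(k + 1) (Module.Dual ℂ (V n)) := by
  change _ ∈ LinearMap.range (ExteriorAlgebra.ι ℂ) ^ (k + 1)
  rw [pow_succ']
  exact Submodule.mul_mem_mul (LinearMap.mem_range_self _ _) hα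

theorem iSup_exteriorPower (n : ℕ) : ⨆ k, ⋀[ℂ]^k (Module.Dual ℂ (V n)) = ⊤ := by
  refine (Submodule.eq_top_iff').mpr fun α => ?_
  induction α using forms_induction with
  | h1 => exact Submodule.mem_iSup_of_mem 0 (by
      change _ ∈ LinearMap.range (ExteriorAlgebra.ι ℂ) ^ 0
      rw [pow_zero]; exact Submodule.one_le.mp le_rfl)
  | hs c α h => exact Submodule.smul_mem _ _ h
  | ha α β h h' => exact add_mem h h'
  | hw ε α h =>
    induction h using Submodule.iSup_induction' with
    | mem k α h => exact Submodule.mem_iSup_of_mem (k + 1) (wedge_mem_exteriorPower ε h)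
    | zero => rw [map_zero]; exact zero_mem _
    | add x y _ _ h h' => rw [map_add]; exact add_mem h h'

/-- The number operator on forms is the degree. -/
theorem sum_wedge_contract {k : ℕ} {α : Forms n} (hα : α ∈ ⋀[ℂ]^k (Module.Dual ℂ (V n))) :
    ∑ r, wedge (cov r) (contract (vAB r) α) = (k : ℂ) • α := by
  induction hα using Submodule.pow_induction_on_left' with
  | algebraMap r =>
    simp [Algebra.algebraMap_eq_smul_one, contract_one]
  | add x y i _ _ h h' => simp only [map_add, Finset.sum_add_distrib, h, h', smul_add]
  | mem_mul m hm i x hx h =>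
    obtain ⟨ε, rfl⟩ := hm
    change ∑ r, wedge (cov r) (contract (vAB r) (wedge ε x)) = _ • wedge ε x
    have h1 (r) : wedge (cov r) (contract (vAB r) (wedge ε x)) =
        wedge (ε (vAB r) • cov r) x + wedge ε (wedge (cov r) (contract (vAB r) x)) := by
      rw [contract_wedge, map_sub, map_smul, wedge_wedge (cov r), sub_neg_eq_add, map_smul,
        LinearMap.smul_apply]
    simp only [h1, Finset.sum_add_distrib]
    rw [← LinearMap.sum_apply, ← map_sum, ← dual_eq_sum_cov, ← map_sum, h, map_smul]
    push_cast
    module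

theorem tensorSub_le_eigenspace (k : ℕ) : tensorSub (⋀[ℂ]^k (Module.Dual ℂ (V n))) ⊤ ≤
    End.eigenspace (osc n).NF (k : ℂ) := by
  refine tensorSub_le fun α hα s _ => End.mem_eigenspace_iff.mpr ?_
  have : (osc n).NF (α ⊗ₜ s) = (∑ r, wedge (cov r) (contract (vAB r) α)) ⊗ₜ s := by
    rw [Osc.NF, LinearMap.sum_apply, TensorProduct.sum_tmul]
    rfl
  rw [this, sum_wedge_contract hα, TensorProduct.smul_tmul']

theorem tensorSub_top_le (B : Submodule ℂ (S n)) :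
    tensorSub ⊤ B ≤ ⨆ k, tensorSub (⋀[ℂ]^k (Module.Dual ℂ (V n))) B := by
  refine tensorSub_le fun α hα' s hs => ?_
  clear hα'
  have hα : α ∈ ⨆ k, ⋀[ℂ]^k (Module.Dual ℂ (V n)) := by rw [iSup_exteriorPower]; trivial
  induction hα using Submodule.iSup_induction' with
  | mem k α h => exact Submodule.mem_iSup_of_mem k (tmul_mem_tensorSub h hs)
  | zero => rw [TensorProduct.zero_tmul]; exact zero_mem _
  | add x y _ _ h h' => rw [TensorProduct.add_tmul]; exact add_mem h h'

theorem iSup_tensorSub (n : ℕ) : ⨆ k, tensorSub (⋀[ℂ]^k (Module.Dual ℂ (V n))) ⊤ = ⊤ := by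
  rw [eq_top_iff]
  refine le_trans ?_ (tensorSub_top_le ⊤)
  rintro x -
  induction x using TensorProduct.induction_on with
  | zero => exact zero_mem _
  | tmul α s => exact tmul_mem_tensorSub trivial trivial
  | add x y hx hy => exact add_mem hx hy

/-- The eigenspaces of the fermion number operator are the spaces of forms of a given degree. -/
theorem eigenspace_NF (k : ℕ) :
    End.eigenspace (osc n).NF (k : ℂ) = tensorSub (⋀[ℂ]^k (Module.Dual ℂ (V n))) ⊤ := by
  refine le_antisymm (fun x hx => ?_) (tensorSub_le_eigenspace k)
  have h1 : x ∈ tensorSub (⋀[ℂ]^k (Module.Dual ℂ (V n))) ⊤ ⊔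
      ⨆ j : {j : ℕ // j ≠ k}, End.eigenspace (osc n).NF (j : ℂ) := by
    have h2 : ⨆ k, tensorSub (⋀[ℂ]^k (Module.Dual ℂ (V n))) ⊤ ≤
        tensorSub (⋀[ℂ]^k (Module.Dual ℂ (V n))) ⊤ ⊔
        ⨆ j : {j : ℕ // j ≠ k}, End.eigenspace (osc n).NF (j : ℂ) := by
      refine iSup_le fun j => ?_
      by_cases hj : j = k
      · rw [hj]; exact le_sup_left
      · exact (tensorSub_le_eigenspace j).trans
          (le_sup_of_le_right (le_iSup (fun j : {j : ℕ // j ≠ k} =>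
            End.eigenspace (osc n).NF (j : ℂ)) ⟨j, hj⟩))
    exact h2 (by rw [iSup_tensorSub]; trivial)
  obtain ⟨y, hy, z, hz, rfl⟩ := Submodule.mem_sup.mp h1
  have hz' := (Submodule.add_mem_iff_right _ (tensorSub_le_eigenspace k hy)).mp hx
  by_cases h0 : z = 0
  · rwa [h0, add_zero]
  · obtain ⟨j, hj⟩ := exists_eq_of_mem_iSup_eigenspace _ _ hz h0 (End.mem_eigenspace_iff.mp hz')
    exact absurd (Nat.cast_injective hj).symm j.2

theorem iSup_eigenspace_NF (n : ℕ) : ⨆ k : ℕ, End.eigenspace (osc n).NF (k : ℂ) = ⊤ := by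
  simp only [eigenspace_NF, iSup_tensorSub]

/-- Forms of degree `k` with values in even or odd functions. -/
theorem tensorSub_Spar (k : ℕ) (p : Fin 2) : tensorSub (⋀[ℂ]^k (Module.Dual ℂ (V n))) (Spar n p) =
    End.eigenspace (parE n) ((-1) ^ (p : ℕ)) ⊓ End.eigenspace (osc n).NF (k : ℂ) := by
  refine le_antisymm (le_inf ?_ ?_) ?_
  · refine tensorSub_le fun α _ s hs => End.mem_eigenspace_iff.mpr ?_
    rw [parE, onS_tmul, mem_Spar.mp hs, TensorProduct.tmul_smul]
  · rw [eigenspace_NF]; exact tensorSub_mono le_rfl le_top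
  · rintro x ⟨hx, hx'⟩
    rw [eigenspace_NF] at hx'
    have hx2 : parE n x = (-1 : ℂ) ^ (p : ℕ) • x := End.mem_eigenspace_iff.mp hx
    have hp : (-1 : ℂ) ^ (p : ℕ) * (-1) ^ (p : ℕ) = 1 := by
      rw [← mul_pow]; simp
    have h1 : TensorProduct.map LinearMap.id ((2⁻¹ : ℂ) • (1 + (-1 : ℂ) ^ (p : ℕ) • refl n)) x = x := by
      have h2 : (TensorProduct.map LinearMap.id ((2⁻¹ : ℂ) • (1 + (-1 : ℂ) ^ (p : ℕ) • refl n)) :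
          End ℂ (E n)) = (2⁻¹ : ℂ) • (1 + (-1 : ℂ) ^ (p : ℕ) • parE n) := by
        refine TensorProduct.ext' fun α s => ?_
        simp only [TensorProduct.map_tmul, LinearMap.smul_apply, LinearMap.add_apply,
          End.one_apply, TensorProduct.tmul_smul, TensorProduct.tmul_add, parE, onS_tmul,
          LinearMap.id_apply]
      rw [h2, LinearMap.smul_apply, LinearMap.add_apply, LinearMap.smul_apply, hx2, smul_smul, hp,
        End.one_apply, one_smul, ← two_smul ℂ x, smul_smul]
      norm_num
    rw [← h1]
    refine map_mem_tensorSub (fun α h => h) (fun s _ => mem_Spar.mpr ?_) hx'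
    simp only [LinearMap.smul_apply, LinearMap.add_apply, End.one_apply, map_smul, map_add,
      refl_refl]
    match_scalars
    · linear_combination -(2⁻¹ : ℂ) * hp
    · ring

theorem eq_zero_of_NF {k : ℕ} (hk : 2 * n < k) {x : E n} (hx : (osc n).NF x = (k : ℂ) • x) :
    x = 0 := by
  refine eq_zero_of_smul_add_sum_idem (fun r => (osc n).hole r) (fun r x => (osc n).hole_idem r x)
    (fun r s x => (osc n).hole_comm r s x) Finset.univ (k - 2 * n) (by omega) x ?_
  have h1 : ∑ r, (osc n).hole r x = (2 * n : ℂ) • x - (osc n).NF x := by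
    simp only [Osc.hole_eq, Finset.sum_sub_distrib, Osc.NF, LinearMap.sum_apply, Finset.sum_const,
      Finset.card_univ, Fintype.card_sum, Fintype.card_fin, ← Nat.cast_smul_eq_nsmul ℂ]
    push_cast
    rw [two_mul]
  rw [h1, hx, Nat.cast_sub hk.le]
  push_cast
  module

theorem gradeE_eq (p : ZMod 2) :
    gradeE n p = ⨆ (k : ℕ) (_ : (k : ZMod 2) = p), End.eigenspace (osc n).NF (k : ℂ) := by
  simp only [gradeE, eigenspace_NF]

/-! ### The contravariant form -/

/-- The map `V^* → V` that exchanges the coordinate functions of `q_k` and `p_k` with the basis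
vectors `p_k` and `q_k`. -/
def theta (ε : Module.Dual ℂ (V n)) : V n := fun a => ε (Pi.single a.swap 1)

theorem theta_apply (ε : Module.Dual ℂ (V n)) (a) : theta ε a = ε (Pi.single a.swap 1) := rfl

/-- The inverse of `theta`. -/
def eta (v : V n) : Module.Dual ℂ (V n) := ∑ a, v a • LinearMap.proj a.swap

theorem eta_apply (v w : V n) : eta v w = ∑ a, v a * w a.swap := by
  simp only [eta, LinearMap.sum_apply, LinearMap.smul_apply, LinearMap.proj_apply, smul_eq_mul]

theorem eta_theta (v : V n) (ε : Module.Dual ℂ (V n)) : eta v (theta ε) = ε v := by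
  conv_rhs => rw [pi_eq_sum_univ' v, map_sum]
  rw [eta_apply]
  simp only [theta_apply, Sum.swap_swap, map_smul, smul_eq_mul]

/-- The antihomomorphism that maps the exterior multiplication by `ε` to the contraction by
`theta ε`. -/
def contractHom (n : ℕ) : Forms n →ₐ[ℂ] (End ℂ (Forms n))ᵐᵒᵖ :=
  ExteriorAlgebra.lift ℂ ⟨
    { toFun := fun ε => MulOpposite.op (contract (theta ε))
      map_add' := fun ε δ => by
        rw [← MulOpposite.op_add, ← contract_add]; rfl
      map_smul' := fun c ε => by
        rw [RingHom.id_apply, ← MulOpposite.op_smul, ← contract_smul]; rfl },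
    fun ε => by
      change MulOpposite.op (contract (theta ε) * contract (theta ε)) = 0
      rw [MulOpposite.op_eq_zero_iff]
      exact LinearMap.ext fun α => CliffordAlgebra.contractLeft_contractLeft _ _⟩

theorem contractHom_wedge (ε : Module.Dual ℂ (V n)) (α β : Forms n) :
    (contractHom n (wedge ε α)).unop β = (contractHom n α).unop (contract (theta ε) β) := by
  rw [wedge_apply, map_mul, MulOpposite.unop_mul, contractHom, ExteriorAlgebra.lift_ι_apply]
  rfl

/-- The bilinear form on exterior forms for which the exterior multiplication by `ε` is adjoint to
the contraction by `theta ε`. -/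
def formF (n : ℕ) : Forms n →ₗ[ℂ] Forms n →ₗ[ℂ] ℂ :=
  LinearMap.mk₂ ℂ (fun α β => ExteriorAlgebra.algebraMapInv ((contractHom n α).unop β))
    (fun α α' β => by rw [map_add, MulOpposite.unop_add, LinearMap.add_apply, map_add])
    (fun c α β => by rw [map_smul, MulOpposite.unop_smul, LinearMap.smul_apply, map_smul])
    (fun α β β' => by rw [map_add, map_add])
    (fun c α β => by rw [map_smul, map_smul])

theorem formF_wedge (ε : Module.Dual ℂ (V n)) (α β : Forms n) :
    formF n (wedge ε α) β = formF n α (contract (theta ε) β) := by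
  change ExteriorAlgebra.algebraMapInv _ = ExteriorAlgebra.algebraMapInv _
  rw [contractHom_wedge]

theorem formF_one_left (β : Forms n) : formF n 1 β = ExteriorAlgebra.algebraMapInv β := by
  change ExteriorAlgebra.algebraMapInv _ = ExteriorAlgebra.algebraMapInv _
  rw [map_one, MulOpposite.unop_one, End.one_apply]

theorem formF_contract (v : V n) (α β : Forms n) :
    formF n (contract v α) β = formF n α (wedge (eta v) β) := by
  induction α using forms_induction generalizing β with
  | h1 =>
    rw [contract_one, map_zero, LinearMap.zero_apply, formF_one_left, wedge_apply, map_mul]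
    simp [ExteriorAlgebra.algebraMapInv]
  | hs c α h => simp only [map_smul, LinearMap.smul_apply, h]
  | ha α α' h h' => simp only [map_add, LinearMap.add_apply, h, h']
  | hw ε α h =>
    simp only [contract_wedge, map_sub, map_smul, LinearMap.sub_apply, LinearMap.smul_apply,
      formF_wedge, h, eta_theta]

/-- The contravariant form on `E`. -/
def formE (n : ℕ) : E n →ₗ[ℂ] E n →ₗ[ℂ] ℂ := LinearMap.BilinForm.tmul (formF n) (formS n)

theorem formE_tmul (α β : Forms n) (s t : S n) :
    formE n (α ⊗ₜ s) (β ⊗ₜ t) = formF n α β * formS n s t := by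
  simp [formE, mul_comm]

/-- The reflection `q_k ↦ -q_k`, `p_k ↦ p_k`. -/
def kap (v : V n) : V n := Sum.elim (fun k => -v (Sum.inl k)) (fun k => v (Sum.inr k))

theorem formS_cliff (v : V n) (s t : S n) : formS n (cliff n v s) t = formS n s (cliff n (kap v) t) := by
  have h1 : derV (kap v) t = -derV v t := by
    simp [derV_apply, kap, neg_smul, Finset.sum_neg_distrib]
  have h2 : mulV (kap v) t = mulV v t := by simp [mulV_apply, kap]
  rw [cliff_apply, cliff_apply, h1, h2]
  simp only [derV_apply, mulV_apply, map_add, map_smul, map_sum, map_neg, LinearMap.add_apply,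
    LinearMap.smul_apply, LinearMap.sum_apply, formS_mulX, formS_derX, smul_neg,
    Finset.sum_neg_distrib]

theorem eta_kap (u : V n) : flatF (kap u) = -eta u := by
  refine LinearMap.ext fun w => ?_
  rw [flatF_apply, LinearMap.neg_apply, eta_apply, Fintype.sum_sum_type, ← Finset.sum_add_distrib,
    ← Finset.sum_neg_distrib, omega]
  refine Finset.sum_congr rfl fun k _ => ?_
  simp only [kap, Sum.elim_inl, Sum.elim_inr, Sum.swap_inl, Sum.swap_inr]
  ring

theorem theta_flatF (v : V n) : theta (flatF v) = -kap v := by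
  ext a
  rcases a with k | k <;> simp [theta_apply, flatF_apply, omega, kap, Pi.single_apply]

theorem form_ext {f g : End ℂ (E n)}
    (h : ∀ α s β t, formE n (f (α ⊗ₜ s)) (β ⊗ₜ t) = formE n (α ⊗ₜ s) (g (β ⊗ₜ t))) (x y : E n) :
    formE n (f x) y = formE n x (g y) := by
  have h1 : formE n ∘ₗ f = (formE n).compl₂ g := TensorProduct.ext' fun α s =>
    TensorProduct.ext' fun β t => h α s β t
  exact LinearMap.congr_fun (LinearMap.congr_fun h1 x) y

theorem formE_sigmaE_T (u v : V n) (x y : E n) :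
    formE n (sigmaE n (T u v) x) y = formE n x (sigmaE n (T (kap u) (kap v)) y) := by
  refine form_ext (fun α s β t => ?_) x y
  have hn (v : V n) (α : Forms n) : contract (-v) α = -contract v α := by
    rw [← neg_one_smul ℂ v, contract_smul, LinearMap.smul_apply, neg_one_smul]
  simp only [sigmaE_T_tmul, map_add, map_sub, map_neg, map_smul, LinearMap.add_apply,
    LinearMap.sub_apply, LinearMap.neg_apply, LinearMap.smul_apply, formE_tmul, formF_wedge,
    formF_contract, formS_cliff, eta_kap, theta_flatF, hn, smul_eq_mul]
  ring

/-- The form `formE` is contravariant for the action of `sp(2n)`. -/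
theorem exists_formE_adjoint (X : G n) :
    ∃ X' : G n, ∀ x y, formE n (sigmaE n X x) y = formE n x (sigmaE n X' y) := by
  let p : Submodule ℂ (G n) :=
    { carrier := {X | ∃ X' : G n, ∀ x y, formE n (sigmaE n X x) y = formE n x (sigmaE n X' y)}
      add_mem' := by
        rintro X Y ⟨X', hX⟩ ⟨Y', hY⟩
        refine ⟨X' + Y', fun x y => ?_⟩
        simp only [← sigmaHom_apply, map_add, LinearMap.add_apply] at *
        rw [hX, hY]
      zero_mem' := ⟨0, fun x y => by
        simp only [← sigmaHom_apply, map_zero, LinearMap.zero_apply]⟩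
      smul_mem' := by
        rintro c X ⟨X', hX⟩
        refine ⟨c • X', fun x y => ?_⟩
        simp only [← sigmaHom_apply, map_smul, LinearMap.smul_apply] at *
        rw [hX] }
  exact mem_of_T_mem (p := p) (fun u v => ⟨_, formE_sigmaE_T u v⟩) X

theorem kap_vA (k : Fin n) : kap (vA k) = -vB k := by
  ext a
  rcases a with a | a <;> simp [kap, vA, vB, Pi.single_apply]

theorem kap_vB (k : Fin n) : kap (vB k) = -vA k := by
  ext a
  rcases a with a | a <;> simp [kap, vA, vB, Pi.single_apply]

theorem theta_cov_inl (k : Fin n) : theta (cov (Sum.inl k)) = (-(2 * I)) • vA k := by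
  ext a
  rcases a with a | a <;> rcases eq_or_ne a k with rfl | h
  · simp [theta_apply, cov_inl, vA]
    ring
  · simp [theta_apply, cov_inl, vA, h, h.symm]
  · simp [theta_apply, cov_inl, vA]
    linear_combination I_sq
  · simp [theta_apply, cov_inl, vA, h, h.symm]

theorem theta_cov_inr (k : Fin n) : theta (cov (Sum.inr k)) = (2 * I) • vB k := by
  ext a
  rcases a with a | a <;> rcases eq_or_ne a k with rfl | h
  · simp [theta_apply, cov_inr, vB]
    ring
  · simp [theta_apply, cov_inr, vB, h, h.symm]
  · simp [theta_apply, cov_inr, vB]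
    linear_combination I_sq
  · simp [theta_apply, cov_inr, vB, h, h.symm]

theorem eta_vA (k : Fin n) : eta (vA k) = (I / 2) • cov (Sum.inl k) := by
  refine LinearMap.ext fun w => ?_
  rw [eta_apply, Fintype.sum_sum_type]
  simp [cov_inl, vA, Pi.single_apply]
  linear_combination (w (Sum.inr k) / 2) * I_sq

theorem eta_vB (k : Fin n) : eta (vB k) = (-(I / 2)) • cov (Sum.inr k) := by
  refine LinearMap.ext fun w => ?_
  rw [eta_apply, Fintype.sum_sum_type]
  simp [cov_inr, vB, Pi.single_apply]
  linear_combination (w (Sum.inr k) / 2) * I_sq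

theorem isForm (n : ℕ) : (osc n).IsForm (formE n) where
  z k := form_ext fun α s β t => by
    simp [osc_z, osc_d, formE_tmul, zS_apply, dS_apply, formS_cliff, kap_vA]
    ring
  d k := form_ext fun α s β t => by
    simp [osc_z, osc_d, formE_tmul, zS_apply, dS_apply, formS_cliff, kap_vB]
    ring
  a k x y := by
    refine (form_ext (f := (osc n).a k) (g := (-(2 * I)) • (osc n).da k) (fun α s β t => ?_) x y).trans
      (by simp)
    simp [Osc.a, Osc.da, osc_c, osc_dc, formE_tmul, formF_wedge, theta_cov_inl, contract_smul, vAB,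
      -neg_smul]
    ring
  b k x y := by
    refine (form_ext (f := (osc n).b k) (g := (2 * I) • (osc n).db k) (fun α s β t => ?_) x y).trans
      (by simp)
    simp [Osc.b, Osc.db, osc_c, osc_dc, formE_tmul, formF_wedge, theta_cov_inr, contract_smul, vAB]
    ring
  da k x y := by
    refine (form_ext (f := (osc n).da k) (g := (I / 2) • (osc n).a k) (fun α s β t => ?_) x y).trans
      (by simp)
    simp [Osc.a, Osc.da, osc_c, osc_dc, formE_tmul, formF_contract, eta_vA, vAB]
    ring
  db k x y := by
    refine (form_ext (f := (osc n).db k) (g := (-(I / 2)) • (osc n).b k) (fun α s β t => ?_) x y).trans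
      (by simp)
    simp [Osc.b, Osc.db, osc_c, osc_dc, formE_tmul, formF_contract, eta_vB, vAB]
    ring

theorem formE_vac : formE n (vac n) (vac n) ≠ 0 := by
  rw [vac, formE_tmul, formF_one_left, map_one, one_mul]
  exact formS_gauss

end

section

/-! ### Representations of `osp(1|2)` from a pair of odd operators -/

/-- Operators `f` and `g` that raise and lower the degree `d` by one and whose anticommutator is
`(d - c) / 4`. They generate a representation of `osp(1|2)`. -/
structure OspPair {M : Type*} [AddCommGroup M] [Module ℂ M] (c : ℂ) (f g d : End ℂ M) : Prop where
  anti : ∀ x, g (f x) = (1 / 4 : ℂ) • (d x - c • x) - f (g x)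
  deg_f : ∀ x, d (f x) = f (d x) + f x
  deg_g : ∀ x, d (g x) = g (d x) - g x

open OspGen

theorem ospLift_gen {M : Type*} [AddCommGroup M] [Module ℂ M] (r : OspGen → End ℂ M) (a : OspGen) :
    ospLift r (gen a) = r a := by
  rw [ospLift, gen, ← Pi.basisFun_apply, Module.Basis.constr_basis]

namespace OspPair

variable {M : Type*} [AddCommGroup M] [Module ℂ M] {c : ℂ} {f g d : End ℂ M}

/-- In a representation of `osp(1|2)`, half the commutator of `e^+` and `e^-` is `2 {f^+, f^-}`. -/
theorem half_commutator (h : OspPair c f g d) :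
    (1 / 2 : ℂ) • (((2 : ℂ) • SympHowe.anti f f) * (-((2 : ℂ) • SympHowe.anti g g)) -
      (-((2 : ℂ) • SympHowe.anti g g)) * ((2 : ℂ) • SympHowe.anti f f)) = (2 : ℂ) • SympHowe.anti f g := by
  refine LinearMap.ext fun x => ?_
  simp only [SympHowe.anti, LinearMap.smul_apply, LinearMap.add_apply, LinearMap.sub_apply,
    LinearMap.neg_apply, End.mul_apply, map_smul, map_add, map_sub, map_neg, h.anti, h.deg_f,
    h.deg_g]
  module

/-- The brackets follow from the anticommutator of `f` and `g`, which makes `2 {f, g}` the grading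
operator `(d - c) / 2`. -/
theorem isOspRep (h : OspPair c f g d) {gr : ZMod 2 → Submodule ℂ M} (hgr : IsCompl (gr 0) (gr 1))
    (hf : ∀ p, ∀ m ∈ gr p, f m ∈ gr (p + 1)) (hg : ∀ p, ∀ m ∈ gr p, g m ∈ gr (p + 1))
    {r : OspGen → End ℂ M} (hP : r eP = (2 : ℂ) • SympHowe.anti f f)
    (hM : r eM = -((2 : ℂ) • SympHowe.anti g g)) (h0' : r h0 = (2 : ℂ) • SympHowe.anti f g)
    (hfP : r fP = f) (hfM : r fM = g) : IsOspRep gr (ospLift r) where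
  isCompl := hgr
  parity a p m hm := by
    have hff (k l : End ℂ M) (hk : ∀ p, ∀ m ∈ gr p, k m ∈ gr (p + 1))
        (hl : ∀ p, ∀ m ∈ gr p, l m ∈ gr (p + 1)) : SympHowe.anti k l m ∈ gr p := by
      have h2 : p = p + 1 + 1 := by rw [add_assoc, CharTwo.add_self_eq_zero, add_zero]
      have h3 := hk _ _ (hl p m hm)
      have h4 := hl _ _ (hk p m hm)
      rw [← h2] at h3 h4
      exact add_mem h3 h4
    rw [ospLift_gen]
    cases a
    · simpa [ospParity, hP] using (gr p).smul_mem 2 (hff f f hf hf)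
    · simpa [ospParity, hM] using (gr p).smul_mem 2 (hff g g hg hg)
    · simpa [ospParity, h0'] using (gr p).smul_mem 2 (hff f g hf hg)
    · simpa [ospParity, hfP] using hf p m hm
    · simpa [ospParity, hfM] using hg p m hm
  bracket a b := by
    refine LinearMap.ext fun x => ?_
    cases a <;> cases b <;>
    simp only [ospBracket, ospParity, mul_zero, mul_one, pow_zero, pow_one, map_neg,
      map_smul, map_zero, ospLift_gen, hP, hM, h0', hfP, hfM, SympHowe.anti, LinearMap.smul_apply,
      LinearMap.add_apply, LinearMap.sub_apply, LinearMap.neg_apply, LinearMap.zero_apply,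
      End.mul_apply, map_add, map_sub, h.anti, h.deg_f, h.deg_g] <;> module

end OspPair

variable {n : ℕ}

theorem Osc.NF_d {M : Type*} [AddCommGroup M] [Module ℂ M] (o : Osc n M) (k) (x : M) :
    o.NF (o.d k x) = o.d k (o.NF x) := by
  simp only [Osc.NF, LinearMap.sum_apply, map_sum, Osc.num_apply, o.d_c, o.ddc]

theorem Osc.NF_dc {M : Type*} [AddCommGroup M] [Module ℂ M] (o : Osc n M) (r) (x : M) :
    o.NF (o.dc r x) = o.dc r (o.NF x) - o.dc r x := by
  have h (s) : o.num s (o.dc r x) = o.dc r (o.num s x) - if r = s then o.dc r x else 0 := by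
    rw [Osc.num_apply, Osc.num_apply, o.dcc, o.dcdc s r]
    by_cases h : r = s
    · subst h; simp
    · simp [h]
  simp only [Osc.NF, LinearMap.sum_apply, h, Finset.sum_sub_distrib, map_sum, Finset.sum_ite_eq,
    Finset.mem_univ, if_true]

/-- The anticommutator of `ρ(f^+)` and `ρ(f^-)` is `(deg - n) / 4`, by `D_D'`. -/
theorem ospPair_rho {e : Module.Basis (Fin n ⊕ Fin n) ℂ (V n)} (he : IsSymplecticBasis e) :
    OspPair (n : ℂ) (rhoFp e) (rhoFm e) (osc n).NF where
  anti x := by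
    rw [rhoFp_eq, rhoFm_eq he]
    have h : (osc n).D ((osc n).D' x) = _ := eq_sub_of_add_eq ((osc n).D_D' x)
    simp only [LinearMap.smul_apply, map_smul, smul_smul, h]
    match_scalars
    · linear_combination (-(n : ℂ) / 8) * r2_sq
    · linear_combination (1 / 8) * r2_sq
    · ring
  deg_f x := by
    rw [rhoFp_eq]
    simp only [LinearMap.smul_apply, map_smul, ← smul_add]
    congr 1
    simp only [Osc.D'_apply, map_sum, map_sub, ← Finset.sum_add_distrib, Osc.a, Osc.b, Osc.NF_c,
      Osc.NF_z, Osc.NF_d]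
    exact Finset.sum_congr rfl fun k _ => by abel
  deg_g x := by
    rw [rhoFm_eq he]
    simp only [LinearMap.smul_apply, map_smul, ← smul_sub]
    congr 1
    simp only [Osc.D_apply, map_sum, map_add, ← Finset.sum_sub_distrib, Osc.da, Osc.db, Osc.NF_dc,
      Osc.NF_z, Osc.NF_d]
    exact Finset.sum_congr rfl fun k _ => by abel

theorem commute_sigmaE_rho (X : G n) {e : Module.Basis (Fin n ⊕ Fin n) ℂ (V n)}
    (he : IsSymplecticBasis e) (y : Osp) : Commute (sigmaE n X) (rho e y) := by
  have h1 := commute_sigmaE_rhoFp X e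
  have h2 := commute_sigmaE_rhoFm X he
  have h3 : rhoEm e = (-2 : ℂ) • anti (rhoFm e) (rhoFm e) := by
    refine LinearMap.ext fun x => ?_
    rw [rhoEm, LinearMap.neg_apply, LinearMap.smul_apply, LinearMap.smul_apply, neg_smul]
  rw [rho, ospLift, Module.Basis.constr_apply_fintype]
  refine Commute.sum_right _ _ _ fun a _ => Commute.smul_right ?_ _
  cases a
  · exact Commute.smul_right (Commute.add_right (h1.mul_right h1) (h1.mul_right h1)) 2
  · change Commute (sigmaE n X) (rhoEm e)
    rw [h3]
    exact Commute.smul_right (Commute.add_right (h2.mul_right h2) (h2.mul_right h2)) _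
  · have h4 := (ospPair_rho he).half_commutator
    change Commute (sigmaE n X) ((1 / 2 : ℂ) • (rhoEp e * rhoEm e - rhoEm e * rhoEp e))
    rw [rhoEp, rhoEm, h4]
    exact Commute.smul_right (Commute.add_right (h1.mul_right h2) (h2.mul_right h1)) _
  · exact h1
  · exact h2

theorem iSupIndep_eigenspace_nat {M : Type*} [AddCommGroup M] [Module ℂ M] (T : End ℂ M) :
    iSupIndep fun k : ℕ => End.eigenspace T (k : ℂ) :=
  (End.eigenspaces_iSupIndep T).comp Nat.cast_injective

theorem eigenspace_le_gradeE (k : ℕ) : End.eigenspace (osc n).NF (k : ℂ) ≤ gradeE n (k : ZMod 2) := by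
  rw [gradeE_eq]
  exact le_iSup₂_of_le k rfl le_rfl

theorem isCompl_gradeE (n : ℕ) : IsCompl (gradeE n 0) (gradeE n 1) := by
  refine ⟨?_, ?_⟩
  · rw [gradeE_eq, gradeE_eq]
    refine (iSupIndep_eigenspace_nat (osc n).NF).disjoint_biSup_biSup
      (s := {k : ℕ | (k : ZMod 2) = 0}) (t := {k : ℕ | (k : ZMod 2) = 1}) ?_
    rw [Set.disjoint_left]
    intro k (h0 : (k : ZMod 2) = 0) (h1 : (k : ZMod 2) = 1)
    exact zero_ne_one (h0.symm.trans h1)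
  · rw [codisjoint_iff, eq_top_iff, ← iSup_eigenspace_NF]
    refine iSup_le fun k => (eigenspace_le_gradeE k).trans ?_
    have : (k : ZMod 2) = 0 ∨ (k : ZMod 2) = 1 := by
      generalize (k : ZMod 2) = p; revert p; decide
    rcases this with h | h <;> rw [h]
    · exact le_sup_left
    · exact le_sup_right

namespace OspPair

variable {M : Type*} [AddCommGroup M] [Module ℂ M] {c : ℂ} {f g d : End ℂ M}

theorem f_mem (h : OspPair c f g d) {k : ℕ} {x : M} (hx : x ∈ End.eigenspace d (k : ℂ)) :
    f x ∈ End.eigenspace d ((k + 1 : ℕ) : ℂ) := by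
  rw [End.mem_eigenspace_iff] at hx ⊢
  rw [h.deg_f, hx, map_smul]
  push_cast
  module

theorem g_mem (h : OspPair c f g d) {k : ℕ} {x : M} (hx : x ∈ End.eigenspace d ((k + 1 : ℕ) : ℂ)) :
    g x ∈ End.eigenspace d (k : ℂ) := by
  rw [End.mem_eigenspace_iff] at hx ⊢
  rw [h.deg_g, hx, map_smul]
  push_cast
  module

end OspPair

theorem rhoFm_eq_zero {e : Module.Basis (Fin n ⊕ Fin n) ℂ (V n)} (he : IsSymplecticBasis e) {x : E n}
    (hx : x ∈ End.eigenspace (osc n).NF ((0 : ℕ) : ℂ)) : rhoFm e x = 0 := by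
  have h1 : ∀ r, contractE (vAB r) x = 0 := fun r => by
    have : End.eigenspace (osc n).NF ((0 : ℕ) : ℂ) ≤ LinearMap.ker (contractE (vAB r)) := by
      rw [eigenspace_NF]
      refine tensorSub_le fun α hα s _ => ?_
      change α ∈ LinearMap.range (ExteriorAlgebra.ι ℂ) ^ 0 at hα
      rw [pow_zero] at hα
      obtain ⟨c, rfl⟩ := Submodule.mem_one.mp hα
      rw [LinearMap.mem_ker]
      change contract (vAB r) _ ⊗ₜ[ℂ] s = 0
      rw [Algebra.algebraMap_eq_smul_one, map_smul, contract_one, smul_zero, TensorProduct.zero_tmul]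
    exact this hx
  rw [rhoFm_eq he, LinearMap.smul_apply, Osc.D_apply]
  refine (congrArg _ (Finset.sum_eq_zero fun k _ => ?_)).trans (smul_zero _)
  rw [Osc.da, Osc.db, ← (osc n).zdc, ← (osc n).ddc]
  refine (congrArg₂ (· + ·) (congrArg _ (h1 _)) (congrArg _ (h1 _))).trans ?_
  rw [map_zero, map_zero, add_zero]

theorem isOspRep_rho {e : Module.Basis (Fin n ⊕ Fin n) ℂ (V n)} (he : IsSymplecticBasis e) :
    IsOspRep (gradeE n) (rho e) := by
  have h := ospPair_rho he
  refine h.isOspRep (isCompl_gradeE n) (fun p m hm => ?_) (fun p m hm => ?_) rfl rfl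
    h.half_commutator rfl rfl
  · have : gradeE n p ≤ (gradeE n (p + 1)).comap (rhoFp e) := by
      conv_lhs => rw [gradeE_eq]
      refine iSup₂_le fun k hk x hx => ?_
      subst hk
      have h2 := eigenspace_le_gradeE _ (h.f_mem hx)
      rwa [Nat.cast_succ] at h2
    exact this hm
  · have : gradeE n p ≤ (gradeE n (p + 1)).comap (rhoFm e) := by
      conv_lhs => rw [gradeE_eq]
      refine iSup₂_le fun k hk x hx => ?_
      subst hk
      rcases k with _ | k
      · rw [Submodule.mem_comap, rhoFm_eq_zero he hx]
        exact zero_mem _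
      · have h2 := eigenspace_le_gradeE _ (h.g_mem hx)
        rw [Nat.cast_succ, add_assoc, CharTwo.add_self_eq_zero, add_zero]
        exact h2
    exact this hm

/-! ### The modules `F_i` -/

theorem A_of_even {i : ℕ} {j : ℤ} (h : Even (j - i)) : A n i j = (j - i) / 8 := by
  have h1 : Even ((i : ℤ) - j) := by rw [← neg_sub]; exact h.neg
  rw [A, h1.neg_one_zpow, h1.add_one.neg_one_zpow]
  ring

theorem A_of_odd {i : ℕ} {j : ℤ} (h : Odd (j - i)) : A n i j = (i + j - 2 * n - 1) / 8 := by
  have h1 : Odd ((i : ℤ) - j) := by rw [← neg_sub]; exact h.neg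
  rw [A, h1.neg_one_zpow, h1.add_one.neg_one_zpow]
  ring

theorem A_add_A_succ (i : ℕ) (j : ℤ) : A n i j + A n i (j + 1) = (1 / 4) * (j - n) := by
  rcases Int.even_or_odd (j - i) with h | h
  · rw [A_of_even h, A_of_odd (by rw [add_sub_right_comm]; exact h.add_one)]
    push_cast
    ring
  · rw [A_of_odd h, A_of_even (by rw [add_sub_right_comm]; exact h.add_one)]
    push_cast
    ring

theorem A_self (i : ℕ) : A n i i = 0 := by
  rw [A_of_even (by simp)]
  simp

/-- The coefficient vanishes just above the top degree of `F_i`, so `f^+` need not be truncated. -/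
theorem A_last (i : ℕ) : A n i (2 * n - i + 1) = 0 := by
  rw [A_of_odd ⟨n - i, by ring⟩]
  push_cast
  ring

theorem basisFun_eq_b {i : ℕ} (j : Finset.Icc (i : ℤ) (2 * n - i)) : Pi.basisFun ℂ _ j = b n i j := by
  rw [Pi.basisFun_apply, b, dif_pos j.2]

theorem b_eq_zero {i : ℕ} {j : ℤ} (hj : j < i ∨ 2 * n - i < j) : b n i j = 0 := by
  rw [b, dif_neg]
  rw [Finset.mem_Icc]
  omega

theorem rhoIFp_b (i : ℕ) (j : ℤ) : rhoIFp n i (b n i j) = A n i (j + 1) • b n i (j + 1) := by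
  by_cases hj : j ∈ Finset.Icc (i : ℤ) (2 * n - i)
  · rw [← basisFun_eq_b ⟨j, hj⟩, rhoIFp, Module.Basis.constr_basis]
  · rw [Finset.mem_Icc] at hj
    rw [b_eq_zero (by omega), map_zero]
    by_cases h : j + 1 = i
    · rw [h, A_self, zero_smul]
    · rw [b_eq_zero (by omega), smul_zero]

theorem rhoIFm_b {i : ℕ} {j : ℤ} (hj : j ≤ 2 * n - i) : rhoIFm n i (b n i j) = b n i (j - 1) := by
  by_cases hj : j ∈ Finset.Icc (i : ℤ) (2 * n - i)
  · rw [← basisFun_eq_b ⟨j, hj⟩, rhoIFm, Module.Basis.constr_basis]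
  · rw [Finset.mem_Icc] at hj
    rw [b_eq_zero (by omega), b_eq_zero (by omega), map_zero]

/-- The operator `b_j ↦ j b_j`. -/
def degF (n i : ℕ) : End ℂ (F n i) := (Pi.basisFun ℂ _).constr ℂ fun j => (j.1 : ℂ) • b n i j

theorem degF_b (i : ℕ) (j : ℤ) : degF n i (b n i j) = (j : ℂ) • b n i j := by
  by_cases hj : j ∈ Finset.Icc (i : ℤ) (2 * n - i)
  · rw [← basisFun_eq_b ⟨j, hj⟩, degF, Module.Basis.constr_basis, basisFun_eq_b]
  · rw [Finset.mem_Icc] at hj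
    rw [b_eq_zero (by omega), map_zero, smul_zero]

theorem end_F_ext {i : ℕ} {M : Type*} [AddCommMonoid M] [Module ℂ M] {f g : F n i →ₗ[ℂ] M}
    (h : ∀ j : ℤ, (i : ℤ) ≤ j → j ≤ 2 * n - i → f (b n i j) = g (b n i j)) : f = g :=
  (Pi.basisFun ℂ _).ext fun j => by
    rw [basisFun_eq_b]
    exact h j (Finset.mem_Icc.mp j.2).1 (Finset.mem_Icc.mp j.2).2

/-- The anticommutator on `F_i` is `A(n,i,j) + A(n,i,j+1) = (j - n) / 4`. -/
theorem ospPair_rhoI (n i : ℕ) : OspPair (n : ℂ) (rhoIFp n i) (rhoIFm n i) (degF n i) where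
  anti := by
    refine LinearMap.congr_fun (f := rhoIFm n i * rhoIFp n i)
      (g := (1 / 4 : ℂ) • (degF n i - (n : ℂ) • 1) - rhoIFp n i * rhoIFm n i)
      (end_F_ext fun j h1 h2 => ?_)
    have h3 : A n i (j + 1) • rhoIFm n i (b n i (j + 1)) = A n i (j + 1) • b n i j := by
      rcases h2.lt_or_eq with h | h
      · rw [rhoIFm_b (by omega), add_sub_cancel_right]
      · rw [h, A_last, zero_smul, zero_smul]
    simp only [End.mul_apply, LinearMap.sub_apply, LinearMap.smul_apply, End.one_apply, rhoIFp_b,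
      map_smul, h3, degF_b, rhoIFm_b h2, sub_add_cancel]
    match_scalars
    linear_combination A_add_A_succ (n := n) i j
  deg_f := by
    refine LinearMap.congr_fun (f := degF n i * rhoIFp n i)
      (g := rhoIFp n i * degF n i + rhoIFp n i) (end_F_ext fun j _ _ => ?_)
    simp only [End.mul_apply, LinearMap.add_apply, rhoIFp_b, map_smul, degF_b]
    push_cast
    module
  deg_g := by
    refine LinearMap.congr_fun (f := degF n i * rhoIFm n i)
      (g := rhoIFm n i * degF n i - rhoIFm n i) (end_F_ext fun j _ h => ?_)
    simp only [End.mul_apply, LinearMap.sub_apply, rhoIFm_b h, map_smul, degF_b]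
    push_cast
    module

theorem b_mem_gradeF (i : ℕ) (j : ℤ) : b n i j ∈ gradeF n i j := Submodule.subset_span ⟨j, rfl, rfl⟩

theorem isCompl_gradeF (n i : ℕ) : IsCompl (gradeF n i 0) (gradeF n i 1) := by
  have h1 (p : ZMod 2) (x : F n i) (hx : x ∈ gradeF n i p) (j) (hj : x j ≠ 0) :
      ((j : ℤ) : ZMod 2) = p := by
    revert hj
    contrapose!
    intro hj
    induction hx using Submodule.span_induction with
    | mem x h =>
      obtain ⟨k, hk, rfl⟩ := h
      rw [b]
      split_ifs with h
      · rw [Pi.single_apply, if_neg]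
        rintro rfl
        exact hj hk
      · rfl
    | zero => rfl
    | add x y _ _ hx hy => rw [Pi.add_apply, hx, hy, add_zero]
    | smul c x _ hx => rw [Pi.smul_apply, hx, smul_zero]
  refine ⟨?_, ?_⟩
  · rw [Submodule.disjoint_def]
    intro x h0 h1'
    ext j
    by_contra hj
    exact zero_ne_one ((h1 0 x h0 j hj).symm.trans (h1 1 x h1' j hj))
  · rw [codisjoint_iff, eq_top_iff, ← (Pi.basisFun ℂ _).span_eq, Submodule.span_le]
    rintro _ ⟨j, rfl⟩
    rw [basisFun_eq_b]
    have h2 := b_mem_gradeF (n := n) i j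
    have : ((j : ℤ) : ZMod 2) = 0 ∨ ((j : ℤ) : ZMod 2) = 1 := by
      generalize ((j : ℤ) : ZMod 2) = p; revert p; decide
    rcases this with h | h <;> rw [h] at h2
    · exact Submodule.mem_sup_left h2
    · exact Submodule.mem_sup_right h2

theorem isOspRep_rhoI (n i : ℕ) : IsOspRep (gradeF n i) (rhoI n i) := by
  have h := ospPair_rhoI n i
  have key (k : End ℂ (F n i)) (hk : ∀ j : ℤ, k (b n i j) ∈ gradeF n i ((j : ZMod 2) + 1)) (p : ZMod 2) :
      ∀ m ∈ gradeF n i p, k m ∈ gradeF n i (p + 1) := by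
    have : gradeF n i p ≤ (gradeF n i (p + 1)).comap k := by
      refine Submodule.span_le.mpr ?_
      rintro _ ⟨j, rfl, rfl⟩
      exact hk j
    exact this
  refine h.isOspRep (isCompl_gradeF n i) (key _ fun j => ?_) (key _ fun j => ?_) rfl rfl rfl rfl rfl
  · rw [rhoIFp_b]
    have := b_mem_gradeF (n := n) i (j + 1)
    push_cast at this
    exact Submodule.smul_mem _ _ this
  · by_cases hj : j ≤ 2 * n - i
    · rw [rhoIFm_b hj]
      have := b_mem_gradeF (n := n) i (j - 1)
      push_cast at this
      rwa [CharTwo.sub_eq_add (j : ZMod 2)] at this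
    · rw [b_eq_zero (by omega), map_zero]
      exact zero_mem _

theorem finrank_F {i : ℕ} (hi : i ≤ n) : Module.finrank ℂ (F n i) = 2 * n - 2 * i + 1 := by
  rw [Module.finrank_fintype_fun_eq_card, Fintype.card_coe, Int.card_Icc]
  omega

end

section

/-! ### Decomposition of a graded `osp(1|2)`-module -/

/-- The coefficient of `f^m w` in the image of `w ⊗ b_{i+m}`: the inverse of the product of
`A(n,i,i+1), …, A(n,i,i+m)`. -/
def chainCoeff (n i m : ℕ) : ℂ := ∏ l ∈ Finset.range m, (A n i (i + l + 1))⁻¹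

/-- Operators as in `OspPair` such that `d` is diagonalizable with eigenvalues in `0, …, 2n`,
and an involution `p` that anticommutes with `f` and `g`. -/
structure OspData (n : ℕ) {M : Type*} [AddCommGroup M] [Module ℂ M] (f g d p : End ℂ M) : Prop
    extends OspPair (n : ℂ) f g d where
  top : ⨆ k : ℕ, End.eigenspace d (k : ℂ) = ⊤
  bot : ∀ k : ℕ, 2 * n < k → ∀ x ∈ End.eigenspace d (k : ℂ), x = 0
  g_zero : ∀ x ∈ End.eigenspace d ((0 : ℕ) : ℂ), g x = 0
  p_p : ∀ x, p (p x) = x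
  p_f : ∀ x, p (f x) = -f (p x)
  p_g : ∀ x, p (g x) = -g (p x)
  p_d : ∀ x, p (d x) = d (p x)

variable {n : ℕ} {M : Type*} [AddCommGroup M] [Module ℂ M] {f g d p : End ℂ M}

/-- The vectors of degree `k` that are killed by `g`. -/
def lowest (g d : End ℂ M) (k : ℕ) : Submodule ℂ M :=
  LinearMap.ker g ⊓ End.eigenspace d (k : ℂ)

theorem A_ne_zero {i m : ℕ} (hm : m < 2 * n - 2 * i) : A n i (i + m + 1) ≠ 0 := by
  have h2 : ((m : ℂ) + 1) ≠ 0 := Nat.cast_add_one_ne_zero m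
  have h3 : ((2 * n - 2 * i - m : ℕ) : ℂ) ≠ 0 := Nat.cast_ne_zero.mpr (by omega)
  rw [Nat.cast_sub (by omega), Nat.cast_sub (by omega)] at h3
  rcases Int.even_or_odd ((i : ℤ) + m + 1 - i) with h | h
  · rw [A_of_even h]
    push_cast
    rw [show (i : ℂ) + m + 1 - i = m + 1 by ring]
    exact div_ne_zero h2 (by norm_num)
  · rw [A_of_odd h]
    push_cast at h3 ⊢
    rw [show (i : ℂ) + (i + m + 1) - 2 * n - 1 = -(2 * n - 2 * i - m) by ring]
    exact div_ne_zero (neg_ne_zero.mpr h3) (by norm_num)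

theorem chainCoeff_ne_zero {i m : ℕ} (hm : m ≤ 2 * n - 2 * i) : chainCoeff n i m ≠ 0 :=
  Finset.prod_ne_zero_iff.mpr fun l hl => inv_ne_zero (A_ne_zero (by
    have := Finset.mem_range.mp hl
    omega))

theorem chainCoeff_succ (i m : ℕ) :
    chainCoeff n i (m + 1) = chainCoeff n i m * (A n i (i + m + 1))⁻¹ :=
  Finset.prod_range_succ _ _

theorem chainCoeff_zero (i : ℕ) : chainCoeff n i 0 = 1 := Finset.prod_range_zero _

namespace OspPair

variable {c : ℂ}

theorem f_pow_mem (h : OspPair c f g d) {k : ℕ} (m : ℕ) {x : M}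
    (hx : x ∈ End.eigenspace d (k : ℂ)) :
    (f ^ m) x ∈ End.eigenspace d ((k + m : ℕ) : ℂ) := by
  induction m with
  | zero => exact hx
  | succ m ih => rw [pow_succ']; exact h.f_mem ih

theorem g_pow_mem (h : OspPair c f g d) {k m : ℕ} {x : M}
    (hx : x ∈ End.eigenspace d ((k + m : ℕ) : ℂ)) :
    (g ^ m) x ∈ End.eigenspace d (k : ℂ) := by
  induction m generalizing k with
  | zero => exact hx
  | succ m ih =>
    rw [pow_succ']
    exact h.g_mem (ih (k := k + 1) (by rwa [add_right_comm]))

/-- The string generated by a vector killed by `g` has the structure constants of `F_i`. -/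
theorem g_f_pow (h : OspPair (n : ℂ) f g d) {i : ℕ} {x : M} (hx : x ∈ lowest g d i) (m : ℕ) :
    g ((f ^ (m + 1)) x) = A n i (i + m + 1) • (f ^ m) x := by
  induction m with
  | zero =>
    have h1 := A_add_A_succ (n := n) i i
    rw [A_self, zero_add] at h1
    rw [zero_add, pow_one, pow_zero, h.anti, LinearMap.mem_ker.mp hx.1, map_zero, sub_zero,
      End.mem_eigenspace_iff.mp hx.2, Nat.cast_zero, add_zero, h1, End.one_apply]
    push_cast
    module
  | succ m ih =>
    have h1 := A_add_A_succ (n := n) i (i + m + 1)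
    have h2 := End.mem_eigenspace_iff.mp (h.f_pow_mem (m + 1) hx.2)
    rw [pow_succ' f (m + 1), End.mul_apply, h.anti, h2, ih, map_smul, ← End.mul_apply, ← pow_succ',
      Nat.cast_succ, ← add_assoc (i : ℤ), eq_sub_of_add_eq' h1]
    push_cast
    module

theorem g_pow_f_pow (h : OspPair (n : ℂ) f g d) {i : ℕ} {x : M} (hx : x ∈ lowest g d i) {m : ℕ}
    (hm : m ≤ 2 * n - 2 * i) : (g ^ m) ((f ^ m) x) = (chainCoeff n i m)⁻¹ • x := by
  induction m with
  | zero => simp [chainCoeff_zero]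
  | succ m ih =>
    rw [pow_succ, End.mul_apply, h.g_f_pow hx, map_smul, ih (by omega), smul_smul, chainCoeff_succ,
      mul_inv, inv_inv, mul_comm]

end OspPair

namespace OspData

/-- In degrees above `n`, the operator `f g` is injective. -/
theorem eq_zero_of_f_g (h : OspData n f g d p) {k : ℕ} (hk : n < k) {u : M}
    (hu : u ∈ End.eigenspace d (k : ℂ)) (hfg : f (g u) = 0) : u = 0 := by
  have h1 (m : ℕ) := End.mem_eigenspace_iff.mp (h.f_pow_mem m hu)
  have key (l : ℕ) : g ((f ^ (2 * l + 1)) u) = (((k : ℂ) - n + l) / 4) • (f ^ (2 * l)) u ∧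
      g ((f ^ (2 * l + 2)) u) = (((l : ℂ) + 1) / 4) • (f ^ (2 * l + 1)) u := by
    have step (l : ℕ) (h3 : g ((f ^ (2 * l + 1)) u) = (((k : ℂ) - n + l) / 4) • (f ^ (2 * l)) u) :
        g ((f ^ (2 * l + 2)) u) = (((l : ℂ) + 1) / 4) • (f ^ (2 * l + 1)) u := by
      rw [pow_succ' f (2 * l + 1), End.mul_apply, h.anti, h1, h3, map_smul, ← End.mul_apply,
        ← pow_succ']
      push_cast
      module
    induction l with
    | zero =>
      have h3 : g ((f ^ (2 * 0 + 1)) u) = (((k : ℂ) - n + (0 : ℕ)) / 4) • (f ^ (2 * 0)) u := by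
        rw [mul_zero, zero_add, pow_one, pow_zero, End.one_apply, h.anti, hfg,
          End.mem_eigenspace_iff.mp hu]
        push_cast
        module
      exact ⟨h3, step 0 h3⟩
    | succ l ih =>
      have h3 : g ((f ^ (2 * (l + 1) + 1)) u) =
          (((k : ℂ) - n + (l + 1 : ℕ)) / 4) • (f ^ (2 * (l + 1))) u := by
        rw [pow_succ' f (2 * (l + 1)), End.mul_apply, h.anti, h1, mul_add_one, ih.2, map_smul,
          ← End.mul_apply, ← pow_succ']
        push_cast
        module
      exact ⟨h3, step _ h3⟩
  have h4 (j : ℕ) (hj : (f ^ (j + 1)) u = 0) : (f ^ j) u = 0 := by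
    obtain ⟨l, rfl | rfl⟩ := Nat.even_or_odd' j
    · have h5 := (key l).1
      rw [hj, map_zero, eq_comm, smul_eq_zero] at h5
      refine h5.resolve_left (div_ne_zero ?_ (by norm_num))
      have : ((k - n + l : ℕ) : ℂ) ≠ 0 := Nat.cast_ne_zero.mpr (by omega)
      rwa [Nat.cast_add, Nat.cast_sub hk.le] at this
    · have h5 := (key l).2
      rw [hj, map_zero, eq_comm, smul_eq_zero] at h5
      exact h5.resolve_left (div_ne_zero (Nat.cast_add_one_ne_zero l) (by norm_num))
  have h6 (j : ℕ) (hj : (f ^ j) u = 0) : u = 0 := by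
    induction j with
    | zero => exact hj
    | succ j ih => exact ih (h4 j hj)
  exact h6 (2 * n) (h.bot _ (by omega) _ (h.f_pow_mem (2 * n) hu))

theorem eq_zero_of_mem_lowest (h : OspData n f g d p) {k : ℕ} (hk : n < k) {u : M}
    (hu : u ∈ lowest g d k) : u = 0 :=
  h.eq_zero_of_f_g hk hu.2 (by rw [LinearMap.mem_ker.mp hu.1, map_zero])

/-- The string has the length of `F_i`: the vector of degree `2n - i + 1` is killed by `g`, since
`A(n,i,2n-i+1) = 0`, and its degree exceeds `n`. -/
theorem f_pow_eq_zero (h : OspData n f g d p) {i : ℕ} {x : M} (hx : x ∈ lowest g d i) {m : ℕ}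
    (hm : 2 * n - 2 * i < m) : (f ^ m) x = 0 := by
  rcases le_or_gt i n with hi | hi
  · have h1 : (f ^ (2 * n - 2 * i + 1)) x = 0 := by
      refine h.eq_zero_of_mem_lowest (k := i + (2 * n - 2 * i + 1)) (by omega)
        ⟨?_, h.f_pow_mem _ hx.2⟩
      change g _ = 0
      rw [h.g_f_pow hx]
      have : (i : ℤ) + (2 * n - 2 * i : ℕ) + 1 = 2 * n - i + 1 := by omega
      rw [this, A_last, zero_smul]
    obtain ⟨l, rfl⟩ := Nat.exists_eq_add_of_lt hm
    rw [add_right_comm, add_comm, pow_add, End.mul_apply, h1, map_zero]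
  · rw [h.eq_zero_of_mem_lowest hi hx, map_zero]

theorem g_pow_eq_zero (h : OspData n f g d p) {k : ℕ} {x : M}
    (hx : x ∈ End.eigenspace d (k : ℂ)) : (g ^ (k + 1)) x = 0 := by
  rw [pow_succ', End.mul_apply]
  exact h.g_zero _ (h.g_pow_mem (by rwa [zero_add]))

/-- Every vector is a sum of vectors `f^j w` with `g w = 0`, by induction on the power of `g` that kills
`x`: the last nonzero `g^m x` is a vector `w` killed by `g`, and `x` minus a multiple of `f^m w` is
killed by `g^m`. This works as long as the string of `w` reaches degree `k`; beyond, the injectivity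
of `f g` in high degrees shows that `x` is killed by a smaller power of `g`. -/
theorem mem_span_f_pow (h : OspData n f g d p) (m : ℕ) {k : ℕ} {x : M}
    (hx : x ∈ End.eigenspace d (k : ℂ)) (hm : (g ^ m) x = 0) :
    x ∈ Submodule.span ℂ {y | ∃ i j w, j < m ∧ i + j = k ∧ w ∈ lowest g d i ∧ y = (f ^ j) w} := by
  induction m using Nat.strong_induction_on generalizing k x with
  | _ m ih =>
  rcases m with _ | m
  · rw [show x = 0 from hm]
    exact zero_mem _
  have hmono (m' : ℕ) (hm' : m' ≤ m) :
      Submodule.span ℂ {y | ∃ i j w, j < m' ∧ i + j = k ∧ w ∈ lowest g d i ∧ y = (f ^ j) w} ≤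
      Submodule.span ℂ {y | ∃ i j w, j < m + 1 ∧ i + j = k ∧ w ∈ lowest g d i ∧ y = (f ^ j) w} := by
    refine Submodule.span_mono ?_
    rintro y ⟨i, j, w, h1, h2⟩
    exact ⟨i, j, w, by omega, h2⟩
  by_cases hy0 : (g ^ m) x = 0
  · exact hmono m le_rfl (ih m (by omega) hx hy0)
  have hmk : m ≤ k := by
    by_contra hmk
    obtain ⟨l, rfl⟩ := Nat.exists_eq_add_of_lt (not_le.mp hmk)
    apply hy0
    rw [show k + l + 1 = l + (k + 1) by omega, pow_add, End.mul_apply, h.g_pow_eq_zero hx, map_zero]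
  obtain ⟨i, rfl⟩ := Nat.exists_eq_add_of_le' hmk
  have hy : (g ^ m) x ∈ lowest g d i := by
    refine ⟨?_, h.g_pow_mem hx⟩
    change g _ = 0
    rw [← End.mul_apply, ← pow_succ', hm]
  have hi : i ≤ n := by
    by_contra hi
    exact hy0 (h.eq_zero_of_mem_lowest (not_le.mp hi) hy)
  rcases le_or_gt m (2 * n - 2 * i) with hm2 | hm2
  · have h1 : x - chainCoeff n i m • (f ^ m) ((g ^ m) x) ∈
        Submodule.span ℂ {y | ∃ i' j w, j < m ∧ i' + j = i + m ∧ w ∈ lowest g d i' ∧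
          y = (f ^ j) w} := by
      refine ih m (by omega) (Submodule.sub_mem _ hx (Submodule.smul_mem _ _
        (h.f_pow_mem m hy.2))) ?_
      rw [map_sub, map_smul, h.g_pow_f_pow hy hm2, smul_smul,
        mul_inv_cancel₀ (chainCoeff_ne_zero hm2), one_smul, sub_self]
    rw [← sub_add_cancel x (chainCoeff n i m • (f ^ m) ((g ^ m) x))]
    exact add_mem (hmono m le_rfl h1) (Submodule.smul_mem _ _
      (Submodule.subset_span ⟨i, m, _, by omega, rfl, hy, rfl⟩))
  · -- `u` has degree `2n - i + 1`, and the components of `g u` are annihilated by `f`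
    obtain ⟨l, hl⟩ := Nat.exists_eq_add_of_lt hm2
    have hu : (g ^ l) x ∈ End.eigenspace d ((2 * n - i + 1 : ℕ) : ℂ) := by
      apply h.g_pow_mem
      rwa [show 2 * n - i + 1 + l = i + m by omega]
    have hgu : g ((g ^ l) x) ∈ End.eigenspace d ((2 * n - i : ℕ) : ℂ) := h.g_mem hu
    have h1 := ih (2 * n - 2 * i + 1) (by omega) hgu (by
      rw [← End.mul_apply, ← End.mul_apply, mul_assoc, ← pow_succ', ← pow_add,
        show 2 * n - 2 * i + 1 + (l + 1) = m + 1 by omega, hm])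
    have h2 : f (g ((g ^ l) x)) = 0 := by
      have : Submodule.span ℂ {y | ∃ i' j w, j < 2 * n - 2 * i + 1 ∧ i' + j = 2 * n - i ∧
          w ∈ lowest g d i' ∧ y = (f ^ j) w} ≤ LinearMap.ker f := by
        refine Submodule.span_le.mpr ?_
        rintro _ ⟨i', j, w, hj, hij, hw, rfl⟩
        rw [SetLike.mem_coe, LinearMap.mem_ker, ← End.mul_apply, ← pow_succ']
        exact h.f_pow_eq_zero hw (by omega)
      exact this h1
    have h3 := h.eq_zero_of_f_g (by omega) hu h2
    refine absurd ?_ hy0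
    rw [show m = (2 * n - 2 * i + 1) + l by omega, pow_add, End.mul_apply, h3, map_zero]

end OspData

/-- The vectors of degree `i` and parity `s` that are killed by `g`. -/
def prims (g d p : End ℂ M) (a : Idx n) : Submodule ℂ M :=
  lowest g d a.2 ⊓ End.eigenspace p ((-1) ^ (a.1 : ℕ))

/-- The map `w ⊗ b_{i+m} ↦ f^m w`, up to the factors that make it a map of modules. -/
def chainMap (n : ℕ) (f : End ℂ M) (i : ℕ) : M →ₗ[ℂ] F n i →ₗ[ℂ] M :=
  ((Pi.basisFun ℂ _).constr ℂ fun j : Finset.Icc (i : ℤ) (2 * n - i) =>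
    chainCoeff n i (j - i : ℤ).toNat • f ^ (j - i : ℤ).toNat).flip

theorem chainMap_b (i : ℕ) (w : M) {m : ℕ} (hm : (i : ℤ) + m ≤ 2 * n - i) :
    chainMap n f i w (b n i (i + m)) = chainCoeff n i m • (f ^ m) w := by
  have hj : (i : ℤ) + m ∈ Finset.Icc (i : ℤ) (2 * n - i) := Finset.mem_Icc.mpr ⟨by omega, hm⟩
  rw [← basisFun_eq_b ⟨_, hj⟩, chainMap, LinearMap.flip_apply, Module.Basis.constr_basis]
  simp

theorem chainMap_self {i : ℕ} (hi : i ≤ n) (w : M) : chainMap n f i w (b n i i) = w := by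
  have := chainMap_b (n := n) (f := f) i w (m := 0) (by omega)
  rwa [Nat.cast_zero, add_zero, chainCoeff_zero, one_smul, pow_zero] at this

theorem OspData.chainMap_f (h : OspData n f g d p) {i : ℕ} {w : M} (hw : w ∈ lowest g d i)
    (v : F n i) : chainMap n f i w (rhoIFp n i v) = f (chainMap n f i w v) := by
  refine LinearMap.congr_fun (f := chainMap n f i w ∘ₗ rhoIFp n i)
    (g := f ∘ₗ chainMap n f i w) (end_F_ext fun j h1 h2 => ?_) v
  obtain ⟨m, rfl⟩ := Int.le.dest h1
  rw [LinearMap.comp_apply, LinearMap.comp_apply, rhoIFp_b, map_smul, chainMap_b i w h2, map_smul,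
    ← End.mul_apply, ← pow_succ']
  rcases h2.lt_or_eq with h3 | h3
  · have h4 := chainMap_b (n := n) (f := f) i w (m := m + 1) (by push_cast; omega)
    rw [Nat.cast_succ, ← add_assoc] at h4
    rw [h4, smul_smul, chainCoeff_succ, mul_comm, mul_assoc,
      inv_mul_cancel₀ (A_ne_zero (by omega)), mul_one]
  · rw [h3, A_last, zero_smul, h.f_pow_eq_zero hw (by omega), smul_zero]

theorem OspData.chainMap_g (h : OspData n f g d p) {i : ℕ} {w : M} (hw : w ∈ lowest g d i)
    (v : F n i) : chainMap n f i w (rhoIFm n i v) = g (chainMap n f i w v) := by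
  refine LinearMap.congr_fun (f := chainMap n f i w ∘ₗ rhoIFm n i)
    (g := g ∘ₗ chainMap n f i w) (end_F_ext fun j h1 h2 => ?_) v
  obtain ⟨m, rfl⟩ := Int.le.dest h1
  rw [LinearMap.comp_apply, LinearMap.comp_apply, rhoIFm_b h2, chainMap_b i w h2, map_smul]
  rcases m with _ | m
  · rw [b_eq_zero (by omega), map_zero, pow_zero, End.one_apply, LinearMap.mem_ker.mp hw.1,
      smul_zero]
  · rw [Nat.cast_succ, ← add_assoc, add_sub_cancel_right, h.g_f_pow hw, chainMap_b i w (by omega),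
      smul_smul, chainCoeff_succ, mul_assoc, inv_mul_cancel₀ (A_ne_zero (by omega)), mul_one]

theorem OspPair.chainMap_mem {c : ℂ} (h : OspPair c f g d) {i : ℕ} {w : M} (hw : w ∈ lowest g d i)
    {gr : ZMod 2 → Submodule ℂ M} (hgr : ∀ k : ℕ, End.eigenspace d (k : ℂ) ≤ gr k) {q : ZMod 2}
    {v : F n i} (hv : v ∈ gradeF n i q) : chainMap n f i w v ∈ gr q := by
  have : gradeF n i q ≤ (gr q).comap (chainMap n f i w) := by
    refine Submodule.span_le.mpr ?_
    rintro _ ⟨j, rfl, rfl⟩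
    rw [SetLike.mem_coe, Submodule.mem_comap]
    by_cases hj : (i : ℤ) ≤ j ∧ j ≤ 2 * n - i
    · obtain ⟨m, rfl⟩ := Int.le.dest hj.1
      rw [chainMap_b i w hj.2]
      refine Submodule.smul_mem _ _ ?_
      have := hgr _ (h.f_pow_mem m hw.2)
      rwa [show ((i + m : ℕ) : ZMod 2) = (((i : ℤ) + m : ℤ) : ZMod 2) by push_cast; rfl] at this
    · rw [b_eq_zero (by omega), map_zero]
      exact zero_mem _
  exact this hv

theorem ospLift_intertwine {N : Type*} [AddCommGroup N] [Module ℂ N] (φ : N →ₗ[ℂ] M)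
    {r : OspGen → End ℂ N} {r' : OspGen → End ℂ M} (h : ∀ a x, φ (r a x) = r' a (φ x)) (y : Osp)
    (x : N) : φ (ospLift r y x) = ospLift r' y (φ x) := by
  simp only [ospLift, Module.Basis.constr_apply_fintype, LinearMap.sum_apply, LinearMap.smul_apply,
    map_sum, map_smul, h]

/-- A map that intertwines the odd generators intertwines the actions of `osp(1|2)`. -/
theorem ospLift_intertwine_of_odd {N : Type*} [AddCommGroup N] [Module ℂ N] (φ : N →ₗ[ℂ] M)
    {f' g' : End ℂ N} (hf : ∀ x, φ (f' x) = f (φ x)) (hg : ∀ x, φ (g' x) = g (φ x))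
    {r : OspGen → End ℂ N} {r' : OspGen → End ℂ M}
    (hr : r = fun
      | .eP => (2 : ℂ) • anti f' f'
      | .eM => -((2 : ℂ) • anti g' g')
      | .h0 => (2 : ℂ) • anti f' g'
      | .fP => f'
      | .fM => g')
    (hr' : r' = fun
      | .eP => (2 : ℂ) • anti f f
      | .eM => -((2 : ℂ) • anti g g)
      | .h0 => (2 : ℂ) • anti f g
      | .fP => f
      | .fM => g) (y : Osp) (x : N) : φ (ospLift r y x) = ospLift r' y (φ x) := by
  subst hr hr'
  refine ospLift_intertwine φ (fun a x => ?_) y x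
  cases a <;> simp only [anti, LinearMap.smul_apply, LinearMap.add_apply, LinearMap.neg_apply,
    End.mul_apply, map_smul, map_add, map_neg, hf, hg]

/-! ### The direct sum of the modules `N_a ⊗ F_i` -/

section Sum

variable (N : Idx n → Type) [∀ a, AddCommGroup (N a)] [∀ a, Module ℂ (N a)]

/-- The element `w ⊗ v` of the summand with index `a`. -/
def sumMk (a : Idx n) (w : N a) (v : F n a.2) : SumF N :=
  DirectSum.lof ℂ (Idx n) (fun a => N a ⊗[ℂ] F n a.2) a (w ⊗ₜ v)

/-- The endomorphism `⊕ (1 ⊗ k_i)`. -/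
def sumRight (k : ∀ i, End ℂ (F n i)) : End ℂ (SumF N) :=
  DirectSum.lmap fun a => TensorProduct.map LinearMap.id (k a.2)

/-- The map `⊕ N_a → ⊕ N_a ⊗ F_i`, `w ↦ w ⊗ b_i`. -/
def sumIncl : (⨁ a, N a) →ₗ[ℂ] SumF N :=
  DirectSum.lmap fun a => (TensorProduct.mk ℂ (N a) (F n a.2)).flip (b n a.2 a.2)

/-- The coordinate of `b_i`, the lowest basis vector. -/
def coordLow (n i : ℕ) : F n i →ₗ[ℂ] ℂ :=
  (Pi.basisFun ℂ _).constr ℂ fun j => if (j : ℤ) = i then 1 else 0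

/-- The map `⊕ N_a ⊗ F_i → ⊕ N_a` that extracts the coefficients of the `b_i`. -/
def sumLow : SumF N →ₗ[ℂ] ⨁ a, N a :=
  DirectSum.lmap fun a => (TensorProduct.rid ℂ (N a)).toLinearMap ∘ₗ
    TensorProduct.map LinearMap.id (coordLow n a.2)

variable {N}

theorem sumF_induction {P : SumF N → Prop} (h0 : P 0) (hadd : ∀ x y, P x → P y → P (x + y))
    (h : ∀ a w v, P (sumMk N a w v)) (t : SumF N) : P t := by
  induction t using DirectSum.induction_on with
  | zero => exact h0
  | of a x =>
    induction x using TensorProduct.induction_on with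
    | zero => rw [map_zero]; exact h0
    | tmul w v => exact h a w v
    | add x y hx hy => rw [map_add]; exact hadd _ _ hx hy
  | add x y hx hy => exact hadd _ _ hx hy

theorem sumRight_mk (k : ∀ i, End ℂ (F n i)) (a : Idx n) (w : N a) (v : F n a.2) :
    sumRight N k (sumMk N a w v) = sumMk N a w (k a.2 v) := DirectSum.lmap_lof _ _ _

theorem sumLeft_mk (T : ∀ a, End ℂ (N a)) (a : Idx n) (w : N a) (v : F n a.2) :
    sumLeft N T (sumMk N a w v) = sumMk N a (T a w) v := DirectSum.lmap_lof _ _ _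

theorem sumOsp_mk (y : Osp) (a : Idx n) (w : N a) (v : F n a.2) :
    sumOsp N y (sumMk N a w v) = sumMk N a w (rhoI n a.2 y v) := DirectSum.lmap_lof _ _ _

theorem sumIncl_of (a : Idx n) (w : N a) :
    sumIncl N (DirectSum.of N a w) = sumMk N a w (b n a.2 a.2) := DirectSum.lmap_lof _ _ _

theorem sumLow_mk (a : Idx n) (w : N a) (v : F n a.2) :
    sumLow N (sumMk N a w v) = DirectSum.of N a (coordLow n a.2 v • w) := DirectSum.lmap_lof _ _ _

theorem sumMk_add (a : Idx n) (w : N a) (v v' : F n a.2) :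
    sumMk N a w (v + v') = sumMk N a w v + sumMk N a w v' := by
  simp only [sumMk, TensorProduct.tmul_add, map_add]

theorem sumMk_smul (c : ℂ) (a : Idx n) (w : N a) (v : F n a.2) :
    sumMk N a (c • w) v = sumMk N a w (c • v) := by
  simp only [sumMk, TensorProduct.smul_tmul]

theorem sumMk_zero (a : Idx n) (w : N a) : sumMk N a w 0 = 0 := by
  simp only [sumMk, TensorProduct.tmul_zero, map_zero]

theorem gradeSum_le {q : ZMod 2} {P : Submodule ℂ (SumF N)}
    (h : ∀ a (w : N a), ∀ v ∈ gradeF n a.2 q, sumMk N a w v ∈ P) : gradeSum N q ≤ P := by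
  refine iSup_le fun a => ?_
  rintro _ ⟨_, ⟨t, rfl⟩, rfl⟩
  induction t using TensorProduct.induction_on with
  | zero => rw [map_zero, map_zero]; exact zero_mem _
  | tmul w v => exact h a w v v.2
  | add x y hx hy => rw [map_add, map_add]; exact add_mem hx hy

theorem rhoIFm_pow (i m : ℕ) {j : ℤ} (hj : j ≤ 2 * n - i) :
    (rhoIFm n i ^ m) (b n i j) = b n i (j - m) := by
  induction m with
  | zero => simp
  | succ m ih =>
    rw [pow_succ', End.mul_apply, ih, rhoIFm_b (by omega), Nat.cast_succ, sub_sub]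

/-- The shift `b_j ↦ b_{j+1}`. -/
def shiftF (n i : ℕ) : End ℂ (F n i) := (Pi.basisFun ℂ _).constr ℂ fun j => b n i (j + 1)

/-- `v` is recovered from its image under `f^-` and its lowest coordinate. -/
theorem shiftF_rhoIFm {i : ℕ} (v : F n i) :
    shiftF n i (rhoIFm n i v) + coordLow n i v • b n i i = v := by
  refine LinearMap.congr_fun (f := shiftF n i ∘ₗ rhoIFm n i + (coordLow n i).smulRight (b n i i))
    (g := LinearMap.id) (end_F_ext fun j h1 h2 => ?_) v
  have h3 : coordLow n i (b n i j) = if j = i then 1 else 0 := by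
    rw [← basisFun_eq_b ⟨j, Finset.mem_Icc.mpr ⟨h1, h2⟩⟩, coordLow, Module.Basis.constr_basis]
  rw [LinearMap.add_apply, LinearMap.comp_apply, rhoIFm_b h2, LinearMap.smulRight_apply, h3,
    LinearMap.id_apply]
  split_ifs with h
  · rw [b_eq_zero (by omega), map_zero, zero_add, one_smul, h]
  · rw [← basisFun_eq_b ⟨j - 1, Finset.mem_Icc.mpr (by omega)⟩, shiftF, Module.Basis.constr_basis,
      sub_add_cancel, zero_smul, add_zero]

theorem sumRight_shiftF (t : SumF N) :
    sumRight N (shiftF n) (sumRight N (rhoIFm n) t) + sumIncl N (sumLow N t) = t := by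
  induction t using sumF_induction with
  | h0 => simp only [map_zero, add_zero]
  | hadd x y hx hy => rw [map_add, map_add, map_add, map_add, add_add_add_comm, hx, hy]
  | h a w v =>
    rw [sumRight_mk, sumRight_mk, sumLow_mk, sumIncl_of, sumMk_smul, ← sumMk_add, shiftF_rhoIFm]

theorem sumRight_pow (k : ∀ i, End ℂ (F n i)) (m : ℕ) (a : Idx n) (w : N a) (v : F n a.2) :
    (sumRight N k ^ m) (sumMk N a w v) = sumMk N a w ((k a.2 ^ m) v) := by
  induction m with
  | zero => rfl
  | succ m ih => rw [pow_succ', End.mul_apply, ih, sumRight_mk, pow_succ', End.mul_apply]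

theorem sumRight_rhoIFm_pow (t : SumF N) : (sumRight N (rhoIFm n) ^ (2 * n + 1)) t = 0 := by
  induction t using sumF_induction with
  | h0 => rw [map_zero]
  | hadd x y hx hy => rw [map_add, hx, hy, add_zero]
  | h a w v =>
    have h6 : rhoIFm n a.2 ^ (2 * n + 1) = 0 := end_F_ext fun j h1 h2 => by
      rw [rhoIFm_pow _ _ h2, b_eq_zero (by push_cast; omega), LinearMap.zero_apply]
    rw [sumRight_pow, h6, LinearMap.zero_apply, sumMk_zero]

end Sum

/-- The values `4 k ± 1` separate the pairs of a degree and a parity, so the spaces `prims` lie in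
different eigenspaces of `4 d + p`. -/
theorem iSupIndep_prims (g d p : End ℂ M) : iSupIndep (prims (n := n) g d p) := by
  have h1 : iSupIndep fun a : Idx n =>
      End.eigenspace ((4 : ℂ) • d + p) (4 * (a.2 : ℕ) + (-1) ^ (a.1 : ℕ)) := by
    refine (End.eigenspaces_iSupIndep ((4 : ℂ) • d + p)).comp ?_
    rintro ⟨s, i⟩ ⟨s', i'⟩ h
    have h2 : ((4 * (i : ℕ) + (-1) ^ (s : ℕ) : ℤ) : ℂ) =
        ((4 * (i' : ℕ) + (-1) ^ (s' : ℕ) : ℤ) : ℂ) := by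
      push_cast
      exact h
    have h3 : (4 * (i : ℕ) + (-1) ^ (s : ℕ) : ℤ) = 4 * (i' : ℕ) + (-1) ^ (s' : ℕ) :=
      Int.cast_injective h2
    fin_cases s <;> fin_cases s' <;> simp only [Prod.mk.injEq, Fin.ext_iff] <;> simp at h3 ⊢ <;>
      omega
  refine h1.mono fun a w hw => End.mem_eigenspace_iff.mpr ?_
  rw [LinearMap.add_apply, LinearMap.smul_apply, End.mem_eigenspace_iff.mp hw.1.2,
    End.mem_eigenspace_iff.mp hw.2, add_smul, smul_smul]

/-! ### The isomorphism -/

section Equiv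

variable {M : Type} [AddCommGroup M] [Module ℂ M] (n) (f g d p : End ℂ M)

/-- The space `prims`, as a type. -/
abbrev Prims (a : Idx n) : Type := prims g d p a

/-- The sum of the maps `chainMap` over all `w` in the spaces `prims`. -/
def sumMap : SumF (Prims n g d p) →ₗ[ℂ] M :=
  DirectSum.toModule ℂ (Idx n) M fun a =>
    TensorProduct.lift (chainMap n f a.2 ∘ₗ (prims g d p a).subtype)

variable {n f g d p}

theorem sumMap_mk (a : Idx n) (w : Prims n g d p a) (v : F n a.2) :
    sumMap n f g d p (sumMk _ a w v) = chainMap n f a.2 w v := by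
  rw [sumMap, sumMk, DirectSum.toModule_lof, TensorProduct.lift.tmul]
  rfl

theorem sumMap_sumRight {k : End ℂ M} {k' : ∀ i, End ℂ (F n i)}
    (hk : ∀ i, ∀ w ∈ lowest g d i, ∀ v, chainMap n f i w (k' i v) = k (chainMap n f i w v))
    (t : SumF (Prims n g d p)) :
    sumMap n f g d p (sumRight _ k' t) = k (sumMap n f g d p t) := by
  induction t using sumF_induction with
  | h0 => simp only [map_zero]
  | hadd x y hx hy => simp only [map_add, hx, hy]
  | h a w v => rw [sumRight_mk, sumMap_mk, sumMap_mk, hk _ _ w.2.1]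

theorem sumMap_sumIncl (u : ⨁ a, Prims n g d p a) : sumMap n f g d p (sumIncl _ u) =
    DirectSum.coeLinearMap (fun a : Idx n => prims g d p a) u := by
  induction u using DirectSum.induction_on with
  | zero => simp only [map_zero]
  | add x y hx hy => simp only [map_add, hx, hy]
  | of a w => rw [sumIncl_of, sumMap_mk, chainMap_self (by omega), DirectSum.coeLinearMap_of]

/-- The kernel is stable under the nilpotent operator `g`, so if it were nonzero it would contain a
nonzero vector killed by `g`. Such a vector is a sum of `w ⊗ b_i`, on which the map is injective because
the spaces `prims` are independent. -/
theorem OspData.sumMap_injective (h : OspData n f g d p) :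
    Function.Injective (sumMap n f g d p) := by
  have hG := sumMap_sumRight (k := g) (k' := rhoIFm n) (p := p) fun i w hw v => h.chainMap_g hw v
  have h3 (t : SumF (Prims n g d p)) (ht : sumRight _ (rhoIFm n) t = 0)
      (ht' : sumMap n f g d p t = 0) : t = 0 := by
    have h4 := sumRight_shiftF t
    rw [ht, map_zero, zero_add] at h4
    rw [← h4, sumMap_sumIncl] at ht'
    have h5 : sumLow _ t = 0 := (iSupIndep_prims g d p).dfinsupp_lsum_injective
      (ht'.trans (map_zero _).symm)
    rw [← h4, h5, map_zero]
  have h4 (m : ℕ) (t : SumF (Prims n g d p)) (hm : (sumRight _ (rhoIFm n) ^ m) t = 0)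
      (ht : sumMap n f g d p t = 0) : t = 0 := by
    induction m generalizing t with
    | zero => exact hm
    | succ m ih =>
      refine h3 t (ih _ ?_ ?_) ht
      · rw [← End.mul_apply, ← pow_succ, hm]
      · rw [hG, ht, map_zero]
  exact (injective_iff_map_eq_zero _).mpr fun t ht => h4 _ t (sumRight_rhoIFm_pow t) ht

/-- The image contains the vectors killed by `g`, which split into even and odd ones under `p`, and is
stable under `f`. -/
theorem OspData.sumMap_surjective (h : OspData n f g d p) :
    Function.Surjective (sumMap n f g d p) := by
  rw [← LinearMap.range_eq_top]
  have h1 (i : ℕ) (w : M) (hw : w ∈ lowest g d i) : w ∈ LinearMap.range (sumMap n f g d p) := by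
    rcases le_or_gt i n with hi | hi
    · have key (s : Fin 2) (u : M) (hu : u ∈ prims g d p (s, (⟨i, by omega⟩ : Fin (n + 1)))) :
          u ∈ LinearMap.range (sumMap n f g d p) :=
        ⟨_, (sumMap_mk (f := f) (s, (⟨i, by omega⟩ : Fin (n + 1))) ⟨u, hu⟩ (b n i i)).trans
          (chainMap_self hi u)⟩
      have hp : p w ∈ lowest g d i := by
        refine ⟨?_, End.mem_eigenspace_iff.mpr ?_⟩
        · change g (p w) = 0
          rw [← neg_neg (g (p w)), ← h.p_g, LinearMap.mem_ker.mp hw.1, map_zero, neg_zero]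
        · rw [← h.p_d, End.mem_eigenspace_iff.mp hw.2, map_smul]
      have h2 : w = (2⁻¹ : ℂ) • (w + p w) + (2⁻¹ : ℂ) • (w - p w) := by module
      rw [h2]
      refine add_mem (Submodule.smul_mem _ _ (key 0 _ ⟨add_mem hw hp, ?_⟩))
        (Submodule.smul_mem _ _ (key 1 _ ⟨(lowest g d i).sub_mem hw hp, ?_⟩))
      · refine End.mem_eigenspace_iff.mpr ?_
        rw [map_add, h.p_p, add_comm]
        simp
      · refine End.mem_eigenspace_iff.mpr ?_
        rw [map_sub, h.p_p]
        simp
    · rw [h.eq_zero_of_mem_lowest hi hw]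
      exact zero_mem _
  have h2 (j i : ℕ) (w : M) (hw : w ∈ lowest g d i) :
      (f ^ j) w ∈ LinearMap.range (sumMap n f g d p) := by
    induction j with
    | zero => exact h1 i w hw
    | succ j ih =>
      obtain ⟨t, ht⟩ := ih
      rw [pow_succ', End.mul_apply, ← ht,
        ← sumMap_sumRight (k' := rhoIFp n) fun i w hw v => h.chainMap_f hw v]
      exact LinearMap.mem_range_self _ _
  rw [eq_top_iff, ← h.top]
  refine iSup_le fun k x hx => ?_
  have h3 := h.mem_span_f_pow (k + 1) hx (h.g_pow_eq_zero hx)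
  refine Submodule.span_le.mpr ?_ h3
  rintro _ ⟨i, j, w, _, _, hw, rfl⟩
  exact h2 j i w hw

/-- The decomposition of a module with operators as in `OspData`. -/
def OspData.equiv (h : OspData n f g d p) :
    SumF (Prims n g d p) ≃ₗ[ℂ] M :=
  LinearEquiv.ofBijective (sumMap n f g d p) ⟨h.sumMap_injective, h.sumMap_surjective⟩

theorem OspData.equiv_mk (h : OspData n f g d p) (a : Idx n) (w : Prims n g d p a) (v : F n a.2) :
    h.equiv (sumMk _ a w v) = chainMap n f a.2 w v := sumMap_mk a w v

end Equiv

end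

section

variable {n : ℕ}

/-! ### Root vectors -/

theorem lie_T_of_eigen {X : G n} {u v : V n} {c d : ℂ} (hu : actV X u = c • u)
    (hv : actV X v = d • v) : ⁅X, T u v⁆ = (c + d) • T u v := by
  rw [lie_T, hu, hv, map_smul, map_smul, LinearMap.smul_apply, add_smul]

theorem actV_H_vA (k l : Fin n) : actV (H k) (vA l) = (-(if k = l then 1 else 0 : ℂ)) • vA l := by
  rw [H_eq, map_smul, LinearMap.smul_apply, actV_T, omega_vA', omega_vB', vA_eq l, cov_vAB, cov_vAB]
  by_cases h : k = l
  · subst h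
    simp only [reduceCtorEq, if_false, if_true, vA_eq]
    match_scalars
    all_goals first | ring1 | linear_combination I_sq
  · simp [h]

theorem actV_H_vB (k l : Fin n) : actV (H k) (vB l) = (if k = l then 1 else 0 : ℂ) • vB l := by
  rw [H_eq, map_smul, LinearMap.smul_apply, actV_T, omega_vA', omega_vB', vB_eq l, cov_vAB, cov_vAB]
  by_cases h : k = l
  · subst h
    simp only [reduceCtorEq, if_false, if_true, vB_eq]
    match_scalars
    all_goals first | ring1 | linear_combination I_sq | linear_combination -I_sq
  · simp [h]

/-- The element `∑ (n-k) H_k`, on which every positive root takes a positive integral value. -/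
def heightElt (n : ℕ) : G n := ∑ k : Fin n, ((n - k : ℕ) : ℂ) • H k

theorem heightElt_mem : heightElt n ∈ Submodule.span ℂ (Set.range (H (n := n))) :=
  sum_mem fun k _ => Submodule.smul_mem _ _ (Submodule.subset_span ⟨k, rfl⟩)

theorem actV_heightElt_vA (l : Fin n) : actV (heightElt n) (vA l) = (-((n - l : ℕ) : ℂ)) • vA l := by
  simp [heightElt, map_sum, LinearMap.sum_apply, actV_H_vA, -neg_sub]

theorem actV_heightElt_vB (l : Fin n) : actV (heightElt n) (vB l) = ((n - l : ℕ) : ℂ) • vB l := by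
  simp [heightElt, map_sum, LinearMap.sum_apply, actV_H_vB]

theorem T_vB_vB_mem (k l : Fin n) : T (vB k) (vB l) ∈ PosVec n := by
  have h (k l : Fin n) (hkl : k ≤ l) : T (vB k) (vB l) ∈ PosVec n := by
    refine ⟨_, Or.inr ⟨k, l, hkl, rfl⟩, fun m => ?_⟩
    rw [lie_T_of_eigen (actV_H_vB m k) (actV_H_vB m l)]
    simp only [Pi.add_apply, Pi.single_apply]
  rcases le_total k l with hkl | hkl
  · exact h k l hkl
  · rw [T_swap]; exact h l k hkl

theorem T_vB_vA_mem {k l : Fin n} (hkl : k < l) : T (vB k) (vA l) ∈ PosVec n := by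
  refine ⟨_, Or.inl ⟨k, l, hkl, rfl⟩, fun m => ?_⟩
  rw [lie_T_of_eigen (actV_H_vB m k) (actV_H_vA m l)]
  simp only [Pi.sub_apply, Pi.single_apply, sub_eq_add_neg]

/-- Root vectors of positive roots have positive integral height. -/
theorem heightElt_lie {μ : Fin n → ℂ} (hμ : μ ∈ PosRoots n) {X : G n} (hX : HasRoot X μ) :
    ∃ m : ℕ, m ≠ 0 ∧ ⁅heightElt n, X⁆ = (m : ℂ) • X := by
  have h1 : ⁅heightElt n, X⁆ = (∑ k : Fin n, ((n - k : ℕ) : ℂ) * μ k) • X := by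
    rw [heightElt, sum_lie, Finset.sum_smul]
    exact Finset.sum_congr rfl fun k _ => by rw [smul_lie, hX k, smul_smul]
  rcases hμ with ⟨i, j, hij, rfl⟩ | ⟨i, j, hij, rfl⟩
  · refine ⟨j - i, by omega, ?_⟩
    rw [h1]
    congr 1
    simp only [Pi.sub_apply, Pi.single_apply, mul_sub, mul_ite, mul_one, mul_zero,
      Finset.sum_sub_distrib, Finset.sum_ite_eq', Finset.mem_univ, if_true]
    rw [Nat.cast_sub i.2.le, Nat.cast_sub j.2.le, Nat.cast_sub (le_of_lt hij)]
    ring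
  · refine ⟨(n - i) + (n - j), by omega, ?_⟩
    rw [h1]
    congr 1
    simp only [Pi.add_apply, Pi.single_apply, mul_add, mul_ite, mul_one, mul_zero,
      Finset.sum_add_distrib, Finset.sum_ite_eq', Finset.mem_univ, if_true]
    push_cast
    rfl

/-- The root space decomposition: `sp(2n)` is spanned by the products of the `A_k` and `B_k`, which are
vectors of negative height, elements of the Cartan subalgebra or positive root vectors. -/
theorem span_root_vectors :
    ⊤ ≤ Submodule.span ℂ (NegHt (heightElt n) ∪ (Set.range H ∪ PosVec n)) := by
  rintro X -
  refine mem_of_T_mem (fun u v => ?_) X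
  set P := Submodule.span ℂ (NegHt (heightElt n) ∪ (Set.range H ∪ PosVec n))
  have hBB (k l) : T (vB k) (vB l) ∈ P :=
    Submodule.subset_span (Or.inr (Or.inr (T_vB_vB_mem k l)))
  have hAA (k l) : T (vA k) (vA l) ∈ P := by
    refine Submodule.subset_span (Or.inl ⟨(n - k) + (n - l), by omega, ?_⟩)
    rw [lie_T_of_eigen (actV_heightElt_vA k) (actV_heightElt_vA l)]
    push_cast
    congr 1
    ring
  have hBA (k l) : T (vB k) (vA l) ∈ P := by
    rcases lt_trichotomy k l with h | rfl | h
    · exact Submodule.subset_span (Or.inr (Or.inr (T_vB_vA_mem h)))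
    · have h1 : T (vB k) (vA k) = (2 * I)⁻¹ • H k := by
        rw [H_eq, smul_smul, inv_mul_cancel₀ (by simp), one_smul]
      rw [h1]
      exact Submodule.smul_mem _ _ (Submodule.subset_span (Or.inr (Or.inl ⟨k, rfl⟩)))
    · refine Submodule.subset_span (Or.inl ⟨k - l, by omega, ?_⟩)
      rw [lie_T_of_eigen (actV_heightElt_vB k) (actV_heightElt_vA l), Nat.cast_sub k.2.le,
        Nat.cast_sub l.2.le, Nat.cast_sub (le_of_lt h)]
      congr 1
      ring
  have hAB (k l) : T (vA k) (vB l) ∈ P := by rw [T_swap]; exact hBA l k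
  have hA (u l) : T u (vA l) ∈ P := by
    rw [eq_sum u]
    simp only [map_sum, map_add, map_smul, LinearMap.sum_apply, LinearMap.add_apply,
      LinearMap.smul_apply]
    exact sum_mem fun k _ =>
      add_mem (Submodule.smul_mem _ _ (hAA _ _)) (Submodule.smul_mem _ _ (hBA _ _))
  have hB (u l) : T u (vB l) ∈ P := by
    rw [eq_sum u]
    simp only [map_sum, map_add, map_smul, LinearMap.sum_apply, LinearMap.add_apply,
      LinearMap.smul_apply]
    exact sum_mem fun k _ =>
      add_mem (Submodule.smul_mem _ _ (hAB _ _)) (Submodule.smul_mem _ _ (hBB _ _))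
  rw [eq_sum v]
  simp only [map_sum, map_add, map_smul]
  exact sum_mem fun k _ =>
    add_mem (Submodule.smul_mem _ _ (hA _ _)) (Submodule.smul_mem _ _ (hB _ _))

/-! ### Invariant subspaces of `E` -/

/-- It suffices to check on the `T u v` that `σ` maps `p` to `q`. -/
theorem sigmaE_mem_of_T {p q : Submodule ℂ (E n)}
    (h : ∀ u v, ∀ x ∈ p, sigmaE n (T u v) x ∈ q) (X : G n) {x : E n} (hx : x ∈ p) :
    sigmaE n X x ∈ q :=
  mem_of_T_mem (p := q.comap ((sigmaHom n : G n →ₗ[ℂ] End ℂ (E n)).flip x))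
    (fun u v => h u v x hx) X

theorem sigmaE_mem_EK (X : G n) {x : E n} (hx : x ∈ EK n) : sigmaE n X x ∈ EK n := by
  refine sigmaE_mem_of_T (fun u v x hx => ?_) X hx
  have : EK n ≤ (EK n).comap (sigmaE n (T u v)) := by
    refine tensorSub_le fun α _ s hs => ?_
    rw [Submodule.mem_comap, sigmaE_T_tmul]
    refine add_mem ((EK n).sub_mem ((EK n).neg_mem ?_) ?_) (add_mem ?_ ?_)
    · exact tmul_mem_tensorSub trivial hs
    · exact tmul_mem_tensorSub trivial hs
    · exact Submodule.smul_mem _ _ (tmul_mem_tensorSub trivial (cliff_mem_SK _ (cliff_mem_SK _ hs)))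
    · exact Submodule.smul_mem _ _ (tmul_mem_tensorSub trivial (cliff_mem_SK _ (cliff_mem_SK _ hs)))
  exact this hx

theorem parE_sigmaE (X : G n) (x : E n) : parE n (sigmaE n X x) = sigmaE n X (parE n x) := by
  let p : Submodule ℂ (G n) :=
    { carrier := {X | ∀ x, parE n (sigmaE n X x) = sigmaE n X (parE n x)}
      add_mem' := fun {X Y} hX hY x => by
        have h := map_add (sigmaHom n : G n →ₗ[ℂ] End ℂ (E n)) X Y
        rw [show sigmaE n (X + Y) = sigmaE n X + sigmaE n Y from h, LinearMap.add_apply,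
          LinearMap.add_apply, map_add, hX, hY]
      zero_mem' := fun x => by
        have h := map_zero (sigmaHom n : G n →ₗ[ℂ] End ℂ (E n))
        rw [show sigmaE n 0 = 0 from h, LinearMap.zero_apply, LinearMap.zero_apply, map_zero]
      smul_mem' := fun c X hX x => by
        have h := map_smul (sigmaHom n : G n →ₗ[ℂ] End ℂ (E n)) c X
        rw [show sigmaE n (c • X) = c • sigmaE n X from h, LinearMap.smul_apply,
          LinearMap.smul_apply, map_smul, hX] }
  refine mem_of_T_mem (p := p) (fun u v x => ?_) X x
  refine end_tensor_ext (f := parE n * sigmaE n (T u v)) (g := sigmaE n (T u v) * parE n)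
    (fun α s => ?_) x
  simp only [End.mul_apply, sigmaE_T_tmul, map_add, map_sub, map_neg, map_smul, parE, onS_tmul,
    refl_cliff, neg_neg]

theorem parE_rhoFp (e : Module.Basis (Fin n ⊕ Fin n) ℂ (V n)) (x : E n) :
    parE n (rhoFp e x) = -rhoFp e (parE n x) := by
  have h : parE n * rhoFp e = (-1 : ℂ) • (rhoFp e * parE n) := TensorProduct.ext' fun α s => by
    simp only [End.mul_apply, LinearMap.smul_apply, rhoFp, LinearMap.sum_apply, parE, onS_tmul,
      TensorProduct.map_tmul, map_smul, map_sum, refl_cliff, TensorProduct.tmul_neg,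
      Finset.sum_neg_distrib]
    module
  refine (LinearMap.congr_fun h x).trans ?_
  rw [LinearMap.smul_apply, neg_one_smul, End.mul_apply]

theorem parE_rhoFm (e : Module.Basis (Fin n ⊕ Fin n) ℂ (V n)) (x : E n) :
    parE n (rhoFm e x) = -rhoFm e (parE n x) := by
  have h : parE n * rhoFm e = (-1 : ℂ) • (rhoFm e * parE n) := TensorProduct.ext' fun α s => by
    simp only [End.mul_apply, LinearMap.smul_apply, rhoFm, LinearMap.sum_apply, parE, onS_tmul,
      TensorProduct.map_tmul, map_smul, map_sum, refl_cliff, TensorProduct.tmul_neg,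
      Finset.sum_neg_distrib, smul_neg]
    module
  refine (LinearMap.congr_fun h x).trans ?_
  rw [LinearMap.smul_apply, neg_one_smul, End.mul_apply]

theorem parE_parE (x : E n) : parE n (parE n x) = x := by
  refine end_tensor_ext (f := parE n * parE n) (g := 1) (fun α s => ?_) x
  simp only [End.mul_apply, parE, onS_tmul, refl_refl, End.one_apply]

theorem parE_NF (x : E n) : parE n ((osc n).NF x) = (osc n).NF (parE n x) := by
  refine end_tensor_ext (f := parE n * (osc n).NF) (g := (osc n).NF * parE n) (fun α s => ?_) x
  simp only [End.mul_apply, Osc.NF, LinearMap.sum_apply, map_sum, Osc.num_apply, osc_c, osc_dc,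
    parE, onS_tmul]

theorem sigmaE_NF {e : Module.Basis (Fin n ⊕ Fin n) ℂ (V n)} (he : IsSymplecticBasis e) (X : G n)
    (x : E n) : sigmaE n X ((osc n).NF x) = (osc n).NF (sigmaE n X x) := by
  have h1 (x : E n) : (osc n).NF x =
      (n : ℂ) • x + (4 : ℂ) • (rhoFm e (rhoFp e x) + rhoFp e (rhoFm e x)) := by
    rw [(ospPair_rho he).anti]
    module
  have hp (x : E n) : sigmaE n X (rhoFp e x) = rhoFp e (sigmaE n X x) :=
    LinearMap.congr_fun (commute_sigmaE_rhoFp X e) x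
  have hm (x : E n) : sigmaE n X (rhoFm e x) = rhoFm e (sigmaE n X x) :=
    LinearMap.congr_fun (commute_sigmaE_rhoFm X he) x
  simp only [h1, map_add, map_smul, hp, hm]

theorem sigmaE_H (k : Fin n) (x : E n) :
    sigmaE n (H k) x = (osc n).R k k x - (1 / 2 : ℂ) • x := by
  rw [H_eq, sigmaE_BA, if_pos rfl]

theorem sigmaE_smul (c : ℂ) (X : G n) (x : E n) : sigmaE n (c • X) x = c • sigmaE n X x :=
  LinearMap.congr_fun (map_smul (sigmaHom n : G n →ₗ[ℂ] End ℂ (E n)) c X) x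

/-- The operator `ht` is the action of `heightElt`, up to the zero-point energy. -/
theorem ht_eq (x : E n) : (osc n).ht x =
    sigmaE n (heightElt n) x + (∑ k : Fin n, ((n - k : ℕ) : ℂ) / 2) • x := by
  have h1 : sigmaE n (heightElt n) x = ∑ k : Fin n, ((n - k : ℕ) : ℂ) • sigmaE n (H k) x := by
    change (sigmaHom n : G n →ₗ[ℂ] End ℂ (E n)) _ x = _
    rw [heightElt, map_sum, LinearMap.sum_apply]
    exact Finset.sum_congr rfl fun k _ => sigmaE_smul _ _ _
  rw [h1, Osc.ht_apply, Finset.sum_smul, ← Finset.sum_add_distrib]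
  refine Finset.sum_congr rfl fun k _ => ?_
  rw [sigmaE_H]
  module

theorem ht_sigmaE {X : G n} {m : ℂ} (hX : ⁅heightElt n, X⁆ = m • X) (x : E n) :
    (osc n).ht (sigmaE n X x) = sigmaE n X ((osc n).ht x) + m • sigmaE n X x := by
  have h1 : sigmaE n (heightElt n) (sigmaE n X x) =
      sigmaE n X (sigmaE n (heightElt n) x) + m • sigmaE n X x := by
    rw [← sigmaE_smul, ← hX, sigmaE_lie]
    exact (add_sub_cancel _ _).symm
  rw [ht_eq, ht_eq, h1, map_add, map_smul]
  abel

theorem ht_mem {N : Submodule ℂ (E n)} (hN : ∀ X, ∀ x ∈ N, sigmaE n X x ∈ N) {x : E n}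
    (hx : x ∈ N) : (osc n).ht x ∈ N := by
  rw [ht_eq]
  exact add_mem (hN _ x hx) (N.smul_mem _ hx)

/-! ### The irreducible modules in `E_K` -/

/-- The vectors of `E_K` killed by `ρ(f^-)` are the primitive vectors of the Fock space. -/
theorem prims_inf_EK {e : Module.Basis (Fin n ⊕ Fin n) ℂ (V n)} (he : IsSymplecticBasis e)
    (a : Idx n) : prims (rhoFm e) (osc n).NF (parE n) a ⊓ EK n =
    (osc n).prim (vac n) (parE n) a.1 a.2 := by
  ext x
  have hD : rhoFm e x = 0 ↔ (osc n).D x = 0 := by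
    rw [rhoFm_eq he, LinearMap.smul_apply]
    exact smul_eq_zero_iff_right (div_ne_zero r2_ne two_ne_zero)
  rw [Osc.mem_prim, fock_eq_EK, ← hD]
  constructor
  · rintro ⟨⟨⟨h1, h2⟩, h3⟩, h4⟩
    exact ⟨h4, End.mem_eigenspace_iff.mp h3, End.mem_eigenspace_iff.mp h2, h1⟩
  · rintro ⟨h4, h3, h2, h1⟩
    exact ⟨⟨⟨h1, End.mem_eigenspace_iff.mpr h2⟩, End.mem_eigenspace_iff.mpr h3⟩, h4⟩

theorem sigmaE_mem_prims {e : Module.Basis (Fin n ⊕ Fin n) ℂ (V n)} (he : IsSymplecticBasis e)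
    (a : Idx n) (X : G n) {x : E n}
    (hx : x ∈ prims (rhoFm e) (osc n).NF (parE n) a) :
    sigmaE n X x ∈ prims (rhoFm e) (osc n).NF (parE n) a := by
  obtain ⟨⟨h1, h2⟩, h3⟩ := hx
  refine ⟨⟨?_, End.mem_eigenspace_iff.mpr ?_⟩, End.mem_eigenspace_iff.mpr ?_⟩
  · have h4 : sigmaE n X (rhoFm e x) = rhoFm e (sigmaE n X x) :=
      LinearMap.congr_fun (commute_sigmaE_rhoFm X he) x
    change rhoFm e (sigmaE n X x) = 0
    rw [← h4, LinearMap.mem_ker.mp h1, map_zero]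
  · rw [← sigmaE_NF he, End.mem_eigenspace_iff.mp h2, map_smul]
  · rw [parE_sigmaE, End.mem_eigenspace_iff.mp h3, map_smul]

theorem sigmaE_mem_prim {e : Module.Basis (Fin n ⊕ Fin n) ℂ (V n)} (he : IsSymplecticBasis e)
    (a : Idx n) (X : G n) {x : E n}
    (hx : x ∈ (osc n).prim (vac n) (parE n) a.1 a.2) :
    sigmaE n X x ∈ (osc n).prim (vac n) (parE n) a.1 a.2 := by
  rw [← prims_inf_EK he] at hx ⊢
  exact ⟨sigmaE_mem_prims he a X hx.1, sigmaE_mem_EK X hx.2⟩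

theorem prim_le_fock (s : Fin 2) (i : ℕ) :
    (osc n).prim (vac n) (parE n) s i ≤ (osc n).fock (vac n) := inf_le_left

theorem fock_le_iSup_eigenspace (n : ℕ) :
    (osc n).fock (vac n) ≤ ⨆ μ, End.eigenspace (osc n).ht μ :=
  (Osc.fock_le_htLe (vacuum n)).trans (iSup_le fun _ => le_iSup (End.eigenspace (osc n).ht) _)

/-- A nonzero submodule of `prim` contains the highest weight vector, which is killed by the positive
root vectors: an eigenvector of the submodule for the largest eigenvalue of the height is singular,
hence a multiple of `hvec`. -/
theorem hvec_mem_of_invariant {t : Fin n} (ht : (t : ℕ) + 1 = n) {s : Fin 2} {i : ℕ} (hi : i ≤ n)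
    {N : Submodule ℂ (E n)} (hNK : N ≤ (osc n).prim (vac n) (parE n) s i)
    (hN : ∀ X, ∀ x ∈ N, sigmaE n X x ∈ N) (h0 : N ≠ ⊥) :
    (osc n).hvec (vac n) t s i ∈ N ∧ ∀ X ∈ PosVec n, sigmaE n X ((osc n).hvec (vac n) t s i) = 0 := by
  have hfock := hNK.trans (prim_le_fock s i)
  obtain ⟨w, hw, hw0, r, hr, hmax⟩ := exists_top_eigenvector (T := (osc n).ht)
    (fun x hx => ht_mem hN hx) (hfock.trans (fock_le_iSup_eigenspace n)) h0
    (fun x hx hx0 μ hμ =>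
      Osc.exists_le_of_mem_htLe (Osc.fock_le_htLe (vacuum n) (hfock hx)) hx0 hμ)
  have hpos : ∀ X ∈ PosVec n, sigmaE n X w = 0 := by
    rintro X ⟨μ, hμ, hX⟩
    obtain ⟨m, hm, hXm⟩ := heightElt_lie hμ hX
    refine hmax (r + m) (by omega) _ (hN X w hw) ?_
    rw [ht_sigmaE hXm, hr, map_smul, ← add_smul]
    push_cast
    rfl
  have hsing : (osc n).Sing w := by
    refine ⟨fun k l => ?_, fun k l hkl => ?_, (Osc.mem_prim.mp (hNK hw)).2.2.2⟩
    · rw [← sigmaE_BB, sigmaE_smul, hpos _ (T_vB_vB_mem k l), smul_zero]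
    · have h1 := sigmaE_BA k l w
      rw [if_neg hkl.ne, zero_smul, sub_zero] at h1
      rw [← h1, sigmaE_smul, hpos _ (T_vB_vA_mem hkl), smul_zero]
  obtain ⟨c, hc⟩ := Osc.eq_smul_hvec ht (vacuum n) hi (hNK hw) hsing
  have hc0 : c ≠ 0 := by
    rintro rfl
    exact hw0 (by rw [hc, zero_smul])
  have h1 : (osc n).hvec (vac n) t s i = c⁻¹ • w := by
    rw [hc, smul_smul, inv_mul_cancel₀ hc0, one_smul]
  rw [h1]
  exact ⟨N.smul_mem _ hw, fun X hX => by rw [map_smul, hpos X hX, smul_zero]⟩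

theorem hvec_ne_zero {t : Fin n} (ht : (t : ℕ) + 1 = n) {s : Fin 2} {i : ℕ} (hi : i ≤ n) :
    (osc n).hvec (vac n) t s i ≠ 0 := fun h => by
  have := Osc.form_hvec_ne_zero (isForm n) ht (vacuum n) formE_vac (s := s) hi
  rw [h, map_zero] at this
  exact this rfl

/-- The primitive vectors in `E_K` of given degree and parity form the irreducible module
`E^{ii}_±`. -/
theorem isEii_prim (hn : 1 ≤ n) {e : Module.Basis (Fin n ⊕ Fin n) ℂ (V n)}
    (he : IsSymplecticBasis e) (a : Idx n) :
    IsEii a.2 a.1 ((osc n).prim (vac n) (parE n) a.1 a.2) := by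
  let t : Fin n := ⟨n - 1, by omega⟩
  have ht : (t : ℕ) + 1 = n := Nat.sub_add_cancel hn
  have hi : (a.2 : ℕ) ≤ n := by omega
  have hK (X : G n) (x : E n) (hx : x ∈ (osc n).prim (vac n) (parE n) a.1 a.2) :=
    sigmaE_mem_prim he a X hx
  have hvK := Osc.hvec_mem_prim (s := a.1) ht (vacuum n) hi
  have hv0 := hvec_ne_zero ht (s := a.1) hi
  have hirr : ∀ N ≤ (osc n).prim (vac n) (parE n) a.1 a.2, (∀ X, ∀ x ∈ N, sigmaE n X x ∈ N) →
      N ≠ ⊥ → N = (osc n).prim (vac n) (parE n) a.1 a.2 := by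
    intro N hNK hN hN0
    refine eq_of_form (σ := sigmaE n) (T := (osc n).ht) (B := formE n) exists_formE_adjoint
      (isForm n).ht ((prim_le_fock _ _).trans (fock_le_iSup_eigenspace n)) (fun μ => ?_)
      (fun N hN x hx => ht_mem hN hx) hK
      (fun N hNK hN hN0 => (hvec_mem_of_invariant ht hi hNK hN hN0).1)
      (Osc.form_hvec_ne_zero (isForm n) ht (vacuum n) formE_vac hi) hNK hN hN0
    have := Osc.finite_eigenspace_ht (vacuum n) μ
    exact Submodule.finiteDimensional_of_le
      (inf_le_inf_right (End.eigenspace (osc n).ht μ) (prim_le_fock (n := n) a.1 a.2))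
  refine exists_equiv_L span_root_vectors heightElt_mem (sigmaHom n) hvK hv0
    (hvec_mem_of_invariant ht hi le_rfl hK ?_).2 (fun k => ?_) hK hirr
  · intro h
    rw [h] at hvK
    exact hv0 hvK
  · rw [sigmaHom_apply, sigmaE_H, Osc.R_self_hvec ht (vacuum n) hi, add_smul, add_sub_cancel_right]

end

section

variable {n : ℕ}

/-! ### The decompositions -/

/-- The map of direct sums induced by isomorphisms of the first tensor factors. -/
def sumCongr {N N' : Idx n → Type} [∀ a, AddCommGroup (N a)] [∀ a, Module ℂ (N a)]
    [∀ a, AddCommGroup (N' a)] [∀ a, Module ℂ (N' a)] (ψ : ∀ a, N a ≃ₗ[ℂ] N' a) :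
    SumF N ≃ₗ[ℂ] SumF N' :=
  DirectSum.congrLinearEquiv fun a => TensorProduct.congr (ψ a) (LinearEquiv.refl ℂ _)

theorem sumCongr_mk {N N' : Idx n → Type} [∀ a, AddCommGroup (N a)] [∀ a, Module ℂ (N a)]
    [∀ a, AddCommGroup (N' a)] [∀ a, Module ℂ (N' a)] (ψ : ∀ a, N a ≃ₗ[ℂ] N' a) (a : Idx n)
    (w : N a) (v : F n a.2) : sumCongr ψ (sumMk N a w v) = sumMk N' a (ψ a w) v :=
  (congrFun (DirectSum.coe_congrLinearEquiv _) _).trans (DirectSum.lmap_lof _ _ _)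

theorem chainMap_commute {M : Type*} [AddCommGroup M] [Module ℂ M] {f k : End ℂ M}
    (h : ∀ x, k (f x) = f (k x)) (i : ℕ) (w : M) (v : F n i) :
    k (chainMap n f i w v) = chainMap n f i (k w) v := by
  have hp (m : ℕ) (x : M) : k ((f ^ m) x) = (f ^ m) (k x) := by
    induction m with
    | zero => rfl
    | succ m ih => rw [pow_succ', End.mul_apply, h, ih, End.mul_apply]
  have : k ∘ₗ chainMap n f i w = chainMap n f i (k w) := end_F_ext fun j h1 h2 => by
    obtain ⟨m, rfl⟩ := Int.le.dest h1
    rw [LinearMap.comp_apply, chainMap_b i w h2, chainMap_b i _ h2, map_smul, hp]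
  exact LinearMap.congr_fun this v

/-- `ρ(h)` can be defined as for the modules `F_i`. -/
theorem rho_eq {e : Module.Basis (Fin n ⊕ Fin n) ℂ (V n)} (he : IsSymplecticBasis e) :
    rho e = ospLift fun
      | .eP => (2 : ℂ) • anti (rhoFp e) (rhoFp e)
      | .eM => -((2 : ℂ) • anti (rhoFm e) (rhoFm e))
      | .h0 => (2 : ℂ) • anti (rhoFp e) (rhoFm e)
      | .fP => rhoFp e
      | .fM => rhoFm e := by
  rw [rho]
  congr 1
  funext a
  cases a
  · rfl
  · rfl
  · exact (ospPair_rho he).half_commutator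
  · rfl
  · rfl

/-- The isomorphism for a `sp(2n) × osp(1|2)`-submodule `M` of `E`. -/
theorem exists_decomposition {e : Module.Basis (Fin n ⊕ Fin n) ℂ (V n)} (he : IsSymplecticBasis e)
    {M : Type} [AddCommGroup M] [Module ℂ M] {f g d p : End ℂ M} (h : OspData n f g d p)
    (ι : M →ₗ[ℂ] E n) (hf : ∀ x, ι (f x) = rhoFp e (ι x)) (hg : ∀ x, ι (g x) = rhoFm e (ι x))
    (hd : ∀ x, ι (d x) = (osc n).NF (ι x))
    {σ : G n → End ℂ M} (hσ : ∀ X x, ι (σ X x) = sigmaE n X (ι x))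
    (hσf : ∀ X x, σ X (f x) = f (σ X x))
    {N : Idx n → Type} [∀ a, AddCommGroup (N a)] [∀ a, Module ℂ (N a)]
    (ψ : ∀ a, N a ≃ₗ[ℂ] Prims n g d p a) {τ : G n → ∀ a, End ℂ (N a)}
    (hψ : ∀ X a w, ((ψ a (τ X a w) : Prims n g d p a) : M) = σ X (ψ a w)) :
    ∃ Φ : SumF N ≃ₗ[ℂ] M,
      (∀ X t, ι (Φ (sumLeft N (τ X) t)) = sigmaE n X (ι (Φ t))) ∧
      (∀ y t, ι (Φ (sumOsp N y t)) = rho e y (ι (Φ t))) ∧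
      (∀ q, ∀ t ∈ gradeSum N q, ι (Φ t) ∈ gradeE n q) := by
  have hmk (a w v) : (sumCongr ψ ≪≫ₗ h.equiv) (sumMk N a w v) = chainMap n f a.2 (ψ a w) v := by
    rw [LinearEquiv.trans_apply, sumCongr_mk, h.equiv_mk]
  refine ⟨sumCongr ψ ≪≫ₗ h.equiv, fun X t => ?_, fun y t => ?_, fun q t ht => ?_⟩
  · induction t using sumF_induction with
    | h0 => simp only [map_zero]
    | hadd x y hx hy => simp only [map_add, hx, hy]
    | h a w v =>
      rw [sumLeft_mk, hmk, hmk, hψ, ← chainMap_commute (hσf X), hσ]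
  · induction t using sumF_induction with
    | h0 => simp only [map_zero]
    | hadd x y hx hy => simp only [map_add, hx, hy]
    | h a w v =>
      rw [sumOsp_mk, hmk, hmk, rho_eq he]
      have hw := (ψ a w).2.1
      exact ospLift_intertwine_of_odd (ι ∘ₗ chainMap n f a.2 (ψ a w))
        (fun x => by rw [LinearMap.comp_apply, LinearMap.comp_apply, h.chainMap_f hw, hf])
        (fun x => by rw [LinearMap.comp_apply, LinearMap.comp_apply, h.chainMap_g hw, hg])
        rfl rfl y v
  · refine gradeSum_le (P := (gradeE n q).comap (ι ∘ₗ (sumCongr ψ ≪≫ₗ h.equiv).toLinearMap))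
      (fun a w v hv => ?_) ht
    change ι ((sumCongr ψ ≪≫ₗ h.equiv) (sumMk N a w v)) ∈ gradeE n q
    rw [hmk]
    refine h.toOspPair.chainMap_mem (ψ a w).2.1 (gr := fun q => (gradeE n q).comap ι)
      (fun k x hx => eigenspace_le_gradeE k (End.mem_eigenspace_iff.mpr ?_)) hv
    rw [← hd, End.mem_eigenspace_iff.mp hx, map_smul]

theorem ospData_rho {e : Module.Basis (Fin n ⊕ Fin n) ℂ (V n)} (he : IsSymplecticBasis e) :
    OspData n (rhoFp e) (rhoFm e) (osc n).NF (parE n) where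
  toOspPair := ospPair_rho he
  top := iSup_eigenspace_NF n
  bot _ hk _ hx := eq_zero_of_NF hk (End.mem_eigenspace_iff.mp hx)
  g_zero _ hx := rhoFm_eq_zero he hx
  p_p := parE_parE
  p_f := parE_rhoFp e
  p_g := parE_rhoFm e
  p_d := parE_NF

/-- The decomposition applies to graded submodules. -/
theorem OspData.restrict {M : Type*} [AddCommGroup M] [Module ℂ M] {f g d p : End ℂ M}
    (h : OspData n f g d p) {K : Submodule ℂ M} (hf : ∀ x ∈ K, f x ∈ K) (hg : ∀ x ∈ K, g x ∈ K)
    (hd : ∀ x ∈ K, d x ∈ K) (hp : ∀ x ∈ K, p x ∈ K)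
    (htop : K ≤ ⨆ k : ℕ, K ⊓ End.eigenspace d (k : ℂ)) :
    OspData n (f.restrict hf) (g.restrict hg) (d.restrict hd) (p.restrict hp) where
  anti x := Subtype.ext (h.anti x)
  deg_f x := Subtype.ext (h.deg_f x)
  deg_g x := Subtype.ext (h.deg_g x)
  top := by
    rw [eq_top_iff]
    rintro x -
    have h1 : ⨆ k : ℕ, K ⊓ End.eigenspace d (k : ℂ) ≤
        (⨆ k : ℕ, End.eigenspace (d.restrict hd) (k : ℂ)).map K.subtype := by
      refine iSup_le fun k y hy => ?_
      refine ⟨⟨y, hy.1⟩, Submodule.mem_iSup_of_mem k (End.mem_eigenspace_iff.mpr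
        (Subtype.ext (End.mem_eigenspace_iff.mp hy.2))), rfl⟩
    obtain ⟨y, hy, hyx⟩ := h1 (htop x.2)
    rwa [← Subtype.ext hyx]
  bot k hk x hx := Subtype.ext (h.bot k hk x (End.mem_eigenspace_iff.mpr
    (congrArg Subtype.val (End.mem_eigenspace_iff.mp hx))))
  g_zero x hx := Subtype.ext (h.g_zero x (End.mem_eigenspace_iff.mpr
    (congrArg Subtype.val (End.mem_eigenspace_iff.mp hx))))
  p_p x := Subtype.ext (h.p_p x)
  p_f x := Subtype.ext (h.p_f x)
  p_g x := Subtype.ext (h.p_g x)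
  p_d x := Subtype.ext (h.p_d x)

/-- The primitive vectors of a submodule. -/
def primsRestrict {M : Type} [AddCommGroup M] [Module ℂ M] {g d p : End ℂ M}
    {K : Submodule ℂ M} (hg : ∀ x ∈ K, g x ∈ K)
    (hd : ∀ x ∈ K, d x ∈ K) (hp : ∀ x ∈ K, p x ∈ K) (a : Idx n) :
    ↥(prims g d p a ⊓ K) ≃ₗ[ℂ] Prims n (g.restrict hg) (d.restrict hd) (p.restrict hp) a where
  toFun x := ⟨⟨x, x.2.2⟩, ⟨Subtype.ext x.2.1.1.1, End.mem_eigenspace_iff.mpr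
    (Subtype.ext (End.mem_eigenspace_iff.mp x.2.1.1.2))⟩, End.mem_eigenspace_iff.mpr
    (Subtype.ext (End.mem_eigenspace_iff.mp x.2.1.2))⟩
  invFun x := ⟨x.1.1, ⟨⟨congrArg Subtype.val x.2.1.1, End.mem_eigenspace_iff.mpr
    (congrArg Subtype.val (End.mem_eigenspace_iff.mp x.2.1.2))⟩, End.mem_eigenspace_iff.mpr
    (congrArg Subtype.val (End.mem_eigenspace_iff.mp x.2.2))⟩, x.1.2⟩
  map_add' _ _ := rfl
  map_smul' _ _ := rfl
  left_inv _ := rfl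
  right_inv _ := rfl

theorem rhoFp_mem_EK (e : Module.Basis (Fin n ⊕ Fin n) ℂ (V n)) {x : E n} (hx : x ∈ EK n) :
    rhoFp e x ∈ EK n := by
  have : EK n ≤ (EK n).comap (rhoFp e) := by
    refine tensorSub_le fun α _ s hs => ?_
    rw [Submodule.mem_comap, rhoFp, LinearMap.smul_apply, LinearMap.sum_apply]
    exact Submodule.smul_mem _ _ (sum_mem fun a _ => tmul_mem_tensorSub trivial (cliff_mem_SK _ hs))
  exact this hx

theorem rhoFm_mem_EK (e : Module.Basis (Fin n ⊕ Fin n) ℂ (V n)) {x : E n} (hx : x ∈ EK n) :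
    rhoFm e x ∈ EK n := by
  have : EK n ≤ (EK n).comap (rhoFm e) := by
    refine tensorSub_le fun α _ s hs => ?_
    rw [Submodule.mem_comap, rhoFm, LinearMap.smul_apply, LinearMap.sum_apply]
    refine Submodule.smul_mem _ _ (sum_mem fun a _ => ?_)
    rw [LinearMap.sum_apply]
    refine sum_mem fun a _ => ?_
    rw [LinearMap.smul_apply]
    refine Submodule.smul_mem _ _ ?_
    exact tmul_mem_tensorSub trivial (cliff_mem_SK _ hs)
  exact this hx

theorem NF_mem_EK {x : E n} (hx : x ∈ EK n) : (osc n).NF x ∈ EK n := by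
  rw [Osc.NF, LinearMap.sum_apply]
  refine sum_mem fun r _ => ?_
  have : EK n ≤ (EK n).comap ((osc n).num r) :=
    tensorSub_le fun α _ s hs => tmul_mem_tensorSub trivial hs
  exact this hx

theorem refl_mem_SK {s : S n} (hs : s ∈ SK n) : refl n s ∈ SK n := by
  have : SK n ≤ (SK n).comap (refl n) := by
    refine SK_le ?_ fun k s hs => ?_
    · rw [Submodule.mem_comap, refl_gauss]
      exact gauss_mem_SK
    · rw [Submodule.mem_comap, refl_mulX]
      exact neg_mem (mulX_mem_SK k hs)
  exact this hs

theorem parE_mem_EK {x : E n} (hx : x ∈ EK n) : parE n x ∈ EK n :=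
  map_mem_tensorSub (fun _ h => h) (fun _ hs => refl_mem_SK hs) hx

/-- `E_K` is the sum of its graded components. -/
theorem EK_le_iSup (n : ℕ) : EK n ≤ ⨆ k : ℕ, EK n ⊓ End.eigenspace (osc n).NF (k : ℂ) := by
  refine (tensorSub_top_le (SK n)).trans (iSup_mono fun k => le_inf ?_ ?_)
  · exact tensorSub_mono le_top le_rfl
  · rw [eigenspace_NF]
    exact tensorSub_mono le_rfl le_top

end

end SympHowe

open SympHowe

theorem theorem10 (n : ℕ) (hn : 1 ≤ n)
    (e : Module.Basis (Fin n ⊕ Fin n) ℂ (V n)) (he : IsSymplecticBasis e) :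
    -- `σ` and `ρ` are representations on `E` that commute with each other
    (∀ X Y : G n, sigmaE n ⁅X, Y⁆ = sigmaE n X * sigmaE n Y - sigmaE n Y * sigmaE n X) ∧
    IsOspRep (gradeE n) (rho e) ∧
    (∀ (X : G n) (y : Osp), sigmaE n X * rho e y = rho e y * sigmaE n X) ∧
    -- `ρ_i` is a representation on `F_i`
    (∀ i : ℕ, i ≤ n → Module.finrank ℂ (F n i) = 2 * n - 2 * i + 1 ∧
      IsOspRep (gradeF n i) (rhoI n i)) ∧
    -- the isomorphism for the polynomials times the Gaussian
    (∃ Φ : SumF (fun a : Idx n => Eii n a.2 a.1) ≃ₗ[ℂ] EK n,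
      (∀ X t, (Φ (sumLeft (fun a : Idx n => Eii n a.2 a.1) (fun a => actL (spinorWeight n a.2 a.2 a.1) X) t) : E n) =
        sigmaE n X (Φ t)) ∧
      (∀ y t, (Φ (sumOsp _ y t) : E n) = rho e y (Φ t)) ∧
      (∀ p, ∀ t ∈ gradeSum _ p, (Φ t : E n) ∈ gradeE n p)) ∧
    -- the isomorphism for the Schwartz space
    (∃ (W : Idx n → Submodule ℂ (E n))
      (hW : ∀ a X, ∀ w ∈ W a, sigmaE n X w ∈ W a),
      (∀ a, W a ≤ tensorSub (⋀[ℂ]^(a.2 : ℕ) (Module.Dual ℂ (V n))) (Spar n a.1)) ∧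
      (∀ a, IsEii a.2 a.1 (W a ⊓ EK n)) ∧
      ∃ Φ : SumF (fun a : Idx n => (W a : Type)) ≃ₗ[ℂ] E n,
        (∀ X t, Φ (sumLeft (fun a : Idx n => (W a : Type)) (fun a => (sigmaE n X).restrict (hW a X)) t) = sigmaE n X (Φ t)) ∧
        (∀ y t, Φ (sumOsp _ y t) = rho e y (Φ t)) ∧
        (∀ p, ∀ t ∈ gradeSum _ p, Φ t ∈ gradeE n p)) := by
  have hcf (X : G n) (x : E n) : sigmaE n X (rhoFp e x) = rhoFp e (sigmaE n X x) :=
    LinearMap.congr_fun (commute_sigmaE_rhoFp X e) x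
  refine ⟨sigmaE_lie, isOspRep_rho he, fun X y => commute_sigmaE_rho X he y,
    fun i hi => ⟨finrank_F hi, isOspRep_rhoI n i⟩, ?_, ?_⟩
  · have h := (ospData_rho he).restrict (K := EK n) (fun _ => rhoFp_mem_EK e)
      (fun _ => rhoFm_mem_EK e) (fun _ => NF_mem_EK) (fun _ => parE_mem_EK) (EK_le_iSup n)
    have hE (a : Idx n) : IsEii a.2 a.1 (prims (rhoFm e) (osc n).NF (parE n) a ⊓ EK n) := by
      rw [prims_inf_EK he]
      exact isEii_prim hn he a
    choose φ hφ using hE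
    exact exists_decomposition he h (EK n).subtype (fun _ => rfl) (fun _ => rfl) (fun _ => rfl)
      (σ := fun X => (sigmaE n X).restrict fun _ => sigmaE_mem_EK X) (fun _ _ => rfl)
      (fun X x => Subtype.ext (hcf X x)) (fun a => φ a ≪≫ₗ primsRestrict _ _ _ a)
      (τ := fun X a => actL (spinorWeight n a.2 a.2 a.1) X)
      (fun X a w => Subtype.ext (hφ a X w))
  · refine ⟨prims (rhoFm e) (osc n).NF (parE n), fun a X _ => sigmaE_mem_prims he a X,
      fun a => ?_, fun a => ?_, ?_⟩
    · rw [tensorSub_Spar]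
      exact le_inf inf_le_right (inf_le_left.trans inf_le_right)
    · rw [prims_inf_EK he]
      exact isEii_prim hn he a
    · exact exists_decomposition he (ospData_rho he) LinearMap.id (fun _ => rfl) (fun _ => rfl)
        (fun _ => rfl) (σ := sigmaE n) (fun _ _ => rfl) hcf (fun a => LinearEquiv.refl ℂ _)
        (τ := fun X a => (sigmaE n X).restrict fun _ => sigmaE_mem_prims he a X)
        (fun _ _ _ => rfl)

end
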